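/- **Setting.** Fix constants $\gamma,\tilde\gamma,R,K>0$, integers $k,k^\star\ge 1$, and a function $K_r:\mathbb R_{\ge0}\to\mathbb R_{>0}$. Let $m=m(n)$, $d=d(n)$ be positive integers and $p=md$, with $m/d\to\tilde\gamma$ and $p/n\to\gamma$ as $n\to\infty$. Let $\sigma:\mathbb R\to\mathbb R$ be four times differentiable with bounded derivatives of orders $1,\dots,4$, and suppose $\mathbb E[\sigma'(G)]=0$ and $\mathbb E[G\sigma'(G)]=0$ for $G\sim\mathcal N(0,1)$. For each $n$, let $w_1,\dots,w_m$ be i.i.d. uniform on the unit sphere of $\mathbb R^d$, let $z_1,\dots,z_n$ be i.i.d. $\mathcal N(0,I_d)$, and let $\epsilon_1,\dots,\epsilon_n$ be i.i.d. real random variables with $\|\epsilon_i\|_{\psi_2}\le K$, where $\|X\|_{\psi_2}=\inf\{t>0:\mathbb E\,e^{X^2/t^2}\le 2\}$. These three families are independent. Put $W=(w_1,\dots,w_m)$, $$x_i=\big(z_i\,\sigma'(w_1^{\mathsf T}z_i),\dots,z_i\,\sigma'(w_m^{\mathsf T}z_i)\big)\in\mathbb R^{p},\qquad \Sigma_W=\mathbb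 E[x_1x_1^{\mathsf T}\mid W].$$ Conditionally on $W$, let $g_1,\dots,g_n$ be i.i.d. $\mathcal N(0,\Sigma_W)$, with $(\epsilon_i)_{i\le n}$ independent of $(W,(g_i)_{i\le n})$. Let $X$ and $G$ be the matrices with rows $x_i$ and $g_i$. For $\theta=(\theta_{(1)},\dots,\theta_{(m)})\in\mathbb R^p$ with $\theta_{(j)}\in\mathbb R^d$, let $T_\theta\in\mathbb R^{d\times m}$ be the matrix with columns $\theta_{(1)},\dots,\theta_{(m)}$, and let $$\mathcal S_p=\{\theta\in\mathbb R^p:\|T_\theta\|_{\mathrm{op}}\le R/\sqrt d\}.$$ The following objects may all depend on $n$ (as may the law of the $\epsilon_i$), with the constants above fixed: * a $K$-Lipschitz function $\ell:\mathbb R^{k+1}\to[0,\infty)$ and a $K$-Lipschitz function $\eta:\mathbb R^{k^\star+1}\to\mathbb R$ (Euclidean norms); * a nonempty compact set $\mathcal C_p\subseteq\mathcal S_p$; * a deterministic matrix $\Theta^\star=(\theta^\star_1,\dots,\theta^\star_{k^\star})$ with columns $\theta_j^\star\in\mathcal S_p$; * a function $r:\mathbb R^{p\times k}\to\mathbb R$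 such that $|r(\Theta_0)-r(\Theta_1)|\le K_r(B)\|\Theta_0-\Theta_1\|_F$ for all $B>0$ and all $\Theta_0,\Theta_1$ with $\|\Theta_0\|_F,\|\Theta_1\|_F\le B$. For a matrix $U\in\mathbb R^{n\times p}$ with rows $u_1,\dots,u_n$ define $$\widehat R_n^\star(U)=\inf_{\Theta\in\mathcal C_p^{k}}\ \frac1n\sum_{i=1}^n\ell\big(\Theta^{\mathsf T}u_i;\,\eta(\Theta^{\star\mathsf T}u_i,\epsilon_i)\big)+r(\Theta),$$ where $\mathcal C_p^{k}$ is the set of $p\times k$ matrices all of whose columns lie in $\mathcal C_p$. **Corollary 3.1.** Under these assumptions: 1. For every bounded Lipschitz function $\psi:\mathbb R\to\mathbb R$, $$\lim_{n\to\infty}\Big|\mathbb E\big[\psi(\widehat R_n^\star(X))\big]-\mathbb E\big[\psi(\widehat R_n^\star(G))\big]\Big|=0.$$ 2. For all $\rho\in\mathbb R$ and $\delta>0$, $$\limsup_{n\to\infty}\Big[\mathbb P\big(\widehat R_n^\star(X)\ge\rho+\delta\big)-\mathbb P\big(\widehat R_n^\star(G)\ge\rho\big)\Big]\le0,$$ $$\limsup_{n\to\infty}\Big[\mathbb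 P\big(\widehat R_n^\star(X)\le\rho-\delta\big)-\mathbb P\big(\widehat R_n^\star(G)\le\rho\big)\Big]\le0.$$ In particular, $\lim_n\mathbb P(\widehat R_n^\star(X)\ge\rho+\delta)\le\lim_n\mathbb P(\widehat R_n^\star(G)\ge\rho)$ and $\lim_n\mathbb P(\widehat R_n^\star(X)\le\rho-\delta)\le\lim_n\mathbb P(\widehat R_n^\star(G)\le\rho)$ whenever these limits exist. 3. For every $\rho\in\mathbb R$, $\widehat R_n^\star(X)\to\rho$ in probability if and only if $\widehat R_n^\star(G)\to\rho$ in probability. -/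

import Mathlib

open MeasureTheory ProbabilityTheory Filter Topology
open scoped NNReal ENNReal

noncomputable section

namespace NTK

/-! ### Weights, features and covariance of the neural tangent model -/

/-- The input space `ℝ^d` with the Euclidean norm. -/
abbrev Input (d : ℕ) : Type := EuclideanSpace ℝ (Fin d)

/-- The feature space `ℝ^p`, `p = m d`, with the Euclidean norm. A vector
`θ = (θ_(1), …, θ_(m))` with blocks `θ_(j) ∈ ℝ^d` has coordinates `θ (j, a) = (θ_(j))_a`. -/
abbrev Feat (m d : ℕ) : Type := EuclideanSpace ℝ (Fin m × Fin d)

/-- The uniform distribution on the unit sphere of `ℝ^d`, as a measure on `ℝ^d`: the normalized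
surface measure (a probability measure for `d ≥ 1`). -/
def sphereUniform (d : ℕ) : Measure (Input d) :=
  Measure.map Subtype.val
    (((volume : Measure (Input d)).toSphere Set.univ)⁻¹ • (volume : Measure (Input d)).toSphere)

/-- The neural tangent feature map `φ(z) = (z σ'(⟨w_1, z⟩), …, z σ'(⟨w_m, z⟩))`. -/
def featureMap {m d : ℕ} (σ : ℝ → ℝ) (w : Fin m → Input d) (z : Input d) : Feat m d :=
  WithLp.toLp 2 fun q => z q.2 * deriv σ (inner ℝ (w q.1) z)

/-- `Σ_W = E[x xᵀ | W]` at `W = w`. Since `x = φ(z)` with `z` standard normal and independent of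
`W`, this is the second moment matrix of `φ(z)` with the weights frozen at `w`. -/
def featureCov {m d : ℕ} (σ : ℝ → ℝ) (w : Fin m → Input d) :
    Matrix (Fin m × Fin d) (Fin m × Fin d) ℝ :=
  Matrix.of fun q q' =>
    ∫ z, featureMap σ w z q * featureMap σ w z q' ∂(stdGaussian (Input d))

/-- The matrix `T_θ = (θ_(1), …, θ_(m)) ∈ ℝ^{d × m}`. -/
def blockMatrix {m d : ℕ} (θ : Feat m d) : Matrix (Fin d) (Fin m) ℝ :=
  Matrix.of fun a j => θ (j, a)

open scoped Matrix.Norms.L2Operator in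
/-- The set `S_p` of all `θ ∈ ℝ^p` with `‖T_θ‖_op ≤ R / √d`; the norm is the operator norm
for the Euclidean norms. -/
def paramSet (m d : ℕ) (R : ℝ) : Set (Feat m d) :=
  {θ | ‖blockMatrix θ‖ ≤ R / Real.sqrt d}

/-! ### Empirical risk minimization -/

/-- Parameter matrices `Θ = (θ_1, …, θ_k) ∈ ℝ^{p × k}`, as the tuple of their columns. The norm
is `(∑_j ‖θ_j‖²)^{1/2}`, the Frobenius norm. -/
abbrev Param (m d k : ℕ) : Type := PiLp 2 fun _ : Fin k => Feat m d

/-- `Θᵀ x ∈ ℝ^k`. -/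
def proj {m d k : ℕ} (Θ : Param m d k) (x : Feat m d) : EuclideanSpace ℝ (Fin k) :=
  WithLp.toLp 2 fun j => inner ℝ (Θ j) x

/-- `f : ℝ^k × ℝ → ℝ` is `K`-Lipschitz as a function on `ℝ^{k+1}` with the Euclidean norm. -/
def IsLip {k : ℕ} (K : ℝ≥0) (f : EuclideanSpace ℝ (Fin k) → ℝ → ℝ) : Prop :=
  LipschitzWith K fun v : WithLp 2 (EuclideanSpace ℝ (Fin k) × ℝ) => f v.fst v.snd

/-- The responses `y_i = η(Θ⋆ᵀ x_i, ε_i)`. -/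
def response {m d ks n : ℕ} (η : EuclideanSpace ℝ (Fin ks) → ℝ → ℝ) (Θs : Param m d ks)
    (X : Fin n → Feat m d) (e : Fin n → ℝ) : Fin n → ℝ :=
  fun i => η (proj Θs (X i)) (e i)

/-- The regularized empirical risk `n⁻¹ ∑_i ℓ(Θᵀ x_i; y_i) + r(Θ)`. -/
def empRisk {m d k n : ℕ} (ℓ : EuclideanSpace ℝ (Fin k) → ℝ → ℝ) (r : Param m d k → ℝ)
    (X : Fin n → Feat m d) (y : Fin n → ℝ) (Θ : Param m d k) : ℝ :=
  (1 / (n : ℝ)) * ∑ i, ℓ (proj Θ (X i)) (y i) + r Θ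

/-- The optimal empirical risk: the infimum of the empirical risk over `Θ ∈ C^k`. -/
def minRisk {m d k n : ℕ} (ℓ : EuclideanSpace ℝ (Fin k) → ℝ → ℝ) (r : Param m d k → ℝ)
    (C : Set (Feat m d)) (X : Fin n → Feat m d) (y : Fin n → ℝ) : ℝ :=
  sInf (empRisk ℓ r X y '' {Θ | ∀ j, Θ j ∈ C})

/-! ### Probability -/

/-- The subgaussian norm `‖X‖_{ψ₂} = inf {t > 0 : E exp(X² / t²) ≤ 2}` (`∞` if there is no such
`t`). -/
def psi2Norm {Ω : Type*} [MeasurableSpace Ω] (X : Ω → ℝ) (P : Measure Ω) : ℝ≥0∞ :=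
  sInf (ENNReal.ofReal '' {t : ℝ | 0 < t ∧
    ∫⁻ ω, ENNReal.ofReal (Real.exp ((X ω) ^ 2 / t ^ 2)) ∂P ≤ 2})

/-- The random variables at sample size `n`: weights `W = (w_1, …, w_m)` i.i.d. uniform on the
unit sphere, inputs `z = (z_1, …, z_n)` i.i.d. standard normal, noise `e = (e_1, …, e_n)` i.i.d.
with law `ν`, these three families being independent; and Gaussian features `g = (g_1, …, g_n)`
which, conditionally on `W`, are i.i.d. `N(0, Σ_W)`, with `e` independent of `(W, g)`. Nothing is
assumed on the joint law of `z` and `g`. -/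
structure IsModel {Ω : Type*} [MeasurableSpace Ω] {m d n : ℕ} (P : Measure Ω)
    [IsProbabilityMeasure P] (σ : ℝ → ℝ) (ν : Measure ℝ) (W : Ω → Fin m → Input d)
    (z : Ω → Fin n → Input d) (e : Ω → Fin n → ℝ) (g : Ω → Fin n → Feat m d) : Prop where
  law_W : HasLaw W (Measure.pi fun _ => sphereUniform d) P
  law_z : HasLaw z (Measure.pi fun _ => stdGaussian (Input d)) P
  law_e : HasLaw e (Measure.pi fun _ => ν) P
  indep_z_e : IndepFun z e P
  indep_W_ze : IndepFun W (fun ω => (z ω, e ω)) P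
  aemeasurable_g : AEMeasurable g P
  cond_law_g : ∀ᵐ w ∂(P.map W),
    condDistrib g W P w = Measure.pi fun _ => multivariateGaussian 0 (featureCov σ w)
  indep_Wg_e : IndepFun (fun ω => (W ω, g ω)) e P

/-- Convergence in probability to the constant `ρ`, for random variables that may live on
different probability spaces. -/
def TendstoInProb {Ω : ℕ → Type*} [∀ n, MeasurableSpace (Ω n)] (P : ∀ n, Measure (Ω n))
    (Y : ∀ n, Ω n → ℝ) (ρ : ℝ) : Prop :=
  ∀ δ : ℝ, 0 < δ → Tendsto (fun n => (P n).real {ω | δ ≤ |Y n ω - ρ|}) atTop (𝓝 0)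

end NTK

end

noncomputable section

namespace NTK

/-! ### Functions of polynomial growth and Gaussian integrals -/

/-! Freeze the weights at `w`. A linear functional of the features is `ntkF`, F(z) = ∑ ⟨θ_j, z⟩
σ'(⟨w_j, z⟩), a smooth function of a standard Gaussian vector. Directions θ are measured by q(θ) =
√d ‖T_θ‖_op (`opSeminorm`), whose ball of radius R is S_p. With overwhelming probability the
weights, too, form a matrix of bounded operator norm ω (`measure_not_bddFamily_le`), and all
estimates depend on `w` only through ω and ‖w_j‖ = 1.

Asymptotic normality. Integration by parts along rotations of a pair of independent Gaussian vectors
writes the characteristic function of F through inner products of ∇F at two correlated points. If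
these inner products concentrate, F is nearly normal (`norm_integral_cexp_sub_le`); they concentrate
by the Gaussian Poincaré inequality, because the Hessian of F is small on S_p. F is centered since
E[Gσ'(G)] = 0. The characteristic functions at θ of the features and of N(0, Σ_w) then differ by
O(q(θ)² d^(-1/4)), up to an exponentially small truncation error (`norm_integral_cexp_ntkF_sub_le`,
`norm_charFun_truncFeature_sub_le`).

Tails. Once the features are cut off where ‖z‖² > 3d, their functionals have bounded gradient, so
the Maurey–Pisier inequality makes them subgaussian uniformly over S_p (`lintegral_exp_truncF_le`).
The cutoff is invisible for all n inputs outside an event of probability n exp(-d/8), which vanishes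
because n is at most of order d².

Universality. For any two row laws that are subgaussian on the q-ball and have close characteristic
functions, the minimal risks are close in law (`exists_charFun_close_imp_optRisk_close`), with
constants that do not see the dimension. Subgaussian tails and a net of the q-ball bound all
quadratic forms ∑ ⟨θ, u_i⟩² by O(n) off an event of probability exp(-n). On the complement, clipping
the losses, restricting Θ to a net and replacing the minimum by a free energy at inverse temperature
nβ cost little (`RowsBounded.abs_optRisk_sub_freeEnergy_le`). The free energy is handled by
Lindeberg replacement, one row at a time. As a function of one row it is a constant minus (nβ)⁻¹ log
∑ w_Θ exp(-β h), so the second order Taylor terms sum to O(1/n), and the first order terms compare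
the means of this logarithm under the two laws. Approximating log by a polynomial reduces those to
moments of the partition function; a moment of order j is a convex combination, over j replicas, of
bounded Lipschitz functions of finitely many marginals, and these are controlled by characteristic
functions through Gaussian smoothing.

It remains to average over weights and noise (`IsModel.abs_integral_sub_le`) and to pass from
bounded Lipschitz test functions to the probabilities in the statement (`AsympEqInLaw`). -/

/-- `f` is dominated by a power of `1 + ‖x‖`. -/
def PolyGrowth {E F : Type*} [Norm E] [Norm F] (f : E → F) : Prop :=
  ∃ C : ℝ, ∃ N : ℕ, ∀ x, ‖f x‖ ≤ C * (1 + ‖x‖) ^ N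

namespace PolyGrowth

variable {E F G H : Type*} [NormedAddCommGroup E] [NormedAddCommGroup F] [NormedAddCommGroup G]
  [NormedAddCommGroup H]

lemma mono {f : E → F} {g : E → G} (hf : PolyGrowth f) (h : ∀ x, ‖g x‖ ≤ ‖f x‖) :
    PolyGrowth g := by
  obtain ⟨C, N, hC⟩ := hf
  exact ⟨C, N, fun x => (h x).trans (hC x)⟩

lemma of_bdd {f : E → F} {C : ℝ} (h : ∀ x, ‖f x‖ ≤ C) : PolyGrowth f :=
  ⟨C, 0, by simpa using h⟩

lemma const (c : F) : PolyGrowth (fun _ : E => c) := of_bdd (C := ‖c‖) fun _ => le_rfl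

lemma norm {f : E → F} (hf : PolyGrowth f) : PolyGrowth fun x => ‖f x‖ :=
  hf.mono fun _ => by simp

lemma exists_nonneg {f : E → F} (hf : PolyGrowth f) :
    ∃ C : ℝ, 0 ≤ C ∧ ∃ N : ℕ, ∀ x, ‖f x‖ ≤ C * (1 + ‖x‖) ^ N := by
  obtain ⟨C, N, hC⟩ := hf
  refine ⟨C, ?_, N, hC⟩
  have := (norm_nonneg _).trans (hC 0)
  simpa using this

lemma add {f g : E → F} (hf : PolyGrowth f) (hg : PolyGrowth g) :
    PolyGrowth fun x => f x + g x := by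
  obtain ⟨C, hC0, N, hC⟩ := hf.exists_nonneg
  obtain ⟨D, hD0, M, hD⟩ := hg.exists_nonneg
  refine ⟨C + D, N + M, fun x => ?_⟩
  have h1 : 1 ≤ 1 + ‖x‖ := by linarith [norm_nonneg x]
  calc ‖f x + g x‖ ≤ C * (1 + ‖x‖) ^ N + D * (1 + ‖x‖) ^ M :=
        (norm_add_le _ _).trans (add_le_add (hC x) (hD x))
    _ ≤ C * (1 + ‖x‖) ^ (N + M) + D * (1 + ‖x‖) ^ (N + M) := by
        gcongr
        · omega
        · omega
    _ = _ := by ring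

lemma of_mul {f : E → F} {g : E → G} {h : E → H} (hf : PolyGrowth f) (hg : PolyGrowth g)
    (hh : ∀ x, ‖h x‖ ≤ ‖f x‖ * ‖g x‖) : PolyGrowth h := by
  obtain ⟨C, hC0, N, hC⟩ := hf.exists_nonneg
  obtain ⟨D, hD0, M, hD⟩ := hg.exists_nonneg
  refine ⟨C * D, N + M, fun x => (hh x).trans ?_⟩
  calc ‖f x‖ * ‖g x‖ ≤ (C * (1 + ‖x‖) ^ N) * (D * (1 + ‖x‖) ^ M) := by
        gcongr
        · exact hC x
        · exact hD x
    _ = _ := by ring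

lemma mul {f g : E → ℝ} (hf : PolyGrowth f) (hg : PolyGrowth g) :
    PolyGrowth fun x => f x * g x := hf.of_mul hg fun _ => (norm_mul _ _).le

lemma smul [NormedSpace ℝ F] {f : E → ℝ} {g : E → F} (hf : PolyGrowth f) (hg : PolyGrowth g) :
    PolyGrowth fun x => f x • g x := hf.of_mul hg fun _ => norm_smul_le _ _

lemma pow {f : E → ℝ} (hf : PolyGrowth f) (k : ℕ) : PolyGrowth fun x => f x ^ k := by
  induction k with
  | zero => simpa using const (E := E) (1 : ℝ)
  | succ k ih => simpa [pow_succ] using ih.mul hf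

lemma inner [InnerProductSpace ℝ F] {f g : E → F} (hf : PolyGrowth f) (hg : PolyGrowth g) :
    PolyGrowth fun x => inner ℝ (f x) (g x) := hf.of_mul hg fun _ => norm_inner_le_norm _ _

lemma clm_apply [NormedSpace ℝ F] [NormedSpace ℝ G] {f : E → F →L[ℝ] G} {g : E → F}
    (hf : PolyGrowth f) (hg : PolyGrowth g) : PolyGrowth fun x => f x (g x) :=
  hf.of_mul hg fun _ => ContinuousLinearMap.le_opNorm _ _

lemma sum {ι : Type*} (s : Finset ι) {f : ι → E → F} (hf : ∀ i ∈ s, PolyGrowth (f i)) :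
    PolyGrowth fun x => ∑ i ∈ s, f i x := by
  classical
  induction s using Finset.induction_on with
  | empty => simpa using const (E := E) (0 : F)
  | insert i s hi ih =>
    simp_rw [Finset.sum_insert hi]
    exact (hf i (Finset.mem_insert_self i s)).add
      (ih fun j hj => hf j (Finset.mem_insert_of_mem hj))

lemma clm [NormedSpace ℝ E] [NormedSpace ℝ F] (L : E →L[ℝ] F) : PolyGrowth fun x => L x :=
  ⟨‖L‖, 1, fun x => (L.le_opNorm x).trans (by
    have := norm_nonneg L
    nlinarith [norm_nonneg x])⟩

lemma comp_clm [NormedSpace ℝ E] [NormedSpace ℝ G] {f : E → F} (hf : PolyGrowth f)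
    (L : G →L[ℝ] E) : PolyGrowth fun x => f (L x) := by
  obtain ⟨C, hC0, N, hC⟩ := hf.exists_nonneg
  refine ⟨C * (1 + ‖L‖) ^ N, N, fun x => (hC _).trans ?_⟩
  rw [mul_assoc, ← mul_pow]
  gcongr
  have := L.le_opNorm x
  nlinarith [norm_nonneg x, norm_nonneg L]

lemma comp_snd {f : F → G} (hf : PolyGrowth f) : PolyGrowth fun p : E × F => f p.2 := by
  obtain ⟨C, hC0, N, hC⟩ := hf.exists_nonneg
  refine ⟨C, N, fun p => (hC _).trans ?_⟩
  gcongr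
  exact norm_snd_le p

lemma comp_fst {f : E → G} (hf : PolyGrowth f) : PolyGrowth fun p : E × F => f p.1 := by
  obtain ⟨C, hC0, N, hC⟩ := hf.exists_nonneg
  refine ⟨C, N, fun p => (hC _).trans ?_⟩
  gcongr
  exact norm_fst_le p

lemma integrable [NormedSpace ℝ E] [MeasurableSpace E] [BorelSpace E] [CompleteSpace E]
    [SecondCountableTopology E] {f : E → F} (hf : PolyGrowth f) {γ : Measure E} [IsGaussian γ]
    (hm : AEStronglyMeasurable f γ) : Integrable f γ := by
  obtain ⟨C, N, hC⟩ := hf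
  have h0 : MemLp (fun x : E => ‖x‖) (N : ℝ≥0∞) γ :=
    MemLp.norm (f := fun x : E => x) (IsGaussian.memLp_id γ N (ENNReal.natCast_ne_top N))
  have hc : MemLp (fun _ : E => (1 : ℝ)) (N : ℝ≥0∞) γ := memLp_const 1
  have h1 : MemLp (fun x : E => 1 + ‖x‖) (N : ℝ≥0∞) γ := hc.add h0
  have h2 : Integrable (fun x : E => (1 + ‖x‖) ^ N) γ := by
    have := h1.integrable_norm_pow'
    refine this.congr (ae_of_all _ fun x => ?_)
    have : 0 ≤ 1 + ‖x‖ := by positivity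
    simp [abs_of_nonneg this]
  exact (h2.const_mul C).mono' hm (ae_of_all _ hC)

end PolyGrowth

/-! ### Rotations of a pair of independent Gaussian vectors -/

section Interpolation

variable {V : Type*} [NormedAddCommGroup V] [NormedSpace ℝ V]

/-- The increment of `H` along the quarter circle from `p.1` to `p.2`. -/
lemma sub_eq_integral_rotation {F : Type*} [NormedAddCommGroup F] [NormedSpace ℝ F]
    [CompleteSpace F] {H : V → F} {H' : V → V →L[ℝ] F}
    (hH : ∀ x, HasFDerivAt H (H' x) x) (hH' : Continuous H') (p : V × V) :
    H p.2 - H p.1 = ∫ a in (0 : ℝ)..(Real.pi / 2),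
      H' (ContinuousLinearMap.rotation a p).1 (ContinuousLinearMap.rotation a p).2 := by
  have hd : ∀ a : ℝ, HasDerivAt (fun a : ℝ => Real.cos a • p.1 + Real.sin a • p.2)
      (-Real.sin a • p.1 + Real.cos a • p.2) a := fun a =>
    ((Real.hasDerivAt_cos a).smul_const p.1).add ((Real.hasDerivAt_sin a).smul_const p.2)
  have hd2 : ∀ a : ℝ, HasDerivAt (fun a : ℝ => H (Real.cos a • p.1 + Real.sin a • p.2))
      (H' (Real.cos a • p.1 + Real.sin a • p.2) (-Real.sin a • p.1 + Real.cos a • p.2)) a :=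
    fun a => (hH _).comp_hasDerivAt a (hd a)
  have hcont : Continuous fun a : ℝ =>
      H' (Real.cos a • p.1 + Real.sin a • p.2) (-Real.sin a • p.1 + Real.cos a • p.2) := by
    fun_prop
  have := intervalIntegral.integral_eq_sub_of_hasDerivAt (a := 0) (b := Real.pi / 2)
    (fun a _ => hd2 a) (hcont.intervalIntegrable _ _)
  simp only [ContinuousLinearMap.rotation_apply]
  rw [this]
  simp

variable [MeasurableSpace V] [BorelSpace V] [SecondCountableTopology V] [CompleteSpace V]
  {γ : Measure V} [IsGaussian γ]

lemma lintegral_comp_rotation (hγ : γ[id] = 0) (a : ℝ) {f : V × V → ℝ≥0∞} (hf : Measurable f) :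
    ∫⁻ p, f (ContinuousLinearMap.rotation a p) ∂(γ.prod γ) = ∫⁻ p, f p ∂(γ.prod γ) := by
  conv_rhs => rw [← IsGaussian.map_rotation_eq_self hγ a]
  rw [lintegral_map hf (by fun_prop)]

lemma integral_comp_rotation {F : Type*} [NormedAddCommGroup F] [NormedSpace ℝ F]
    (hγ : γ[id] = 0) (a : ℝ) {f : V × V → F} (hf : AEStronglyMeasurable f (γ.prod γ)) :
    ∫ p, f (ContinuousLinearMap.rotation a p) ∂(γ.prod γ) = ∫ p, f p ∂(γ.prod γ) := by
  conv_rhs => rw [← IsGaussian.map_rotation_eq_self hγ a]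
  rw [integral_map (by fun_prop)]
  rwa [IsGaussian.map_rotation_eq_self hγ a]

/-- The Maurey–Pisier inequality: convex moments of the fluctuations of a smooth function of a
centered Gaussian vector are controlled by those of its derivative. -/
theorem lintegral_convex_sub_le (hγ : γ[id] = 0) {H : V → ℝ} {H' : V → V →L[ℝ] ℝ}
    (hH : ∀ x, HasFDerivAt H (H' x) x) (hH' : Continuous H') {Ψ : ℝ → ℝ}
    (hΨ : ConvexOn ℝ Set.univ Ψ) (hΨc : Continuous Ψ) (hΨ0 : ∀ x, 0 ≤ Ψ x) :
    ∫⁻ p, ENNReal.ofReal (Ψ (H p.2 - H p.1)) ∂(γ.prod γ) ≤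
      ∫⁻ p, ENNReal.ofReal (Ψ (Real.pi / 2 * H' p.1 p.2)) ∂(γ.prod γ) := by
  set I : Set ℝ := Set.Ioc 0 (Real.pi / 2) with hI
  have hpi : 0 < Real.pi / 2 := by positivity
  have hvol : volume I = ENNReal.ofReal (Real.pi / 2) := by simp [hI, Real.volume_Ioc]
  set J : V × V → ℝ≥0∞ := fun p => ENNReal.ofReal (Ψ (Real.pi / 2 * H' p.1 p.2)) with hJ
  have hJm : Measurable J := by
    have : Continuous fun p : V × V => Ψ (Real.pi / 2 * H' p.1 p.2) := by fun_prop
    exact this.measurable.ennreal_ofReal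
  have hrotc : Continuous fun q : ℝ × (V × V) => ContinuousLinearMap.rotation q.1 q.2 := by
    simp only [ContinuousLinearMap.rotation_apply]
    fun_prop
  -- The increment is the uniform average over the quarter circle of π/2 times the speed of `H`, so
  -- Jensen's inequality applies for each fixed pair.
  have key : ∀ p : V × V, ENNReal.ofReal (Ψ (H p.2 - H p.1)) ≤
      (ENNReal.ofReal (Real.pi / 2))⁻¹ *
        ∫⁻ a in I, J (ContinuousLinearMap.rotation a p) := by
    intro p
    set D : ℝ → ℝ := fun a => Real.pi / 2 *
      H' (ContinuousLinearMap.rotation a p).1 (ContinuousLinearMap.rotation a p).2 with hD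
    have hDc : Continuous D := by
      simp only [hD, ContinuousLinearMap.rotation_apply]
      fun_prop
    have hint : ∀ {f : ℝ → ℝ}, Continuous f → IntegrableOn f I := fun hf =>
      (hf.integrableOn_Icc (a := 0) (b := Real.pi / 2)).mono_set Set.Ioc_subset_Icc_self
    have h1 : H p.2 - H p.1 = ⨍ a in I, D a := by
      rw [sub_eq_integral_rotation hH hH', setAverage_eq,
        intervalIntegral.integral_of_le hpi.le, measureReal_def, hvol,
        ENNReal.toReal_ofReal hpi.le, hD, integral_const_mul, smul_eq_mul, inv_mul_cancel_left₀]
      exact hpi.ne'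
    have h2 : Ψ (⨍ a in I, D a) ≤ ⨍ a in I, Ψ (D a) :=
      hΨ.map_set_average_le hΨc.continuousOn isClosed_univ (by simp [hvol, Real.pi_pos])
        (by simp [hvol]) (by simp) (hint hDc) (hint (hΨc.comp hDc))
    rw [h1]
    refine (ENNReal.ofReal_le_ofReal h2).trans ?_
    rw [setAverage_eq, smul_eq_mul, ENNReal.ofReal_mul (inv_nonneg.2 measureReal_nonneg),
      measureReal_def, hvol, ENNReal.toReal_ofReal hpi.le, ENNReal.ofReal_inv_of_pos hpi,
      ofReal_integral_eq_lintegral_ofReal (f := fun a => Ψ (D a)) (hint (hΨc.comp hDc))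
        (ae_of_all _ fun a => hΨ0 _)]
  calc ∫⁻ p, ENNReal.ofReal (Ψ (H p.2 - H p.1)) ∂(γ.prod γ)
      ≤ ∫⁻ p, ((ENNReal.ofReal (Real.pi / 2))⁻¹ *
        ∫⁻ a in I, J (ContinuousLinearMap.rotation a p)) ∂(γ.prod γ) := lintegral_mono key
    _ = (ENNReal.ofReal (Real.pi / 2))⁻¹ *
        ∫⁻ a in I, ∫⁻ p, J (ContinuousLinearMap.rotation a p) ∂(γ.prod γ) := by
        rw [lintegral_const_mul', lintegral_lintegral_swap]
        · exact (hJm.comp (hrotc.measurable.comp measurable_swap)).aemeasurable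
        · simp [Real.pi_pos]
    -- The position and the velocity on the circle are again independent with law γ, whatever the
    -- angle.
    _ = (ENNReal.ofReal (Real.pi / 2))⁻¹ * ∫⁻ a in I, ∫⁻ p, J p ∂(γ.prod γ) := by
        simp_rw [lintegral_comp_rotation hγ _ hJm]
    _ = ∫⁻ p, J p ∂(γ.prod γ) := by
        rw [setLIntegral_const, hvol, mul_comm, mul_assoc, ENNReal.mul_inv_cancel, mul_one]
        · simp [Real.pi_pos]
        · simp

end Interpolation

lemma PolyGrowth.comp {E F G : Type*} [NormedAddCommGroup E] [NormedAddCommGroup F]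
    [NormedAddCommGroup G] {f : F → G} {g : E → F} (hf : PolyGrowth f) (hg : PolyGrowth g) :
    PolyGrowth fun x => f (g x) := by
  obtain ⟨C, hC0, N, hC⟩ := hf.exists_nonneg
  obtain ⟨D, hD0, M, hD⟩ := hg.exists_nonneg
  refine ⟨C * (1 + D) ^ N, M * N, fun x => (hC _).trans ?_⟩
  rw [mul_assoc, pow_mul, ← mul_pow]
  have h1 : (1 : ℝ) ≤ (1 + ‖x‖) ^ M := one_le_pow₀ (by linarith [norm_nonneg x])
  gcongr
  linarith [hD x]

/-- An integrable bound uniform in the angle. The range |a| ≤ 2 covers the quarter circle, since π ≤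
4, and also the unit ball around 0 in which integrals are differentiated. -/
lemma PolyGrowth.exists_bound {E F : Type*} [NormedAddCommGroup E] [NormedAddCommGroup F]
    {f : ℝ × E → F} (hf : PolyGrowth f) :
    ∃ g : E → ℝ, PolyGrowth g ∧ Continuous g ∧ ∀ a, |a| ≤ 2 → ∀ p, ‖f (a, p)‖ ≤ g p := by
  obtain ⟨C, hC0, N, hC⟩ := hf.exists_nonneg
  refine ⟨fun p => C * (3 + ‖p‖) ^ N, ?_, by fun_prop, fun a ha p => (hC _).trans ?_⟩
  · refine ⟨C * 3 ^ N, N, fun p => ?_⟩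
    have h3 : 0 ≤ 3 + ‖p‖ := by positivity
    have h4 : ‖C * (3 + ‖p‖) ^ N‖ = C * (3 + ‖p‖) ^ N := Real.norm_of_nonneg (by positivity)
    rw [h4, mul_assoc, ← mul_pow]
    gcongr
    linarith [norm_nonneg p]
  · have : ‖(a, p)‖ ≤ 2 + ‖p‖ := by
      rw [Prod.norm_def]
      exact max_le (by simpa using ha.trans (by linarith [norm_nonneg p]))
        (by simp)
    have h4 : 1 + ‖(a, p)‖ ≤ 3 + ‖p‖ := by linarith
    exact mul_le_mul_of_nonneg_left (pow_le_pow_left₀ (by positivity) h4 N) hC0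

section

variable {E : Type*} [NormedAddCommGroup E] [NormedSpace ℝ E] [MeasurableSpace E] [BorelSpace E]
  [CompleteSpace E] [SecondCountableTopology E] {γ : Measure E} [IsGaussian γ]
  {F : Type*} [NormedAddCommGroup F]

lemma PolyGrowth.integrable_interval {f : ℝ × E → F} (hf : PolyGrowth f) (hc : Continuous f) :
    Integrable f ((volume.restrict (Set.uIoc 0 (Real.pi / 2))).prod γ) := by
  obtain ⟨g, hg, hgc, hb⟩ := hf.exists_bound
  have hgi : Integrable g γ := hg.integrable hgc.aestronglyMeasurable
  have : IsFiniteMeasure (volume.restrict (Set.uIoc 0 (Real.pi / 2))) :=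
    ⟨by rw [Measure.restrict_apply_univ, Set.uIoc, Real.volume_Ioc]; exact ENNReal.ofReal_lt_top⟩
  refine (hgi.comp_snd (volume.restrict (Set.uIoc 0 (Real.pi / 2)))).mono'
    hc.aestronglyMeasurable ?_
  have h1 : ∀ᵐ a ∂(volume.restrict (Set.uIoc 0 (Real.pi / 2))), |a| ≤ 2 := by
    filter_upwards [ae_restrict_mem measurableSet_uIoc] with a ha
    rw [Set.uIoc_of_le (by positivity)] at ha
    rw [abs_of_pos ha.1]
    linarith [ha.2, Real.pi_le_four]
  have h2 : ∀ᵐ z ∂((volume.restrict (Set.uIoc 0 (Real.pi / 2))).prod γ), |z.1| ≤ 2 :=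
    Measure.quasiMeasurePreserving_fst.ae h1
  filter_upwards [h2] with z hz using hb z.1 hz z.2

end

/-! ### Gaussian integration by parts -/

section

variable {V : Type*} [NormedAddCommGroup V] [InnerProductSpace ℝ V]

lemma polyGrowth_rotation_fst :
    PolyGrowth fun q : ℝ × V × V => Real.cos q.1 • q.2.1 + Real.sin q.1 • q.2.2 := by
  have hx : PolyGrowth fun q : ℝ × V × V => q.2.1 :=
    PolyGrowth.clm ((ContinuousLinearMap.fst ℝ V V).comp (ContinuousLinearMap.snd ℝ ℝ (V × V)))
  have hy : PolyGrowth fun q : ℝ × V × V => q.2.2 :=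
    PolyGrowth.clm ((ContinuousLinearMap.snd ℝ V V).comp (ContinuousLinearMap.snd ℝ ℝ (V × V)))
  exact ((PolyGrowth.of_bdd (C := 1) fun q => by
      simpa using Real.abs_cos_le_one q.1).smul hx).add
    ((PolyGrowth.of_bdd (C := 1) fun q => by simpa using Real.abs_sin_le_one q.1).smul hy)

lemma polyGrowth_rotation_snd :
    PolyGrowth fun q : ℝ × V × V => -Real.sin q.1 • q.2.1 + Real.cos q.1 • q.2.2 := by
  have hx : PolyGrowth fun q : ℝ × V × V => q.2.1 :=
    PolyGrowth.clm ((ContinuousLinearMap.fst ℝ V V).comp (ContinuousLinearMap.snd ℝ ℝ (V × V)))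
  have hy : PolyGrowth fun q : ℝ × V × V => q.2.2 :=
    PolyGrowth.clm ((ContinuousLinearMap.snd ℝ V V).comp (ContinuousLinearMap.snd ℝ ℝ (V × V)))
  exact ((PolyGrowth.of_bdd (C := 1) fun q => by
      simpa using Real.abs_sin_le_one q.1).smul hx).add
    ((PolyGrowth.of_bdd (C := 1) fun q => by simpa using Real.abs_cos_le_one q.1).smul hy)

lemma polyGrowth_rotation_inv :
    PolyGrowth fun q : ℝ × V × V => Real.cos q.1 • q.2.1 - Real.sin q.1 • q.2.2 := by
  refine (polyGrowth_rotation_fst.comp (E := ℝ × V × V) (F := ℝ × V × V)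
    (g := fun q => (-q.1, q.2)) ⟨1, 1, fun q => ?_⟩).mono fun q => ?_
  · have : ‖(-q.1, q.2)‖ = ‖q‖ := by simp [Prod.norm_def]
    rw [this]
    linarith
  · simp [sub_eq_add_neg]

variable [FiniteDimensional ℝ V] [MeasurableSpace V] [BorelSpace V]

lemma stdGaussian_id_eq_zero : (stdGaussian V)[id] = 0 := by simp

lemma integral_inner_smul_id_stdGaussian (v : V) :
    ∫ y, inner ℝ v y • y ∂(stdGaussian V) = v := by
  have hi : Integrable (fun y : V => inner ℝ v y • y) (stdGaussian V) :=
    ((PolyGrowth.clm (innerSL ℝ v)).smul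
      (PolyGrowth.clm (ContinuousLinearMap.id ℝ V))).integrable
      (by fun_prop : Continuous fun y : V => inner ℝ v y • y).aestronglyMeasurable
  refine ext_inner_left ℝ fun w => ?_
  rw [← integral_inner hi w]
  have h := covarianceBilin_apply (μ := stdGaussian V) IsGaussian.memLp_two_id w v
  rw [covarianceBilin_stdGaussian] at h
  simp only [innerSL_apply_apply ℝ, id_eq, integral_id_stdGaussian, sub_zero] at h
  rw [h]
  exact integral_congr_ae (ae_of_all _ fun y => by simp [inner_smul_right, mul_comm])

variable {F : Type*} [NormedAddCommGroup F] [NormedSpace ℝ F] [CompleteSpace F]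

/-- Gaussian integration by parts. -/
theorem integral_inner_smul_stdGaussian {Φ : V → F} {Φ' : V → V →L[ℝ] F}
    (hΦ : ∀ x, HasFDerivAt Φ (Φ' x) x) (hc : Continuous Φ') (hg : PolyGrowth Φ)
    (hg' : PolyGrowth Φ') (v : V) :
    ∫ x, inner ℝ v x • Φ x ∂(stdGaussian V) = ∫ x, Φ' x v ∂(stdGaussian V) := by
  set γ := stdGaussian V with hγ
  have hΦc : Continuous Φ := continuous_iff_continuousAt.2 fun x => (hΦ x).continuousAt
  have hv1 : PolyGrowth fun p : V × V => inner ℝ v p.2 :=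
    (PolyGrowth.clm (innerSL ℝ v)).comp_snd
  have hint : ∀ {f : V × V → F}, PolyGrowth f → Continuous f → Integrable f (γ.prod γ) :=
    fun h1 h2 => h1.integrable h2.aestronglyMeasurable
  set A : F := ∫ x, inner ℝ v x • Φ x ∂γ with hA
  -- The function of a on the left is evaluated twice. Rotation invariance gives sin a • A here; its
  -- derivative at a = 0 is computed next under the integral sign, and comparing the two derivatives
  -- yields the identity.
  have hgval : ∀ a : ℝ, ∫ p, inner ℝ v p.2 • Φ (Real.cos a • p.1 + Real.sin a • p.2) ∂(γ.prod γ)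
      = Real.sin a • A := by
    intro a
    set f : V × V → F := fun q =>
      inner ℝ v (Real.sin a • q.1 + Real.cos a • q.2) • Φ q.1 with hf
    have hfc : Continuous f := by fun_prop
    have h1 := integral_comp_rotation (γ := γ) stdGaussian_id_eq_zero a
      (f := f) hfc.aestronglyMeasurable
    have h2 : ∀ p : V × V, f (ContinuousLinearMap.rotation a p) =
        inner ℝ v p.2 • Φ (Real.cos a • p.1 + Real.sin a • p.2) := by
      intro p
      simp only [hf, ContinuousLinearMap.rotation_apply]
      congr 2
      have : Real.sin a • (Real.cos a • p.1 + Real.sin a • p.2)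
          + Real.cos a • (-Real.sin a • p.1 + Real.cos a • p.2) =
          (Real.sin a ^ 2 + Real.cos a ^ 2) • p.2 := by module
      rw [this, Real.sin_sq_add_cos_sq, one_smul]
    simp_rw [h2] at h1
    rw [h1]
    have h3 : ∀ q : V × V, f q = Real.sin a • (inner ℝ v q.1 • Φ q.1)
        + Real.cos a • (inner ℝ v q.2 • Φ q.1) := by
      intro q
      simp only [hf, inner_add_right, inner_smul_right]
      module
    have hi1 : Integrable (fun q : V × V => inner ℝ v q.1 • Φ q.1) (γ.prod γ) :=
      hint ((PolyGrowth.clm (innerSL ℝ v)).comp_fst.smul hg.comp_fst) (by fun_prop)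
    have hi2 : Integrable (fun q : V × V => inner ℝ v q.2 • Φ q.1) (γ.prod γ) :=
      hint (hv1.smul hg.comp_fst) (by fun_prop)
    simp_rw [h3]
    have hi1' : Integrable (fun q : V × V => Real.sin a • (inner ℝ v q.1 • Φ q.1)) (γ.prod γ) :=
      hi1.smul _
    have hi2' : Integrable (fun q : V × V => Real.cos a • (inner ℝ v q.2 • Φ q.1)) (γ.prod γ) :=
      hi2.smul _
    rw [integral_add hi1' hi2', integral_smul, integral_smul]
    have h4 : ∫ q : V × V, inner ℝ v q.1 • Φ q.1 ∂(γ.prod γ) = A := by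
      rw [integral_prod _ hi1]
      simp [hA]
    have h5 : ∫ q : V × V, inner ℝ v q.2 • Φ q.1 ∂(γ.prod γ) = 0 := by
      rw [integral_prod _ hi2]
      have : ∫ y, inner ℝ v y ∂γ = 0 := integral_strongDual_stdGaussian (innerSL ℝ v)
      simp [integral_smul_const, this]
    rw [h4, h5]
    simp
  have hF'g : PolyGrowth fun q : ℝ × V × V => inner ℝ v q.2.2 •
      Φ' (Real.cos q.1 • q.2.1 + Real.sin q.1 • q.2.2)
        (-Real.sin q.1 • q.2.1 + Real.cos q.1 • q.2.2) :=
    (hv1.comp_snd).smul ((hg'.comp polyGrowth_rotation_fst).clm_apply polyGrowth_rotation_snd)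
  obtain ⟨b, hb, hbc, hbb⟩ := hF'g.exists_bound
  -- At a = 0 the derivative is E[⟨v, y⟩ Φ'(x) y] with x and y independent, and averaging over y
  -- gives Φ'(x) v because the covariance is the identity.
  have hder := (hasDerivAt_integral_of_dominated_loc_of_deriv_le (μ := γ.prod γ) (𝕜 := ℝ)
    (F := fun (a : ℝ) (p : V × V) => inner ℝ v p.2 • Φ (Real.cos a • p.1 + Real.sin a • p.2))
    (F' := fun (a : ℝ) (p : V × V) => inner ℝ v p.2 •
      Φ' (Real.cos a • p.1 + Real.sin a • p.2) (-Real.sin a • p.1 + Real.cos a • p.2))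
    (x₀ := 0) (s := Metric.ball 0 1) (bound := b) (Metric.ball_mem_nhds 0 one_pos)
    (Eventually.of_forall fun a => (by fun_prop : Continuous fun p : V × V =>
      inner ℝ v p.2 • Φ (Real.cos a • p.1 + Real.sin a • p.2)).aestronglyMeasurable)
    (by
      simp only [Real.cos_zero, one_smul, Real.sin_zero, zero_smul, add_zero]
      exact hint (hv1.smul hg.comp_fst) (by fun_prop))
    (by
      refine Continuous.aestronglyMeasurable ?_
      fun_prop)
    (ae_of_all _ fun p a ha => hbb a (by
      have := mem_ball_zero_iff.1 ha
      rw [Real.norm_eq_abs] at this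
      linarith) p)
    (hb.integrable hbc.aestronglyMeasurable)
    (ae_of_all _ fun p a _ => by
      have hd : HasDerivAt (fun a : ℝ => Real.cos a • p.1 + Real.sin a • p.2)
        (-Real.sin a • p.1 + Real.cos a • p.2) a :=
        ((Real.hasDerivAt_cos a).smul_const p.1).add ((Real.hasDerivAt_sin a).smul_const p.2)
      exact ((hΦ _).comp_hasDerivAt a hd).const_smul _)).2
  simp_rw [hgval] at hder
  have hder2 : HasDerivAt (fun a : ℝ => Real.sin a • A) (Real.cos 0 • A) 0 :=
    (Real.hasDerivAt_sin 0).smul_const A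
  have := hder.unique hder2
  simp only [Real.cos_zero, one_smul, Real.sin_zero, zero_smul, add_zero, neg_zero,
    zero_add] at this
  rw [← this, integral_prod]
  · refine integral_congr_ae (ae_of_all _ fun x => ?_)
    change ∫ y, inner ℝ v y • Φ' x y ∂γ = Φ' x v
    have hi : Integrable (fun y : V => inner ℝ v y • y) γ :=
      ((PolyGrowth.clm (innerSL ℝ v)).smul
        (PolyGrowth.clm (ContinuousLinearMap.id ℝ V))).integrable
        (by fun_prop : Continuous fun y : V => inner ℝ v y • y).aestronglyMeasurable
    have h6 := (Φ' x).integral_comp_comm hi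
    rw [integral_inner_smul_id_stdGaussian] at h6
    rw [← h6]
    simp
  · exact hint (hv1.smul (hg'.comp_fst.clm_apply (PolyGrowth.clm
      (ContinuousLinearMap.id ℝ V)).comp_snd)) (by fun_prop)

end

/-! ### Covariance along rotations and normal approximation -/

section

variable {V : Type*} [NormedAddCommGroup V] [InnerProductSpace ℝ V] [FiniteDimensional ℝ V]
  [MeasurableSpace V] [BorelSpace V]

/-- The covariance of `F` and `H` under the standard Gaussian measure, expressed through the
gradient `G` of `F` and the derivative `H'` of `H`. -/
theorem integral_smul_eq_integral_rotation {E : Type*} [NormedAddCommGroup E] [NormedSpace ℝ E]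
    [CompleteSpace E] {F : V → ℝ} {G : V → V} (hF : ∀ x, HasFDerivAt F (innerSL ℝ (G x)) x)
    (hGc : Continuous G) (hFg : PolyGrowth F) (hGg : PolyGrowth G)
    (hF0 : ∫ x, F x ∂(stdGaussian V) = 0) {H : V → E} {H' : V → V →L[ℝ] E}
    (hH : ∀ x, HasFDerivAt H (H' x) x) (hH'c : Continuous H') (hHg : PolyGrowth H)
    (hH'g : PolyGrowth H') :
    ∫ x, F x • H x ∂(stdGaussian V) = ∫ a in (0 : ℝ)..(Real.pi / 2), Real.sin a •
      ∫ p, H' (Real.cos a • p.1 - Real.sin a • p.2) (G p.1)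
        ∂((stdGaussian V).prod (stdGaussian V)) := by
  set γ := stdGaussian V with hγ
  have hFc : Continuous F := continuous_iff_continuousAt.2 fun x => (hF x).continuousAt
  have hHc : Continuous H := continuous_iff_continuousAt.2 fun x => (hH x).continuousAt
  have hint : ∀ {f : V × V → E}, PolyGrowth f → Continuous f → Integrable f (γ.prod γ) :=
    fun h1 h2 => h1.integrable h2.aestronglyMeasurable
  have hid2 : PolyGrowth fun p : V × V => p.2 := PolyGrowth.clm (ContinuousLinearMap.snd ℝ V V)
  set D : ℝ → V × V → ℝ := fun a p => inner ℝ (G (Real.cos a • p.1 + Real.sin a • p.2))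
    (-Real.sin a • p.1 + Real.cos a • p.2) with hD
  have hinc : ∀ p : V × V, F p.2 - F p.1 = ∫ a in (0 : ℝ)..(Real.pi / 2), D a p := fun p =>
    sub_eq_integral_rotation (H' := fun x => innerSL ℝ (G x)) hF (by fun_prop) p
  have hi1 : Integrable (fun p : V × V => F p.2 • H p.1) (γ.prod γ) :=
    hint (hFg.comp_snd.smul hHg.comp_fst) (by fun_prop)
  have hi2 : Integrable (fun p : V × V => F p.1 • H p.1) (γ.prod γ) :=
    hint (hFg.comp_fst.smul hHg.comp_fst) (by fun_prop)
  -- The independent copy contributes nothing because `F` has mean zero; the increment of `F` can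
  -- then be written along the quarter circle.
  have h1 : ∫ x, F x • H x ∂γ = -∫ p : V × V, (F p.2 - F p.1) • H p.1 ∂(γ.prod γ) := by
    simp_rw [sub_smul]
    rw [integral_sub hi1 hi2, integral_prod _ hi1, integral_prod _ hi2]
    simp [integral_smul_const, hF0]
  have h2 : ∫ p : V × V, (F p.2 - F p.1) • H p.1 ∂(γ.prod γ) =
      ∫ a in (0 : ℝ)..(Real.pi / 2), ∫ p : V × V, D a p • H p.1 ∂(γ.prod γ) := by
    rw [intervalIntegral_integral_swap]
    · refine integral_congr_ae (ae_of_all _ fun p => ?_)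
      simp only [hinc p, intervalIntegral.integral_smul_const]
    · refine PolyGrowth.integrable_interval (f := fun q : ℝ × V × V => D q.1 q.2 • H q.2.1) ?_ ?_
      · exact ((hGg.comp polyGrowth_rotation_fst).inner polyGrowth_rotation_snd).smul
          (PolyGrowth.comp_snd (f := fun p : V × V => H p.1) hHg.comp_fst)
      · simp only [hD]; fun_prop
  rw [h1, h2, ← intervalIntegral.integral_neg]
  refine intervalIntegral.integral_congr fun a _ => ?_
  -- In rotated coordinates the gradient is evaluated at the first vector and paired with the
  -- second, independent one, which is the form required for integration by parts.
  set f : V × V → E := fun q => inner ℝ (G q.1) q.2 • H (Real.cos a • q.1 - Real.sin a • q.2)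
    with hf
  have hfc : Continuous f := by fun_prop
  have hsub : PolyGrowth fun q : V × V => Real.cos a • q.1 - Real.sin a • q.2 :=
    PolyGrowth.clm (Real.cos a • ContinuousLinearMap.fst ℝ V V -
      Real.sin a • ContinuousLinearMap.snd ℝ V V)
  have hfg : PolyGrowth f := ((hGg.comp_fst).inner hid2).smul (hHg.comp hsub)
  have h3 : ∫ p : V × V, D a p • H p.1 ∂(γ.prod γ) = ∫ q, f q ∂(γ.prod γ) := by
    rw [← integral_comp_rotation (γ := γ) stdGaussian_id_eq_zero a hfc.aestronglyMeasurable]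
    refine integral_congr_ae (ae_of_all _ fun p => ?_)
    simp only [hf, hD, ContinuousLinearMap.rotation_apply]
    congr 2
    have : Real.cos a • (Real.cos a • p.1 + Real.sin a • p.2)
          - Real.sin a • (-Real.sin a • p.1 + Real.cos a • p.2) =
          (Real.sin a ^ 2 + Real.cos a ^ 2) • p.1 := by module
    rw [this, Real.sin_sq_add_cos_sq, one_smul]
  -- Integration by parts in y in the direction G(x); differentiating cos a • x - sin a • y in y
  -- produces the weight -sin a.
  have h4 : ∀ x : V, ∫ y, f (x, y) ∂γ =
      -(Real.sin a • ∫ y, H' (Real.cos a • x - Real.sin a • y) (G x) ∂γ) := by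
    intro x
    have hd : ∀ y, HasFDerivAt (fun y => H (Real.cos a • x - Real.sin a • y))
        ((H' (Real.cos a • x - Real.sin a • y)).comp
          (-(Real.sin a • ContinuousLinearMap.id ℝ V))) y := fun y =>
      (hH _).comp y (((hasFDerivAt_id y).const_smul (Real.sin a)).const_sub _)
    have hs : PolyGrowth fun y : V => Real.cos a • x - Real.sin a • y := by
      simp_rw [sub_eq_add_neg]
      exact (PolyGrowth.const _).add
        (PolyGrowth.clm (-(Real.sin a • ContinuousLinearMap.id ℝ V)))
    have := integral_inner_smul_stdGaussian hd (by fun_prop) (hHg.comp hs)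
      ((hH'g.comp hs).of_mul (PolyGrowth.const (-(Real.sin a • ContinuousLinearMap.id ℝ V)))
        fun y => ContinuousLinearMap.opNorm_comp_le _ _) (G x)
    simp only [hf]
    rw [this]
    simp [integral_neg, integral_smul, hγ]
  have h5 : Integrable (fun p : V × V => H' (Real.cos a • p.1 - Real.sin a • p.2) (G p.1))
      (γ.prod γ) := hint ((hH'g.comp hsub).clm_apply hGg.comp_fst) (by fun_prop)
  rw [h3, integral_prod _ (hint hfg hfc), integral_prod _ h5]
  simp_rw [h4]
  rw [integral_neg, neg_neg, integral_smul]

set_option maxHeartbeats 1000000 in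
/-- A function `F` of a standard Gaussian vector whose gradient `G` decorrelates from its
rotations is close to normal, in the sense of characteristic functions. -/
theorem norm_integral_cexp_sub_le {F : V → ℝ} {G : V → V}
    (hF : ∀ x, HasFDerivAt F (innerSL ℝ (G x)) x) (hGc : Continuous G) (hFg : PolyGrowth F)
    (hGg : PolyGrowth G) (hF0 : ∫ x, F x ∂(stdGaussian V) = 0) {κ : ℝ}
    (hκ : ∀ a ∈ Set.Ioc (0 : ℝ) (Real.pi / 2),
      ∫ p, |inner ℝ (G (Real.cos a • p.1 - Real.sin a • p.2)) (G p.1) -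
        ∫ p', inner ℝ (G (Real.cos a • p'.1 - Real.sin a • p'.2)) (G p'.1)
          ∂((stdGaussian V).prod (stdGaussian V))| ∂((stdGaussian V).prod (stdGaussian V)) ≤ κ) :
    ‖∫ x, Complex.exp (F x * Complex.I) ∂(stdGaussian V) -
      Complex.exp (-(∫ x, F x ^ 2 ∂(stdGaussian V) : ℝ) / 2)‖ ≤ κ := by
  set γ := stdGaussian V with hγ
  have hFc : Continuous F := continuous_iff_continuousAt.2 fun x => (hF x).continuousAt
  have hpi : (0 : ℝ) ≤ Real.pi / 2 := by positivity
  set Q : ℝ → V × V → ℝ := fun a p =>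
    inner ℝ (G (Real.cos a • p.1 - Real.sin a • p.2)) (G p.1) with hQ
  have hQg : PolyGrowth fun q : ℝ × V × V => Q q.1 q.2 :=
    (hGg.comp polyGrowth_rotation_inv).inner
      (PolyGrowth.comp_snd (f := fun p : V × V => G p.1) hGg.comp_fst)
  have hQc : Continuous fun q : ℝ × V × V => Q q.1 q.2 := by simp only [hQ]; fun_prop
  have hsub : ∀ a, PolyGrowth fun q : V × V => Real.cos a • q.1 - Real.sin a • q.2 := fun a =>
    PolyGrowth.clm (Real.cos a • ContinuousLinearMap.fst ℝ V V -
      Real.sin a • ContinuousLinearMap.snd ℝ V V)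
  have hQi : ∀ a, Integrable (Q a) (γ.prod γ) := fun a =>
    (((hGg.comp (hsub a)).inner hGg.comp_fst)).integrable
      (by simp only [hQ]; fun_prop : Continuous (Q a)).aestronglyMeasurable
  set q : ℝ → ℝ := fun a => ∫ p, Q a p ∂(γ.prod γ) with hq
  set v : ℝ := ∫ x, F x ^ 2 ∂γ with hv
  have hv0 : 0 ≤ v := integral_nonneg fun x => sq_nonneg _
  -- The covariance formula with H = F: the variance is the same weighted average of the means of
  -- the inner products that appears below in φ'.
  have hvq : v = ∫ a in (0 : ℝ)..(Real.pi / 2), Real.sin a * q a := by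
    have := integral_smul_eq_integral_rotation hF hGc hFg hGg hF0 (H := F)
      (H' := fun x => innerSL ℝ (G x)) hF (by fun_prop) hFg
      (hGg.mono fun x => (innerSL_apply_norm (𝕜 := ℝ) (G x)).le)
    simp only [smul_eq_mul] at this
    rw [hv]
    simp_rw [sq]
    rw [this]
    rfl
  set φ : ℝ → ℂ := fun s => ∫ x, Complex.exp (s * F x * Complex.I) ∂γ with hφ
  have hnorm : ∀ (s x : ℝ), ‖Complex.exp (s * x * Complex.I)‖ = 1 := fun s x => by
    rw [← Complex.ofReal_mul, Complex.norm_exp_ofReal_mul_I]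
  have hd1 : ∀ s : ℝ, HasDerivAt φ
      (∫ x, F x • (Complex.I * Complex.exp (s * F x * Complex.I)) ∂γ) s := by
    intro s
    refine (hasDerivAt_integral_of_dominated_loc_of_deriv_le (μ := γ) (𝕜 := ℝ)
      (F := fun (s : ℝ) x => Complex.exp (s * F x * Complex.I))
      (F' := fun (s : ℝ) x => F x • (Complex.I * Complex.exp (s * F x * Complex.I)))
      (x₀ := s) (s := Set.univ) (bound := fun x => ‖F x‖) univ_mem
      (Eventually.of_forall fun a => ?_) ?_ ?_ ?_ ?_ ?_).2
    · exact (by fun_prop : Continuous _).aestronglyMeasurable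
    · exact Integrable.of_bound (by fun_prop : Continuous fun x =>
        Complex.exp (s * F x * Complex.I)).aestronglyMeasurable 1
        (ae_of_all _ fun x => (hnorm s (F x)).le)
    · exact (by fun_prop : Continuous _).aestronglyMeasurable
    · exact ae_of_all _ fun x a _ => by simp [hnorm]
    · exact hFg.norm.integrable hFc.norm.aestronglyMeasurable
    · refine ae_of_all _ fun x a _ => ?_
      have h1 : HasDerivAt (fun s : ℝ => (s : ℂ) * F x * Complex.I) (F x * Complex.I) a := by
        simpa using ((Complex.ofRealCLM.hasDerivAt (x := a)).mul_const
          (F x : ℂ)).mul_const Complex.I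
      convert! h1.cexp using 1
      rw [Complex.real_smul]
      ring
  -- The covariance formula applied to i exp(isF), whose derivative is -s exp(isF) ⟨G, ·⟩.
  have hφ' : ∀ s : ℝ, ∫ x, F x • (Complex.I * Complex.exp (s * F x * Complex.I)) ∂γ =
      ∫ a in (0 : ℝ)..(Real.pi / 2), Real.sin a • ∫ p, Q a p • (-(s : ℂ) * Complex.exp
        (s * F (Real.cos a • p.1 - Real.sin a • p.2) * Complex.I)) ∂(γ.prod γ) := by
    intro s
    set H' : V → V →L[ℝ] ℂ := fun x => (innerSL ℝ (G x)).smulRight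
      (-(s : ℂ) * Complex.exp (s * F x * Complex.I)) with hH'
    have hb : PolyGrowth fun x => -(s : ℂ) * Complex.exp (s * F x * Complex.I) :=
      PolyGrowth.of_bdd (C := |s|) fun x => by simp [hnorm]
    have := integral_smul_eq_integral_rotation hF hGc hFg hGg hF0
      (H := fun x => Complex.I * Complex.exp (s * F x * Complex.I)) (H' := H') (fun x => ?_)
      (by fun_prop) (PolyGrowth.of_bdd (C := 1) fun x => by simp [hnorm])
      (hGg.of_mul hb fun x => by
        rw [hH', ContinuousLinearMap.norm_smulRight_apply, innerSL_apply_norm])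
    · rw [this]
      rfl
    · have h1 : HasFDerivAt (fun x => (F x : ℂ)) (Complex.ofRealCLM.comp (innerSL ℝ (G x))) x :=
        Complex.ofRealCLM.hasFDerivAt.comp x (hF x)
      have h2 := (((h1.const_mul (s : ℂ)).mul_const Complex.I).cexp).const_mul Complex.I
      refine h2.congr_fderiv ?_
      ext y
      simp [hH', Complex.real_smul]
      linear_combination (s * (inner ℝ (G x) y : ℂ) * Complex.exp (s * F x * Complex.I)) *
        Complex.I_mul_I
  have hφrot : ∀ (s a : ℝ), ∫ p : V × V, Complex.exp
      (s * F (Real.cos a • p.1 - Real.sin a • p.2) * Complex.I) ∂(γ.prod γ) = φ s := by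
    intro s a
    have h1 := integral_comp_rotation (γ := γ) stdGaussian_id_eq_zero (-a)
      (f := fun p : V × V => Complex.exp (s * F p.1 * Complex.I))
      (by fun_prop : Continuous _).aestronglyMeasurable
    simp only [ContinuousLinearMap.rotation_apply, Real.cos_neg, Real.sin_neg, neg_smul,
      ← sub_eq_add_neg] at h1
    rw [h1, integral_prod]
    · simp [hφ]
    · exact Integrable.of_bound (by fun_prop : Continuous fun p : V × V =>
        Complex.exp (s * F p.1 * Complex.I)).aestronglyMeasurable 1
        (ae_of_all _ fun p => (hnorm s (F p.1)).le)
  -- Replacing the inner product `Q a` by its mean `q a` turns the formula for φ' into -s v φ(s),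
  -- the equation satisfied by a Gaussian characteristic function. The error is at most s κ since
  -- sin integrates to 1 on the quarter circle.
  have hbound : ∀ s : ℝ, 0 ≤ s →
      ‖(∫ x, F x • (Complex.I * Complex.exp (s * F x * Complex.I)) ∂γ) + s * v * φ s‖ ≤
        s * κ := by
    intro s hs
    have hEc : Continuous fun z : ℝ × V × V => Complex.exp
        (s * F (Real.cos z.1 • z.2.1 - Real.sin z.1 • z.2.2) * Complex.I) := by fun_prop
    have hii : IntervalIntegrable (fun a => Real.sin a • ∫ p, Q a p • (-(s : ℂ) * Complex.exp
        (s * F (Real.cos a • p.1 - Real.sin a • p.2) * Complex.I)) ∂(γ.prod γ))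
        volume 0 (Real.pi / 2) := by
      rw [intervalIntegrable_iff]
      have h1 : Integrable (fun z : ℝ × V × V => Real.sin z.1 • (Q z.1 z.2 • (-(s : ℂ) *
          Complex.exp (s * F (Real.cos z.1 • z.2.1 - Real.sin z.1 • z.2.2) * Complex.I))))
          ((volume.restrict (Set.uIoc 0 (Real.pi / 2))).prod (γ.prod γ)) := by
        refine PolyGrowth.integrable_interval ?_ (by fun_prop)
        exact (PolyGrowth.of_bdd (C := 1) fun z => by simpa using Real.abs_sin_le_one z.1).smul
          (hQg.smul (PolyGrowth.of_bdd (C := |s|) fun x => by simp [hnorm]))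
      have h2 := h1.integral_prod_left
      simp_rw [integral_smul] at h2
      exact h2
    have hiq : IntervalIntegrable (fun a => Real.sin a * q a) volume 0 (Real.pi / 2) := by
      rw [intervalIntegrable_iff]
      have h1 : Integrable (fun z : ℝ × V × V => Real.sin z.1 * Q z.1 z.2)
          ((volume.restrict (Set.uIoc 0 (Real.pi / 2))).prod (γ.prod γ)) := by
        refine PolyGrowth.integrable_interval ?_ (by fun_prop)
        exact (PolyGrowth.of_bdd (C := 1) fun z => by
          simpa using Real.abs_sin_le_one z.1).mul hQg
      have h2 := h1.integral_prod_left
      simp_rw [integral_const_mul] at h2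
      exact h2
    have hvφ : (s : ℂ) * v * φ s =
        ∫ a in (0 : ℝ)..(Real.pi / 2), ((Real.sin a * q a : ℝ) : ℂ) * (s * φ s) := by
      rw [intervalIntegral.integral_mul_const, intervalIntegral.integral_ofReal, ← hvq]
      ring
    have hiq' : IntervalIntegrable (fun a => ((Real.sin a * q a : ℝ) : ℂ) * (s * φ s)) volume 0
        (Real.pi / 2) := ⟨Integrable.mul_const (Integrable.ofReal hiq.1) _,
          Integrable.mul_const (Integrable.ofReal hiq.2) _⟩
    rw [hφ', hvφ, ← intervalIntegral.integral_add hii hiq']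
    have hle : ∀ a ∈ Set.Ioc (0 : ℝ) (Real.pi / 2),
        ‖Real.sin a • (∫ p, Q a p • (-(s : ℂ) * Complex.exp
          (s * F (Real.cos a • p.1 - Real.sin a • p.2) * Complex.I)) ∂(γ.prod γ)) +
          ((Real.sin a * q a : ℝ) : ℂ) * (s * φ s)‖ ≤ Real.sin a * (s * κ) := by
      intro a ha
      have hsin : 0 ≤ Real.sin a :=
        Real.sin_nonneg_of_nonneg_of_le_pi ha.1.le (by linarith [ha.2, Real.pi_pos])
      have he1 : Integrable (fun p : V × V => Q a p • (-(s : ℂ) * Complex.exp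
          (s * F (Real.cos a • p.1 - Real.sin a • p.2) * Complex.I))) (γ.prod γ) := by
        refine ((hQi a).norm.const_mul |s|).mono' (by
          have : Continuous (Q a) := by simp only [hQ]; fun_prop
          exact (by fun_prop : Continuous _).aestronglyMeasurable)
          (ae_of_all _ fun p => ?_)
        rw [norm_smul, norm_mul, hnorm]
        simp [mul_comm]
      have he2 : Integrable (fun p : V × V => q a • (-(s : ℂ) * Complex.exp
          (s * F (Real.cos a • p.1 - Real.sin a • p.2) * Complex.I))) (γ.prod γ) := by
        refine Integrable.of_bound (by fun_prop : Continuous fun p : V × V =>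
          q a • (-(s : ℂ) * Complex.exp (s * F (Real.cos a • p.1 - Real.sin a • p.2) *
            Complex.I))).aestronglyMeasurable (|q a| * |s|) (ae_of_all _ fun p => ?_)
        rw [norm_smul, norm_mul, hnorm]
        simp
      have h3 : Real.sin a • (∫ p, Q a p • (-(s : ℂ) * Complex.exp
          (s * F (Real.cos a • p.1 - Real.sin a • p.2) * Complex.I)) ∂(γ.prod γ)) +
          ((Real.sin a * q a : ℝ) : ℂ) * (s * φ s) = Real.sin a • ∫ p, (Q a p - q a) •
            (-(s : ℂ) * Complex.exp
          (s * F (Real.cos a • p.1 - Real.sin a • p.2) * Complex.I)) ∂(γ.prod γ) := by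
        simp_rw [sub_smul]
        rw [integral_sub he1 he2, integral_smul, integral_const_mul, hφrot]
        simp only [Complex.real_smul]
        push_cast
        ring
      rw [h3, norm_smul, Real.norm_of_nonneg hsin]
      gcongr
      refine (norm_integral_le_integral_norm _).trans ?_
      have h4 : ∀ p : V × V, ‖(Q a p - q a) • (-(s : ℂ) * Complex.exp
          (s * F (Real.cos a • p.1 - Real.sin a • p.2) * Complex.I))‖ = s * |Q a p - q a| := by
        intro p
        rw [norm_smul, norm_mul, hnorm]
        simp [abs_of_nonneg hs, mul_comm]
      simp_rw [h4]
      rw [integral_const_mul]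
      exact mul_le_mul_of_nonneg_left (hκ a ha) hs
    have hsi : IntervalIntegrable (fun a => Real.sin a * (s * κ)) volume 0 (Real.pi / 2) :=
      (by fun_prop : Continuous fun a => Real.sin a * (s * κ)).intervalIntegrable _ _
    refine (intervalIntegral.norm_integral_le_of_norm_le hpi
      (ae_of_all _ fun a ha => hle a ha) hsi).trans (le_of_eq ?_)
    rw [intervalIntegral.integral_mul_const, integral_sin]
    simp
  have hκ0 : 0 ≤ κ := (integral_nonneg fun _ => abs_nonneg _).trans
    (hκ (Real.pi / 2) ⟨by positivity, le_rfl⟩)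
  -- The integrating factor exp(v(s² - 1)/2) is at most 1 on [0, 1]; the product equals exp(-v/2) at
  -- s = 0 and φ(1) at s = 1.
  have hfin := norm_image_sub_le_of_norm_deriv_le_segment_01'
    (f := fun s : ℝ => φ s * Complex.exp ((v * (s ^ 2 - 1) / 2 : ℝ)))
    (f' := fun s : ℝ => ((∫ x, F x • (Complex.I * Complex.exp (s * F x * Complex.I)) ∂γ)
      + s * v * φ s) * Complex.exp ((v * (s ^ 2 - 1) / 2 : ℝ))) (C := κ) (fun s _ => ?_)
    (fun s hs => ?_)
  · simpa [hφ, neg_div] using hfin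
  · have h1 : HasDerivAt (fun s : ℝ => v * (s ^ 2 - 1) / 2) (s * v) s := by
      have := ((((hasDerivAt_id s).pow 2).sub_const 1).const_mul v).div_const 2
      convert! this using 1
      simp
      ring
    have h2 := ((hd1 s).mul h1.ofReal_comp.cexp).hasDerivWithinAt (s := Set.Icc 0 1)
    convert! h2 using 1
    push_cast
    ring
  · rw [norm_mul, Complex.norm_exp, Complex.ofReal_re]
    have h1 : Real.exp (v * (s ^ 2 - 1) / 2) ≤ 1 := by
      rw [Real.exp_le_one_iff]
      have : s ^ 2 ≤ 1 := by nlinarith [hs.1, hs.2]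
      nlinarith
    calc _ ≤ s * κ * 1 := by
          gcongr
          · exact mul_nonneg hs.1 hκ0
          · exact hbound s hs.1
      _ ≤ κ := by nlinarith [hs.1, hs.2]

end

/-! ### The Gaussian Poincaré inequality -/

section

variable {V : Type*} [NormedAddCommGroup V] [NormedSpace ℝ V] [CompleteSpace V]
  [SecondCountableTopology V] [MeasurableSpace V] [BorelSpace V]

/-- The Gaussian Poincaré inequality, in the form of a bound on the mean absolute deviation. -/
theorem integral_abs_sub_integral_le {γ : Measure V} [IsGaussian γ] (hγ : γ[id] = 0)
    {H : V → ℝ} {H' : V → V →L[ℝ] ℝ} (hH : ∀ x, HasFDerivAt H (H' x) x) (hH' : Continuous H')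
    (hHi : Integrable H γ) {D : ℝ} (hD : 0 ≤ D)
    (hHD : ∫⁻ p, ENNReal.ofReal ((H' p.1 p.2) ^ 2) ∂(γ.prod γ) ≤ ENNReal.ofReal (D ^ 2)) :
    ∫ x, |H x - ∫ y, H y ∂γ| ∂γ ≤ 2 * D := by
  have hHc : Continuous H := continuous_iff_continuousAt.2 fun x => (hH x).continuousAt
  have hi1 : Integrable (fun p : V × V => H p.1) (γ.prod γ) := hHi.comp_fst γ
  have hi2 : Integrable (fun p : V × V => H p.2) (γ.prod γ) := hHi.comp_snd γ
  -- The mean is replaced by an independent copy, so that Maurey–Pisier with the square function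
  -- applies; the final factor 2 bounds π/2.
  have h1 : ∫ x, |H x - ∫ y, H y ∂γ| ∂γ ≤ ∫ p : V × V, |H p.2 - H p.1| ∂(γ.prod γ) := by
    have hi : Integrable (fun p : V × V => |H p.2 - H p.1|) (γ.prod γ) := (hi2.sub hi1).abs
    rw [integral_prod _ hi]
    refine integral_mono (hHi.sub (integrable_const _)).abs hi.integral_prod_left fun x => ?_
    calc |H x - ∫ y, H y ∂γ| = |∫ y, (H y - H x) ∂γ| := by
          rw [integral_sub hHi (integrable_const _), abs_sub_comm]
          simp
      _ ≤ _ := abs_integral_le_integral_abs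
  have h2 := lintegral_convex_sub_le hγ hH hH' (Ψ := fun x => x ^ 2)
    (even_two.convexOn_pow) (by fun_prop) fun x => sq_nonneg x
  have h3 : ∫⁻ p : V × V, ENNReal.ofReal ((Real.pi / 2 * H' p.1 p.2) ^ 2) ∂(γ.prod γ) ≤
      ENNReal.ofReal ((2 * D) ^ 2) := by
    simp_rw [mul_pow]
    simp_rw [fun p : V × V => ENNReal.ofReal_mul (q := (H' p.1 p.2) ^ 2)
      (sq_nonneg (Real.pi / 2))]
    rw [lintegral_const_mul', ENNReal.ofReal_mul (by positivity)]
    · gcongr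
      linarith [Real.pi_le_four]
    · simp
  have hm : AEStronglyMeasurable (fun p : V × V => H p.2 - H p.1) (γ.prod γ) :=
    (by fun_prop : Continuous fun p : V × V => H p.2 - H p.1).aestronglyMeasurable
  have h4 : ∫⁻ p : V × V, ENNReal.ofReal |H p.2 - H p.1| ∂(γ.prod γ) ≤
      ENNReal.ofReal (2 * D) := by
    have h5 : ∀ p : V × V, ENNReal.ofReal |H p.2 - H p.1| = ‖H p.2 - H p.1‖ₑ := fun p =>
      (Real.enorm_eq_ofReal_abs _).symm
    have h6 := eLpNorm_le_eLpNorm_of_exponent_le (p := 1) (q := 2) (by norm_num) hm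
    rw [eLpNorm_one_eq_lintegral_enorm] at h6
    simp_rw [h5]
    refine h6.trans ?_
    rw [eLpNorm_eq_lintegral_rpow_enorm_toReal (by simp) (by simp)]
    have h7 : ∫⁻ p : V × V, ‖H p.2 - H p.1‖ₑ ^ (2 : ℝ≥0∞).toReal ∂(γ.prod γ) ≤
        ENNReal.ofReal ((2 * D) ^ 2) := by
      refine le_trans (lintegral_mono fun p => ?_) (h2.trans h3)
      simp only [ENNReal.toReal_ofNat, ENNReal.rpow_ofNat]
      rw [Real.enorm_eq_ofReal_abs, ← ENNReal.ofReal_pow (abs_nonneg _), sq_abs]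
    refine (ENNReal.rpow_le_rpow h7 (by simp)).trans ?_
    rw [ENNReal.ofReal_rpow_of_nonneg (by positivity) (by simp)]
    refine ENNReal.ofReal_le_ofReal (le_of_eq ?_)
    simp only [ENNReal.toReal_ofNat]
    rw [← Real.sqrt_eq_rpow, Real.sqrt_sq (by positivity)]
  refine h1.trans ?_
  rw [integral_eq_lintegral_of_nonneg_ae (ae_of_all _ fun p => abs_nonneg _) hm.norm]
  exact ENNReal.toReal_le_of_le_ofReal (by positivity) h4

end

/-! ### From characteristic functions to Lipschitz test functions -/

section

variable {E : Type*} [NormedAddCommGroup E] [InnerProductSpace ℝ E] [FiniteDimensional ℝ E]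
  [MeasurableSpace E] [BorelSpace E]

lemma integrable_exp_neg_sq_norm {c : ℝ} (hc : 0 < c) :
    Integrable (fun v : E => Real.exp (-(c * ‖v‖ ^ 2))) := by
  have h := (GaussianFourier.integrable_cexp_neg_mul_sq_norm_add (V := E) (b := (c : ℂ))
    (by simpa using hc) 0 0).norm
  refine h.congr (ae_of_all _ fun v => ?_)
  simp [Complex.norm_exp, ← Complex.ofReal_pow]

lemma integrable_norm_mul_exp_neg_sq_norm :
    Integrable (fun v : E => ‖v‖ * Real.exp (-(1 / 2 * ‖v‖ ^ 2))) := by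
  refine (integrable_exp_neg_sq_norm (E := E) (c := 1 / 4) (by norm_num)).mono'
    (by fun_prop : Continuous _).aestronglyMeasurable (ae_of_all _ fun v => ?_)
  rw [Real.norm_of_nonneg (by positivity)]
  have h1 : ‖v‖ ≤ Real.exp (1 / 4 * ‖v‖ ^ 2) := by
    have := Real.add_one_le_exp (1 / 4 * ‖v‖ ^ 2)
    nlinarith [sq_nonneg (‖v‖ / 2 - 1)]
  calc ‖v‖ * Real.exp (-(1 / 2 * ‖v‖ ^ 2))
      ≤ Real.exp (1 / 4 * ‖v‖ ^ 2) * Real.exp (-(1 / 2 * ‖v‖ ^ 2)) := by gcongr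
    _ = Real.exp (-(1 / 4 * ‖v‖ ^ 2)) := by rw [← Real.exp_add]; ring_nf

/-- The Gaussian kernel of width `τ`, integrated against `ρ`, through the characteristic
function of `ρ`. -/
lemma integral_gaussianKernel_eq (ρ : Measure E) [IsProbabilityMeasure ρ] (τ : ℝ) (y : E) :
    ((∫ u, Real.exp (-(1 / 2 * ‖τ⁻¹ • (y - u)‖ ^ 2)) ∂ρ : ℝ) : ℂ) =
      ∫ s, Complex.exp (inner ℝ s (τ⁻¹ • y) * Complex.I) * charFun ρ (-(τ⁻¹ • s))
        ∂(stdGaussian E) := by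
  -- The Gaussian kernel is itself the characteristic function of a standard Gaussian vector; Fubini
  -- then moves the integral over ρ inside.
  have h1 : ∀ u, ((Real.exp (-(1 / 2 * ‖τ⁻¹ • (y - u)‖ ^ 2)) : ℝ) : ℂ) =
      ∫ s, Complex.exp (inner ℝ s (τ⁻¹ • (y - u)) * Complex.I) ∂(stdGaussian E) := by
    intro u
    rw [← charFun_apply, charFun_stdGaussian]
    push_cast
    congr 1
    ring
  rw [← integral_complex_ofReal]
  simp_rw [h1]
  rw [integral_integral_swap]
  · refine integral_congr_ae (ae_of_all _ fun s => ?_)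
    simp only
    rw [charFun_apply, ← integral_const_mul]
    refine integral_congr_ae (ae_of_all _ fun u => ?_)
    simp only
    rw [← Complex.exp_add]
    congr 1
    simp only [smul_sub, inner_sub_right, inner_smul_right, inner_neg_right]
    rw [real_inner_comm s u]
    push_cast
    ring
  · refine Integrable.of_bound (Continuous.aestronglyMeasurable ?_) 1 (ae_of_all _ fun p => ?_)
    · simp only [Function.uncurry_def]; fun_prop
    · simp only [Function.uncurry_def]
      rw [Complex.norm_exp_ofReal_mul_I]

set_option maxHeartbeats 1000000 in
/-- Uniform closeness of characteristic functions controls bounded Lipschitz test functions,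
uniformly over measures with bounded second moments. -/
theorem exists_charFun_close_imp_lipschitz_close (B L M₂ ε : ℝ) (hε : 0 < ε) :
    ∃ δ : ℝ, 0 < δ ∧ ∀ ρ ρ' : Measure E, IsProbabilityMeasure ρ → IsProbabilityMeasure ρ' →
      Integrable (fun y => ‖y‖ ^ 2) ρ → Integrable (fun y => ‖y‖ ^ 2) ρ' →
      ∫ y, ‖y‖ ^ 2 ∂ρ ≤ M₂ → ∫ y, ‖y‖ ^ 2 ∂ρ' ≤ M₂ →
      (∀ s, ‖charFun ρ s - charFun ρ' s‖ ≤ δ * (1 + ‖s‖ ^ 2)) →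
      ∀ φ : E → ℝ, (∀ x y, |φ x - φ y| ≤ L * ‖x - y‖) → (∀ x, |φ x| ≤ B) →
        |∫ y, φ y ∂ρ - ∫ y, φ y ∂ρ'| ≤ ε := by
  set k : E → ℝ := fun v => Real.exp (-(1 / 2 * ‖v‖ ^ 2)) with hk
  have hki : Integrable k := integrable_exp_neg_sq_norm (by norm_num)
  have hkc : Continuous k := by fun_prop
  have hk0 : ∀ v, 0 < k v := fun v => Real.exp_pos _
  have hk1 : ∀ v, k v ≤ 1 := fun v => by
    rw [hk, Real.exp_le_one_iff]
    have := sq_nonneg ‖v‖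
    linarith
  set Z : ℝ := ∫ v, k v with hZ
  have hZ0 : 0 < Z := by
    rw [hZ, integral_pos_iff_support_of_nonneg (fun v => (hk0 v).le) hki]
    have : Function.support k = Set.univ := by
      ext v; simp [(hk0 v).ne']
    rw [this]
    exact Measure.measure_univ_pos.2 (NeZero.ne _)
  set T : ℝ := Z⁻¹ * ∫ v, ‖v‖ * k v with hT
  have hT0 : 0 ≤ T := mul_nonneg (by positivity) (integral_nonneg fun v => by
    have := hk0 v; positivity)
  -- it is enough to treat nonnegative constants
  set B' := |B| + 1 with hB'
  set L' := |L| + 1 with hL'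
  set M' := |M₂| + 1 with hM'
  have hB0 : 0 < B' := by positivity
  have hL0 : 0 < L' := by positivity
  have hM0 : 0 < M' := by positivity
  -- Radius of the ball to which the test function is restricted: by the second moments, little mass
  -- lies beyond M/2.
  obtain ⟨M, hM1, hMM⟩ : ∃ M : ℝ, 1 ≤ M ∧ 8 * B' * M' / M ^ 2 ≤ ε / 8 := by
    have h := (tendsto_pow_atTop (α := ℝ) (n := 2) (by norm_num)).const_div_atTop (8 * B' * M')
    obtain ⟨M, h1, h2⟩ := ((h.eventually (ge_mem_nhds (by positivity : (0 : ℝ) < ε / 8))).and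
      (eventually_ge_atTop 1)).exists
    exact ⟨M, h2, h1⟩
  -- Width of the smoothing kernel, chosen after M because the jump of the restricted function at
  -- the boundary of the ball costs 4B'/M per unit of displacement.
  obtain ⟨τ, hτ0, hττ⟩ : ∃ τ : ℝ, 0 < τ ∧ (L' + 4 * B' / M) * (τ * T) ≤ ε / 8 := by
    refine ⟨ε / 8 / ((L' + 4 * B' / M) * (T + 1)), by positivity, ?_⟩
    have : 0 < L' + 4 * B' / M := by positivity
    rw [div_mul_eq_mul_div, mul_div_assoc', div_le_iff₀ (by positivity)]
    have : 0 ≤ (L' + 4 * B' / M) * ε := by positivity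
    nlinarith
  set dm := Module.finrank ℝ E
  set K : Set E := Metric.closedBall 0 M with hK
  have hKfin : volume K < ∞ := measure_closedBall_lt_top
  set A : ℝ := ∫ s : E, (1 + ‖τ⁻¹ • s‖ ^ 2) ∂(stdGaussian E) with hA
  have hAi : Integrable (fun s : E => 1 + ‖τ⁻¹ • s‖ ^ 2) (stdGaussian E) :=
    ((PolyGrowth.const (1 : ℝ)).add
      ((PolyGrowth.clm (τ⁻¹ • ContinuousLinearMap.id ℝ E)).norm.pow 2)).integrable
      (by fun_prop : Continuous _).aestronglyMeasurable
  have hA0 : 0 ≤ A := integral_nonneg fun s => by positivity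
  set V : ℝ := (volume K).toReal with hV
  set c : ℝ := Z⁻¹ * |(τ ^ dm)⁻¹| with hc
  have hc0 : 0 ≤ c := by positivity
  -- The smoothed kernels differ pointwise by at most δA, hence the smoothed functions by c B' δ A V
  -- after integration over the ball of volume V. This is to be at most ε/2; each of the two
  -- smoothing errors takes ε/4.
  refine ⟨ε / 2 / (c * (B' * A) * V + 1), by positivity, ?_⟩
  set δ := ε / 2 / (c * (B' * A) * V + 1) with hδ
  intro ρ ρ' hρ hρ' hi hi' hm hm' hcf φ hφL hφB
  have hφB' : ∀ x, |φ x| ≤ B' := fun x =>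
    (hφB x).trans ((le_abs_self B).trans (by linarith))
  have hφL' : ∀ x y, |φ x - φ y| ≤ L' * ‖x - y‖ := fun x y =>
    (hφL x y).trans (by
      gcongr
      linarith [le_abs_self L])
  have hφc : Continuous φ :=
    (LipschitzWith.of_dist_le_mul (K := ⟨L', hL0.le⟩) fun x y => by
      rw [Real.dist_eq, dist_eq_norm]; exact hφL' x y).continuous
  set φ₁ : E → ℝ := K.indicator φ with hφ₁
  have hφ₁m : Measurable φ₁ := hφc.measurable.indicator measurableSet_closedBall
  have hφ₁B : ∀ x, |φ₁ x| ≤ B' := fun x => by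
    by_cases hx : x ∈ K
    · simpa [hφ₁, hx] using hφB' x
    · simpa [hφ₁, hx] using hB0.le
  set S : E → ℝ := fun u => Z⁻¹ * ∫ w, φ₁ (u + τ • w) * k w with hS
  have hSi : ∀ u, Integrable fun w => φ₁ (u + τ • w) * k w := fun u => by
    refine (hki.const_mul B').mono' ?_ (ae_of_all _ fun w => ?_)
    · exact ((hφ₁m.comp (by fun_prop)).mul hkc.measurable).aestronglyMeasurable
    · rw [norm_mul, Real.norm_of_nonneg (hk0 w).le]
      exact mul_le_mul_of_nonneg_right (hφ₁B _) (hk0 w).le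
  -- the smoothing error
  have hsmooth : ∀ u, |φ u - S u| ≤ ε / 8 + 8 * B' / M ^ 2 * ‖u‖ ^ 2 := by
    intro u
    have h1 : φ u - S u = Z⁻¹ * ∫ w, (φ u - φ₁ (u + τ • w)) * k w := by
      simp_rw [sub_mul]
      rw [integral_sub (hki.const_mul _) (hSi u), integral_const_mul, ← hZ, mul_sub, hS,
        mul_comm (φ u), inv_mul_cancel_left₀ hZ0.ne']
    have hdiff : Integrable fun w => (φ u - φ₁ (u + τ • w)) * k w := by
      simp_rw [sub_mul]
      exact (hki.const_mul _).sub (hSi u)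
    rw [h1, abs_mul, abs_of_pos (inv_pos.2 hZ0)]
    -- Inside radius M/2 a displacement τw either stays in the ball, where the Lipschitz bound
    -- applies, or has length at least M/2. Outside, the trivial bound 2B' is absorbed by the
    -- quadratic term and integrated with the second moment.
    by_cases hu : ‖u‖ ≤ M / 2
    · have h2 : |∫ w, (φ u - φ₁ (u + τ • w)) * k w| ≤
          ∫ w, (L' + 4 * B' / M) * τ * (‖w‖ * k w) := by
        refine (abs_integral_le_integral_abs).trans (integral_mono hdiff.abs
          ((integrable_norm_mul_exp_neg_sq_norm).const_mul _) fun w => ?_)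
        simp only
        rw [abs_mul, abs_of_pos (hk0 w), ← mul_assoc]
        refine mul_le_mul_of_nonneg_right ?_ (hk0 w).le
        have hτw : ‖τ • w‖ = τ * ‖w‖ := by rw [norm_smul, Real.norm_of_nonneg hτ0.le]
        have hBM : 0 ≤ 4 * B' / M * (τ * ‖w‖) := by positivity
        by_cases hw : u + τ • w ∈ K
        · have := hφL' u (u + τ • w)
          rw [sub_add_cancel_left, norm_neg, hτw] at this
          simp only [hφ₁, Set.indicator_of_mem hw]
          nlinarith
        · have h3 : M < ‖u + τ • w‖ := by simpa [hK] using hw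
          have h4 : M / 2 ≤ τ * ‖w‖ := by
            have := norm_add_le u (τ • w)
            rw [hτw] at this
            linarith
          simp only [hφ₁, Set.indicator_of_notMem hw, sub_zero]
          have h5 : B' ≤ 4 * B' / M * (τ * ‖w‖) := by
            calc B' ≤ 4 * B' / M * (M / 2) := by
                  rw [div_mul_div_comm, le_div_iff₀ (by positivity)]
                  nlinarith
              _ ≤ _ := by gcongr
          have h6 : 0 ≤ L' * (τ * ‖w‖) := by positivity
          nlinarith [hφB' u]
      rw [integral_const_mul] at h2
      have h3 : Z⁻¹ * |∫ w, (φ u - φ₁ (u + τ • w)) * k w| ≤ (L' + 4 * B' / M) * (τ * T) := by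
        calc _ ≤ Z⁻¹ * ((L' + 4 * B' / M) * τ * ∫ w, ‖w‖ * k w) := by gcongr
          _ = _ := by rw [hT]; ring
      have : 0 ≤ 8 * B' / M ^ 2 * ‖u‖ ^ 2 := by positivity
      linarith
    · push Not at hu
      have h2 : |∫ w, (φ u - φ₁ (u + τ • w)) * k w| ≤ ∫ w, 2 * B' * k w := by
        refine (abs_integral_le_integral_abs).trans (integral_mono hdiff.abs
          (hki.const_mul _) fun w => ?_)
        simp only
        rw [abs_mul, abs_of_pos (hk0 w)]
        refine mul_le_mul_of_nonneg_right ?_ (hk0 w).le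
        have := abs_sub (φ u) (φ₁ (u + τ • w))
        linarith [hφB' u, hφ₁B (u + τ • w)]
      rw [integral_const_mul, ← hZ] at h2
      have h3 : Z⁻¹ * |∫ w, (φ u - φ₁ (u + τ • w)) * k w| ≤ 2 * B' := by
        calc _ ≤ Z⁻¹ * (2 * B' * Z) := by gcongr
          _ = _ := by field_simp
      have h4 : 2 * B' ≤ 8 * B' / M ^ 2 * ‖u‖ ^ 2 := by
        rw [div_mul_eq_mul_div, le_div_iff₀ (by positivity)]
        have : (M / 2) ^ 2 ≤ ‖u‖ ^ 2 := by gcongr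
        nlinarith
      linarith
  have hSm : Measurable S := by
    have : Measurable fun p : E × E => φ₁ (p.1 + τ • p.2) * k p.2 :=
      (hφ₁m.comp (by fun_prop)).mul (hkc.measurable.comp measurable_snd)
    exact (this.stronglyMeasurable.integral_prod_right.measurable).const_mul _
  have hSB : ∀ u, |S u| ≤ B' := by
    intro u
    have h2 : |∫ w, φ₁ (u + τ • w) * k w| ≤ ∫ w, B' * k w := by
      refine (abs_integral_le_integral_abs).trans (integral_mono (hSi u).abs
        (hki.const_mul _) fun w => ?_)
      simp only
      rw [abs_mul, abs_of_pos (hk0 w)]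
      exact mul_le_mul_of_nonneg_right (hφ₁B _) (hk0 w).le
    rw [integral_const_mul, ← hZ] at h2
    rw [hS, abs_mul, abs_of_pos (inv_pos.2 hZ0)]
    calc _ ≤ Z⁻¹ * (B' * Z) := by gcongr
      _ = _ := by field_simp
  have herr : ∀ ρ : Measure E, IsProbabilityMeasure ρ → Integrable (fun y => ‖y‖ ^ 2) ρ →
      ∫ y, ‖y‖ ^ 2 ∂ρ ≤ M₂ → |∫ u, φ u ∂ρ - ∫ u, S u ∂ρ| ≤ ε / 4 := by
    intro ρ hρ hi hm
    have hφi : Integrable φ ρ := Integrable.of_bound hφc.aestronglyMeasurable B'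
      (ae_of_all _ hφB')
    have hSi : Integrable S ρ := Integrable.of_bound hSm.aestronglyMeasurable B'
      (ae_of_all _ hSB)
    rw [← integral_sub hφi hSi]
    calc |∫ u, (φ u - S u) ∂ρ| ≤ ∫ u, |φ u - S u| ∂ρ := abs_integral_le_integral_abs
      _ ≤ ∫ u, (ε / 8 + 8 * B' / M ^ 2 * ‖u‖ ^ 2) ∂ρ :=
          integral_mono (hφi.sub hSi).abs ((integrable_const _).add (hi.const_mul _)) hsmooth
      _ = ε / 8 + 8 * B' / M ^ 2 * ∫ u, ‖u‖ ^ 2 ∂ρ := by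
          rw [integral_add (integrable_const _) (hi.const_mul _), integral_const_mul]
          simp
      _ ≤ ε / 8 + 8 * B' / M ^ 2 * M' := by
          gcongr
          exact hm.trans ((le_abs_self _).trans (by linarith))
      _ ≤ ε / 4 := by
          rw [div_mul_eq_mul_div]
          linarith
  -- the smoothed functions
  have hrep : ∀ ρ : Measure E, IsProbabilityMeasure ρ → ∫ u, S u ∂ρ =
      c * ∫ y in K, φ y * ∫ u, k (τ⁻¹ • (y - u)) ∂ρ := by
    intro ρ hρ
    have h1 : ∀ u, S u = c * ∫ y in K, φ y * k (τ⁻¹ • (y - u)) := by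
      intro u
      have h2 := Measure.integral_comp_smul (volume : Measure E)
        (fun v => φ₁ (u + v) * k (τ⁻¹ • v)) τ
      simp only [smul_smul, inv_mul_cancel₀ hτ0.ne', one_smul, smul_eq_mul] at h2
      have h3 : ∫ v, φ₁ (u + v) * k (τ⁻¹ • v) = ∫ y in K, φ y * k (τ⁻¹ • (y - u)) := by
        rw [← integral_sub_right_eq_self (fun v => φ₁ (u + v) * k (τ⁻¹ • v)) u,
          ← integral_indicator measurableSet_closedBall]
        refine integral_congr_ae (ae_of_all _ fun y => ?_)
        have hyu : u + (y - u) = y := by abel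
        by_cases hy : y ∈ K
        · rw [Set.indicator_of_mem (s := Metric.closedBall 0 M) hy]
          simp only [hyu, hφ₁, Set.indicator_of_mem hy]
        · rw [Set.indicator_of_notMem (s := Metric.closedBall 0 M) hy]
          simp only [hyu, hφ₁, Set.indicator_of_notMem hy, zero_mul]
      simp only [hS]
      rw [h2, h3, hc, mul_assoc]
    simp_rw [h1]
    rw [integral_const_mul, integral_integral_swap]
    · simp_rw [integral_const_mul]
    · have : IsFiniteMeasure (volume.restrict K) := ⟨by simpa using hKfin⟩
      refine Integrable.of_bound (Continuous.aestronglyMeasurable ?_) B' (ae_of_all _ fun p => ?_)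
      · simp only [Function.uncurry_def]; fun_prop
      · simp only [Function.uncurry_def]
        rw [norm_mul, Real.norm_of_nonneg (hk0 _).le]
        exact mul_le_of_le_one_right hB0.le (hk1 _) |>.trans' (by
          gcongr
          exact hφB' _)
  -- The two kernel averages are integrals of the characteristic functions against a standard
  -- Gaussian; the growth 1 + ‖s‖² of their discrepancy is integrable there, with value A.
  have hker : ∀ y, |∫ u, k (τ⁻¹ • (y - u)) ∂ρ - ∫ u, k (τ⁻¹ • (y - u)) ∂ρ'| ≤ δ * A := by
    intro y
    rw [← Real.norm_eq_abs, ← Complex.norm_real, Complex.ofReal_sub, hk,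
      integral_gaussianKernel_eq, integral_gaussianKernel_eq]
    have hci : ∀ ρ : Measure E, IsProbabilityMeasure ρ → Integrable (fun s : E =>
        Complex.exp (inner ℝ s (τ⁻¹ • y) * Complex.I) * charFun ρ (-(τ⁻¹ • s)))
        (stdGaussian E) := by
      intro ρ hρ
      refine Integrable.of_bound ?_ 1 (ae_of_all _ fun s => ?_)
      · have h1 : StronglyMeasurable (charFun ρ) := stronglyMeasurable_charFun
        exact ((by fun_prop : Continuous fun s : E =>
          Complex.exp (inner ℝ s (τ⁻¹ • y) * Complex.I)).stronglyMeasurable.mul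
          (h1.comp_measurable (by fun_prop))).aestronglyMeasurable
      · rw [norm_mul, Complex.norm_exp_ofReal_mul_I, one_mul]
        exact norm_charFun_le_one _
    rw [← integral_sub (hci ρ hρ) (hci ρ' hρ'), hA, ← integral_const_mul]
    refine norm_integral_le_of_norm_le (hAi.const_mul δ) (ae_of_all _ fun s => ?_)
    rw [← mul_sub, norm_mul, Complex.norm_exp_ofReal_mul_I, one_mul]
    simpa using hcf (-(τ⁻¹ • s))
  have hmain : |∫ u, S u ∂ρ - ∫ u, S u ∂ρ'| ≤ ε / 2 := by
    have hii : ∀ ρ : Measure E, IsProbabilityMeasure ρ →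
        IntegrableOn (fun y => φ y * ∫ u, k (τ⁻¹ • (y - u)) ∂ρ) K := by
      intro ρ hρ
      have : IsFiniteMeasure (volume.restrict K) := ⟨by simpa using hKfin⟩
      refine Integrable.of_bound ?_ (B' * 1) (ae_of_all _ fun y => ?_)
      · have : StronglyMeasurable fun p : E × E => k (τ⁻¹ • (p.1 - p.2)) :=
          (by fun_prop : Continuous fun p : E × E => k (τ⁻¹ • (p.1 - p.2))).stronglyMeasurable
        exact (hφc.stronglyMeasurable.mul this.integral_prod_right).aestronglyMeasurable
      · rw [norm_mul]
        gcongr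
        · exact hφB' y
        · refine (norm_integral_le_of_norm_le_const (C := 1) (ae_of_all _ fun u => ?_)).trans
            (by simp)
          rw [Real.norm_of_nonneg (hk0 _).le]
          exact hk1 _
    rw [hrep ρ hρ, hrep ρ' hρ', ← mul_sub, ← integral_sub (hii ρ hρ) (hii ρ' hρ'), abs_mul,
      abs_of_nonneg hc0, ← Real.norm_eq_abs]
    have h1 : ‖∫ y in K, (φ y * ∫ u, k (τ⁻¹ • (y - u)) ∂ρ - φ y * ∫ u, k (τ⁻¹ • (y - u)) ∂ρ')‖
        ≤ B' * (δ * A) * V := by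
      refine norm_setIntegral_le_of_norm_le_const hKfin fun y _ => ?_
      rw [← mul_sub, norm_mul]
      gcongr
      · exact hφB' y
      · exact hker y
    have hδ0 : 0 < δ := by positivity
    have hVn : 0 ≤ V := ENNReal.toReal_nonneg
    calc _ ≤ c * (B' * (δ * A) * V) := by gcongr
      _ = δ * (c * (B' * A) * V) := by ring
      _ ≤ δ * (c * (B' * A) * V + 1) := by gcongr; linarith
      _ = ε / 2 := by rw [hδ]; field_simp
  have e1 := herr ρ hρ hi hm
  have e2 := herr ρ' hρ' hi' hm'
  rw [abs_le] at *
  constructor <;> linarith [e1.1, e1.2, e2.1, e2.2, hmain.1, hmain.2]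

end

/-! ### Nets -/

section Nets

variable {E : Type*} [NormedAddCommGroup E] [NormedSpace ℝ E] [FiniteDimensional ℝ E]

/-- The volumetric bound on the size of a separated set. -/
lemma card_le_of_separated_of_subset_closedBall {ρ α : ℝ} (hρ : 0 ≤ ρ) (hα : 0 < α)
    (s : Finset E) (hs : ∀ x ∈ s, ‖x‖ ≤ ρ) (hsep : ∀ x ∈ s, ∀ y ∈ s, x ≠ y → α ≤ ‖x - y‖) :
    (s.card : ℝ) ≤ (1 + 2 * ρ / α) ^ Module.finrank ℝ E := by
  letI : MeasurableSpace E := borel E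
  have : BorelSpace E := ⟨rfl⟩
  set μ : Measure E := Measure.addHaar
  set D := Module.finrank ℝ E
  have hdisj : (s : Set E).PairwiseDisjoint fun x => Metric.ball x (α / 2) := by
    intro x hx y hy hxy
    refine Metric.ball_disjoint_ball ?_
    rw [dist_eq_norm]
    linarith [hsep x hx y hy hxy]
  have hsub : (⋃ x ∈ s, Metric.ball x (α / 2)) ⊆ Metric.ball 0 (ρ + α / 2) := by
    refine Set.iUnion₂_subset fun x hx => Metric.ball_subset_ball' ?_
    rw [dist_zero_right]
    linarith [hs x hx]
  have h0 : μ (Metric.ball (0 : E) 1) ≠ 0 := (Metric.measure_ball_pos μ 0 one_pos).ne'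
  have htop : μ (Metric.ball (0 : E) 1) ≠ ∞ := measure_ball_lt_top.ne
  have h1 : (s.card : ℝ≥0∞) * ENNReal.ofReal ((α / 2) ^ D) * μ (Metric.ball 0 1) ≤
      ENNReal.ofReal ((ρ + α / 2) ^ D) * μ (Metric.ball 0 1) := by
    calc (s.card : ℝ≥0∞) * ENNReal.ofReal ((α / 2) ^ D) * μ (Metric.ball 0 1)
        = μ (⋃ x ∈ s, Metric.ball x (α / 2)) := by
          rw [measure_biUnion_finset hdisj fun x _ => measurableSet_ball]
          have h2 : ∀ x : E, μ (Metric.ball x (α / 2)) =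
              ENNReal.ofReal ((α / 2) ^ D) * μ (Metric.ball 0 1) := fun x =>
            Measure.addHaar_ball_of_pos μ x (by positivity)
          simp_rw [h2]
          rw [Finset.sum_const, nsmul_eq_mul, mul_assoc]
      _ ≤ μ (Metric.ball 0 (ρ + α / 2)) := measure_mono hsub
      _ = _ := Measure.addHaar_ball_of_pos μ 0 (by positivity)
  have h2 := (ENNReal.mul_le_mul_iff_left h0 htop).1 h1
  rw [← ENNReal.ofReal_natCast, ← ENNReal.ofReal_mul (by positivity),
    ENNReal.ofReal_le_ofReal_iff (by positivity)] at h2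
  have h3 : 1 + 2 * ρ / α = (ρ + α / 2) / (α / 2) := by field_simp; ring
  rw [h3, div_pow, le_div_iff₀ (by positivity)]
  exact h2

/-- Subsets of a ball of a finite dimensional normed space have small finite nets. -/
theorem exists_finset_net {A : Set E} {ρ α : ℝ} (hρ : 0 ≤ ρ) (hα : 0 < α)
    (hA : ∀ x ∈ A, ‖x‖ ≤ ρ) : ∃ N : Finset E, (∀ x ∈ N, x ∈ A) ∧
      (∀ a ∈ A, ∃ x ∈ N, ‖a - x‖ ≤ α) ∧
      (N.card : ℝ) ≤ (1 + 2 * ρ / α) ^ Module.finrank ℝ E := by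
  classical
  set P : Finset E → Prop := fun s => (∀ x ∈ s, x ∈ A) ∧
    ∀ x ∈ s, ∀ y ∈ s, x ≠ y → α ≤ ‖x - y‖ with hP
  have hcard : ∀ s, P s → (s.card : ℝ) ≤ (1 + 2 * ρ / α) ^ Module.finrank ℝ E := fun s hs =>
    card_le_of_separated_of_subset_closedBall hρ hα s (fun x hx => hA x (hs.1 x hx)) hs.2
  -- A separated set of maximal cardinality is a net; the volumetric bound ensures that a maximum
  -- exists.
  set S : Set ℕ := {c | ∃ s, P s ∧ s.card = c} with hS
  have hSne : S.Nonempty := ⟨0, ∅, by simp [hP], rfl⟩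
  have hSb : BddAbove S := by
    refine ⟨⌊(1 + 2 * ρ / α) ^ Module.finrank ℝ E⌋₊, ?_⟩
    rintro c ⟨s, hs, rfl⟩
    exact Nat.le_floor (hcard s hs)
  obtain ⟨N, hN, hNc⟩ := Nat.sSup_mem hSne hSb
  refine ⟨N, hN.1, fun a ha => ?_, hcard N hN⟩
  by_contra! hcon
  have haN : a ∉ N := fun h => by
    have := hcon a h
    rw [sub_self, norm_zero] at this
    linarith
  have hins : P (insert a N) := by
    refine ⟨fun x hx => ?_, fun x hx y hy hxy => ?_⟩
    · rcases Finset.mem_insert.1 hx with rfl | hx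
      · exact ha
      · exact hN.1 x hx
    · rcases Finset.mem_insert.1 hx with hx' | hx' <;>
        rcases Finset.mem_insert.1 hy with hy' | hy'
      · exact absurd (hx'.trans hy'.symm) hxy
      · exact hx' ▸ (hcon y hy').le
      · rw [norm_sub_rev]
        exact hy' ▸ (hcon x hx').le
      · exact hN.2 x hx' y hy' hxy
  have := le_csSup hSb ⟨insert a N, hins, rfl⟩
  rw [Finset.card_insert_of_notMem haN, ← hNc] at this
  omega

end Nets

/-! ### Subgaussian rows and their quadratic forms -/

section Rows

variable {V : Type*} [NormedAddCommGroup V] [InnerProductSpace ℝ V] [FiniteDimensional ℝ V]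
  [MeasurableSpace V] [BorelSpace V]

/-- The balls of the seminorm `q` have finite nets as small as in dimension `p`. -/
def HasNets (q : Seminorm ℝ V) (p : ℕ) : Prop :=
  ∀ (A : Set V) (ρ α : ℝ), 0 ≤ ρ → 0 < α → (∀ x ∈ A, q x ≤ ρ) →
    ∃ N : Finset V, (∀ x ∈ N, x ∈ A) ∧ (∀ a ∈ A, ∃ x ∈ N, q (a - x) ≤ α) ∧
      (N.card : ℝ) ≤ (1 + 2 * ρ / α) ^ p

/-- The marginals of `μ` in the directions of the `q`-ball of radius `R` are uniformly
subgaussian. -/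
def SubgaussianOn (μ : Measure V) (q : Seminorm ℝ V) (R c K₀ : ℝ) : Prop :=
  ∀ θ, q θ ≤ R → Integrable (fun u => Real.exp (c * inner ℝ θ u ^ 2)) μ ∧
    ∫ u, Real.exp (c * inner ℝ θ u ^ 2) ∂μ ≤ K₀

/-- The quadratic forms `∑ ⟨θ, u i⟩²` are bounded by `M * n` on the `q`-ball of radius `R`. -/
def RowsBounded (q : Seminorm ℝ V) (R M : ℝ) {n : ℕ} (u : Fin n → V) : Prop :=
  ∀ θ, q θ ≤ R → ∑ i, inner ℝ θ (u i) ^ 2 ≤ M * n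

lemma SubgaussianOn.second_moment {μ : Measure V} [IsProbabilityMeasure μ] {q : Seminorm ℝ V}
    {R c K₀ : ℝ} (h : SubgaussianOn μ q R c K₀) (hc : 0 < c) {θ : V} (hθ : q θ ≤ R) :
    Integrable (fun u => inner ℝ θ u ^ 2) μ ∧ ∫ u, inner ℝ θ u ^ 2 ∂μ ≤ K₀ / c := by
  obtain ⟨hi, hb⟩ := h θ hθ
  have hle : ∀ u : V, inner ℝ θ u ^ 2 ≤ c⁻¹ * Real.exp (c * inner ℝ θ u ^ 2) := by
    intro u
    rw [inv_mul_eq_div, le_div_iff₀ hc]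
    linarith [Real.add_one_le_exp (c * inner ℝ θ u ^ 2)]
  have hi2 : Integrable (fun u => inner ℝ θ u ^ 2) μ := by
    refine (hi.const_mul c⁻¹).mono'
      (by fun_prop : Continuous fun u : V => inner ℝ θ u ^ 2).aestronglyMeasurable
      (ae_of_all _ fun u => ?_)
    rw [Real.norm_of_nonneg (sq_nonneg _)]
    exact hle u
  refine ⟨hi2, ?_⟩
  calc ∫ u, inner ℝ θ u ^ 2 ∂μ ≤ ∫ u, c⁻¹ * Real.exp (c * inner ℝ θ u ^ 2) ∂μ :=
        integral_mono hi2 (hi.const_mul _) hle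
    _ = c⁻¹ * ∫ u, Real.exp (c * inner ℝ θ u ^ 2) ∂μ := integral_const_mul _ _
    _ ≤ K₀ / c := by
        rw [inv_mul_eq_div]
        gcongr

/-- The vector of the inner products of `θ` with the rows `u i`. -/
def rowProducts {n : ℕ} (u : Fin n → V) : V →L[ℝ] EuclideanSpace ℝ (Fin n) :=
  LinearMap.toContinuousLinearMap
    { toFun := fun θ => WithLp.toLp 2 fun i => inner ℝ θ (u i)
      map_add' := fun x y => by ext i; simp [inner_add_left]
      map_smul' := fun r x => by ext i; simp [inner_smul_left] }

lemma norm_rowProducts_sq {n : ℕ} (u : Fin n → V) (θ : V) :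
    ‖rowProducts u θ‖ ^ 2 = ∑ i, inner ℝ θ (u i) ^ 2 := by
  rw [EuclideanSpace.real_norm_sq_eq]
  rfl

/-- Absorption: for a net point x near θ, the vector 2(θ - x) lies in the same ball, so the supremum
s of the norms satisfies s ≤ √(Bn) + s/2. The comparison of the norm with `q` makes s finite, and
squaring s ≤ 2√(Bn) gives the factor 4. -/
lemma rowsBounded_of_net {q : Seminorm ℝ V} (hq : ∀ θ, ‖θ‖ ≤ q θ) {R : ℝ} (hR : 0 < R)
    {N : Finset V} (hN : ∀ a, q a ≤ R → ∃ x ∈ N, q (a - x) ≤ R / 2)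
    {n : ℕ} (u : Fin n → V) {B : ℝ} (hB : 0 ≤ B)
    (hu : ∀ θ ∈ N, ∑ i, inner ℝ θ (u i) ^ 2 ≤ B * n) :
    RowsBounded q R (4 * B) u := by
  set S : Set ℝ := (fun θ => ‖rowProducts u θ‖) '' {θ | q θ ≤ R} with hS
  have hSb : BddAbove S := by
    refine ⟨‖rowProducts u‖ * R, ?_⟩
    rintro _ ⟨θ, hθ, rfl⟩
    refine ((rowProducts u).le_opNorm θ).trans ?_
    gcongr
    exact (hq θ).trans hθ
  have hSne : S.Nonempty := ⟨_, 0, by simpa using hR.le, rfl⟩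
  set b := Real.sqrt (B * n)
  have hs : sSup S ≤ b + sSup S / 2 := by
    refine csSup_le hSne ?_
    rintro _ ⟨θ, hθ, rfl⟩
    obtain ⟨x, hx, hxq⟩ := hN θ hθ
    have h1 : ‖rowProducts u x‖ ≤ b := by
      refine Real.le_sqrt_of_sq_le ?_
      rw [norm_rowProducts_sq]
      exact hu x hx
    have h2 : ‖rowProducts u ((2 : ℝ) • (θ - x))‖ ≤ sSup S := by
      refine le_csSup hSb ⟨_, ?_, rfl⟩
      simp only [Set.mem_ofPred_eq]
      rw [map_smul_eq_mul, Real.norm_of_nonneg (by norm_num)]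
      linarith
    rw [map_smul, norm_smul, Real.norm_of_nonneg (by norm_num)] at h2
    have h3 : rowProducts u θ = rowProducts u x + rowProducts u (θ - x) := by
      rw [← map_add, add_sub_cancel]
    simp only [h3]
    refine (norm_add_le _ _).trans ?_
    linarith
  intro θ hθ
  have h1 : ‖rowProducts u θ‖ ≤ 2 * b := by
    have := le_csSup hSb ⟨θ, hθ, rfl⟩
    simp only at this
    linarith
  rw [← norm_rowProducts_sq]
  calc ‖rowProducts u θ‖ ^ 2 ≤ (2 * b) ^ 2 := by gcongr
    _ = 4 * (B * n) := by rw [mul_pow, Real.sq_sqrt (by positivity)]; norm_num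
    _ = _ := by ring

/-- Independent rows with subgaussian marginals are bounded with overwhelming probability. -/
theorem measure_not_rowsBounded_le {μ : Measure V} [IsProbabilityMeasure μ] {q : Seminorm ℝ V}
    (hq : ∀ θ, ‖θ‖ ≤ q θ) {R c K₀ γ : ℝ} (hR : 0 < R) (hc : 0 < c) (hK₀ : 1 ≤ K₀)
    (hμ : SubgaussianOn μ q R c K₀) {p n : ℕ} (hnet : HasNets q p) (hp : (p : ℝ) ≤ γ * n) :
    (Measure.pi fun _ : Fin n => μ).real
      {u | ¬ RowsBounded q R (4 * ((γ * Real.log 5 + Real.log K₀ + 1) / c)) u} ≤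
        Real.exp (-n) := by
  rcases Nat.eq_zero_or_pos n with rfl | hn
  · have h0 : ((0 : ℕ) : ℝ) = 0 := by norm_num
    rw [h0, neg_zero, Real.exp_zero]
    exact measureReal_le_one
  have hn0 : (0 : ℝ) < n := by exact_mod_cast hn
  have hγ : 0 ≤ γ := by
    by_contra! h
    have : γ * n < 0 := mul_neg_of_neg_of_pos h hn0
    linarith [Nat.cast_nonneg (α := ℝ) p]
  -- Chosen so that the union bound closes exactly: a net of mesh R/2 has at most 5^p points, and γ
  -- n log 5 + n log K₀ - c B n = -n.
  set B := (γ * Real.log 5 + Real.log K₀ + 1) / c with hB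
  have hl5 : 0 < Real.log 5 := Real.log_pos (by norm_num)
  have hB0 : 0 ≤ B := by
    have := Real.log_nonneg hK₀
    positivity
  obtain ⟨N, hNA, hNc, hNcard⟩ := hnet {θ | q θ ≤ R} R (R / 2) hR.le (by positivity)
    fun x hx => hx
  have h5 : 1 + 2 * R / (R / 2) = 5 := by field_simp; norm_num
  rw [h5] at hNcard
  set π : Measure (Fin n → V) := Measure.pi fun _ : Fin n => μ with hπ
  have : IsProbabilityMeasure π := by rw [hπ]; infer_instance
  have hsub : {u : Fin n → V | ¬ RowsBounded q R (4 * B) u} ⊆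
      ⋃ θ ∈ N, {u | B * n ≤ ∑ i, inner ℝ θ (u i) ^ 2} := by
    intro u hu
    by_contra hcon
    refine hu (rowsBounded_of_net hq hR (N := N) (fun a ha => hNc a ha) u hB0 fun θ hθ => ?_)
    simp only [Set.mem_iUnion, not_exists] at hcon
    exact (not_le.1 (hcon θ hθ)).le
  -- Chernoff bound: by independence the exponential moment of the sum is a product of n factors,
  -- each at most K₀.
  have hone : ∀ θ ∈ N, π.real {u | B * n ≤ ∑ i, inner ℝ θ (u i) ^ 2} ≤
      Real.exp (-(c * B * n)) * K₀ ^ n := by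
    intro θ hθ
    obtain ⟨hi, hb⟩ := hμ θ (hNA θ hθ)
    have hpi : Integrable (fun u : Fin n → V => ∏ i, Real.exp (c * inner ℝ θ (u i) ^ 2)) π :=
      Integrable.fintype_prod fun _ => hi
    have hval : ∫ u : Fin n → V, ∏ i, Real.exp (c * inner ℝ θ (u i) ^ 2) ∂π ≤ K₀ ^ n := by
      have h1 := integral_fintype_prod_eq_pow (ι := Fin n) (μ := μ)
        (fun u : V => Real.exp (c * inner ℝ θ u ^ 2))
      rw [h1, Fintype.card_fin]
      exact pow_le_pow_left₀ (integral_nonneg fun _ => (Real.exp_pos _).le) hb n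
    have hmark := mul_meas_ge_le_integral_of_nonneg
      (ae_of_all π fun u : Fin n → V =>
        (Finset.prod_nonneg fun i _ => (Real.exp_pos (c * inner ℝ θ (u i) ^ 2)).le :
          (0 : ℝ) ≤ ∏ i, Real.exp (c * inner ℝ θ (u i) ^ 2))) hpi (Real.exp (c * B * n))
    have hset : {u : Fin n → V | Real.exp (c * B * n) ≤ ∏ i, Real.exp (c * inner ℝ θ (u i) ^ 2)} =
        {u | B * n ≤ ∑ i, inner ℝ θ (u i) ^ 2} := by
      ext u
      simp only [Set.mem_ofPred_eq]
      rw [← Real.exp_sum, Real.exp_le_exp, ← Finset.mul_sum, mul_assoc, mul_le_mul_iff_right₀ hc]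
    rw [hset] at hmark
    rw [Real.exp_neg, inv_mul_eq_div, le_div_iff₀ (Real.exp_pos _), mul_comm]
    exact hmark.trans hval
  calc π.real {u | ¬ RowsBounded q R (4 * B) u}
      ≤ π.real (⋃ θ ∈ N, {u | B * n ≤ ∑ i, inner ℝ θ (u i) ^ 2}) := measureReal_mono hsub (measure_ne_top _ _)
    _ ≤ ∑ θ ∈ N, π.real {u | B * n ≤ ∑ i, inner ℝ θ (u i) ^ 2} :=
        measureReal_biUnion_finset_le _ _
    _ ≤ ∑ θ ∈ N, Real.exp (-(c * B * n)) * K₀ ^ n := Finset.sum_le_sum hone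
    _ = N.card * (Real.exp (-(c * B * n)) * K₀ ^ n) := by rw [Finset.sum_const, nsmul_eq_mul]
    _ ≤ Real.exp (γ * n * Real.log 5) * (Real.exp (-(c * B * n)) * Real.exp (n * Real.log K₀)) := by
        have h1 : (N.card : ℝ) ≤ Real.exp (γ * n * Real.log 5) := by
          refine hNcard.trans ?_
          rw [← Real.rpow_natCast, Real.rpow_def_of_pos (by norm_num)]
          refine Real.exp_le_exp.2 ?_
          rw [mul_comm]
          gcongr
        have h2 : K₀ ^ n = Real.exp (n * Real.log K₀) := by
          rw [← Real.rpow_natCast, Real.rpow_def_of_pos (by linarith), mul_comm]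
        rw [h2]
        gcongr
    _ = Real.exp (-n) := by
        rw [← Real.exp_add, ← Real.exp_add]
        congr 1
        rw [hB]
        field_simp
        ring

end Rows

/-- Uniform closeness of the characteristic functions of `μ` and `μ'` controls bounded Lipschitz
functions of finitely many marginals. -/
theorem exists_charFun_close_imp_marginals_close (ι : Type) [Fintype ι] (R c K₀ B L ε : ℝ)
    (hR : 0 < R) (hc : 0 < c) (hε : 0 < ε) :
    ∃ δ : ℝ, 0 < δ ∧ ∀ (V : Type) [NormedAddCommGroup V] [InnerProductSpace ℝ V]
      [FiniteDimensional ℝ V] [MeasurableSpace V] [BorelSpace V] (q : Seminorm ℝ V)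
      (μ μ' : Measure V) [IsProbabilityMeasure μ] [IsProbabilityMeasure μ'],
      SubgaussianOn μ q R c K₀ → SubgaussianOn μ' q R c K₀ →
      (∀ θ, ‖charFun μ θ - charFun μ' θ‖ ≤ δ * (1 + q θ ^ 2)) →
      ∀ θ : ι → V, (∀ j, q (θ j) ≤ R) → ∀ φ : (ι → ℝ) → ℝ,
        (∀ x y, |φ x - φ y| ≤ L * ‖x - y‖) → (∀ x, |φ x| ≤ B) →
        |∫ u, φ (fun j => inner ℝ (θ j) u) ∂μ - ∫ u, φ (fun j => inner ℝ (θ j) u) ∂μ'| ≤ ε := by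
  set J : ℝ := ((Fintype.card ι : ℕ) : ℝ)
  obtain ⟨δ, hδ, h⟩ := exists_charFun_close_imp_lipschitz_close (E := EuclideanSpace ℝ ι)
    B (|L|) (J * (K₀ / c)) ε hε
  have hJ : 0 ≤ J := Nat.cast_nonneg _
  -- The characteristic function of the marginals at s is that of the row law at ∑ s_j θ_j, and q of
  -- this vector squared is at most R² J ‖s‖². The choice is made before the space `V`, so it is
  -- free of the dimension.
  refine ⟨δ / (1 + R ^ 2 * J), by positivity, ?_⟩
  intro V _ _ _ _ _ q μ μ' _ _ hμ hμ' hcf θ hθ φ hφL hφB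
  set T : V → EuclideanSpace ℝ ι := fun u => WithLp.toLp 2 fun j => inner ℝ (θ j) u with hT
  have hTc : Continuous T := by fun_prop
  have hφc : Continuous φ :=
    (LipschitzWith.of_dist_le_mul (K := ⟨|L|, abs_nonneg L⟩) fun x y => by
      rw [Real.dist_eq, dist_eq_norm]
      exact (hφL x y).trans (mul_le_mul_of_nonneg_right (le_abs_self L) (norm_nonneg _))).continuous
  have hTn : ∀ u, ‖T u‖ ^ 2 = ∑ j, inner ℝ (θ j) u ^ 2 := fun u => by
    rw [EuclideanSpace.real_norm_sq_eq]
  have hchar : ∀ (μ : Measure V) (s : EuclideanSpace ℝ ι),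
      charFun (μ.map T) s = charFun μ (∑ j, s j • θ j) := by
    intro μ s
    rw [charFun_apply, charFun_apply, integral_map hTc.aemeasurable
      (by fun_prop : Continuous _).aestronglyMeasurable]
    refine integral_congr_ae (ae_of_all _ fun u => ?_)
    simp only [hT, PiLp.inner_apply, inner_sum, inner_smul_right]
    congr 3
    refine Finset.sum_congr rfl fun j _ => ?_
    simp [real_inner_comm]
  have hmom : ∀ (μ : Measure V) [IsProbabilityMeasure μ], SubgaussianOn μ q R c K₀ →
      Integrable (fun y => ‖y‖ ^ 2) (μ.map T) ∧ ∫ y, ‖y‖ ^ 2 ∂(μ.map T) ≤ J * (K₀ / c) := by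
    intro μ _ hμ
    have h1 := fun j => hμ.second_moment hc (hθ j)
    constructor
    · rw [integrable_map_measure (by fun_prop : Continuous _).aestronglyMeasurable
        hTc.aemeasurable]
      simp only [Function.comp_def, hTn]
      exact integrable_finsetSum _ fun j _ => (h1 j).1
    · rw [integral_map hTc.aemeasurable (by fun_prop : Continuous _).aestronglyMeasurable]
      simp only [hTn]
      rw [integral_finsetSum _ fun j _ => (h1 j).1]
      calc _ ≤ ∑ _j : ι, K₀ / c := Finset.sum_le_sum fun j _ => (h1 j).2
        _ = _ := by simp [J]
  have hint : ∀ (μ : Measure V), ∫ u, φ (fun j => inner ℝ (θ j) u) ∂μ =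
      ∫ y, φ (WithLp.ofLp y) ∂(μ.map T) := by
    intro μ
    rw [integral_map hTc.aemeasurable (by fun_prop : Continuous _).aestronglyMeasurable]
  rw [hint, hint]
  have := Measure.isProbabilityMeasure_map (μ := μ) hTc.aemeasurable
  have := Measure.isProbabilityMeasure_map (μ := μ') hTc.aemeasurable
  refine h (μ.map T) (μ'.map T) inferInstance inferInstance (hmom μ hμ).1 (hmom μ' hμ').1
    (hmom μ hμ).2 (hmom μ' hμ').2 (fun s => ?_) _ (fun x y => ?_) fun x => hφB _
  · rw [hchar, hchar]
    refine (hcf _).trans ?_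
    have h1 : q (∑ j, s j • θ j) ≤ R * ∑ j, |s j| := by
      calc q (∑ j, s j • θ j) ≤ ∑ j, q (s j • θ j) :=
            Finset.le_sum_of_subadditive q (map_zero q).le (map_add_le_add q) _ _
        _ ≤ ∑ j, |s j| * R := by
            refine Finset.sum_le_sum fun j _ => ?_
            rw [map_smul_eq_mul, Real.norm_eq_abs]
            exact mul_le_mul_of_nonneg_left (hθ j) (abs_nonneg _)
        _ = _ := by rw [← Finset.sum_mul, mul_comm]
    have h2 : (∑ j, |s j|) ^ 2 ≤ J * ‖s‖ ^ 2 := by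
      rw [EuclideanSpace.real_norm_sq_eq]
      have := sq_sum_le_card_mul_sum_sq (s := Finset.univ) (f := fun j => |s j|)
      simpa [J] using this
    have h3 : q (∑ j, s j • θ j) ^ 2 ≤ R ^ 2 * J * ‖s‖ ^ 2 := by
      calc q (∑ j, s j • θ j) ^ 2 ≤ (R * ∑ j, |s j|) ^ 2 := by
            gcongr
        _ = R ^ 2 * (∑ j, |s j|) ^ 2 := by ring
        _ ≤ R ^ 2 * (J * ‖s‖ ^ 2) := by gcongr
        _ = _ := by ring
    rw [div_mul_eq_mul_div, div_le_iff₀ (by positivity), mul_assoc]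
    gcongr
    have : 0 ≤ R ^ 2 * J := by positivity
    nlinarith [sq_nonneg ‖s‖]
  · refine (hφL _ _).trans ?_
    refine mul_le_mul (le_abs_self L) ?_ (norm_nonneg _) (abs_nonneg L)
    rw [← WithLp.ofLp_sub]
    refine (pi_norm_le_iff_of_nonneg (norm_nonneg _)).2 fun j => ?_
    exact PiLp.norm_apply_le (x - y) j

/-! ### The Lindeberg replacement principle -/

lemma abs_integral_le_of_abs_le {Ω : Type*} [MeasurableSpace Ω] {ρ : Measure Ω}
    [IsProbabilityMeasure ρ] {f : Ω → ℝ} {B : ℝ} (h : ∀ x, |f x| ≤ B) : |∫ x, f x ∂ρ| ≤ B := by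
  have := norm_integral_le_of_norm_le_const (μ := ρ) (f := f) (C := B) (ae_of_all _ h)
  simpa using this

lemma integral_pi_fin_succ {V : Type*} [MeasurableSpace V] (μ : Measure V)
    [IsProbabilityMeasure μ] {n : ℕ} {Φ : (Fin (n + 1) → V) → ℝ} (hm : Measurable Φ) {B : ℝ}
    (hB : ∀ u, |Φ u| ≤ B) :
    ∫ u, Φ u ∂(Measure.pi fun _ => μ) =
      ∫ u, ∫ x, Φ (Fin.cons x u) ∂μ ∂(Measure.pi fun _ : Fin n => μ) := by
  have h := (measurePreserving_piFinSuccAbove (fun _ : Fin (n + 1) => μ) 0).symm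
  rw [← h.integral_comp']
  have hmeas := hm.comp h.measurable
  rw [integral_prod_symm]
  · simp only [MeasurableEquiv.piFinSuccAbove_symm_apply, Fin.insertNthEquiv, Equiv.coe_fn_mk,
      Fin.insertNth_zero']
  · exact Integrable.of_bound hmeas.aestronglyMeasurable B (ae_of_all _ fun p => hB _)

lemma measurable_fin_cons {V : Type*} [MeasurableSpace V] (n : ℕ) :
    Measurable fun p : V × (Fin n → V) => (Fin.cons p.1 p.2 : Fin (n + 1) → V) := by
  rw [measurable_pi_iff]
  intro i
  refine Fin.cases ?_ (fun j => ?_) i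
  · simpa using measurable_fst
  · simp only [Fin.cons_succ]
    exact (measurable_pi_apply j).comp measurable_snd

/-- If replacing the law of a single coordinate changes the mean of `Φ` by at most `ε`, then
replacing the laws of all the `n` coordinates changes it by at most `n * ε`. -/
theorem abs_integral_pi_sub_le {V : Type*} [MeasurableSpace V] (μ μ' : Measure V)
    [IsProbabilityMeasure μ] [IsProbabilityMeasure μ'] {n : ℕ} {Φ : (Fin n → V) → ℝ}
    (hm : Measurable Φ) {B ε : ℝ} (hB : ∀ u, |Φ u| ≤ B)
    (h : ∀ i u, |∫ x, Φ (Function.update u i x) ∂μ - ∫ x, Φ (Function.update u i x) ∂μ'| ≤ ε) :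
    |∫ u, Φ u ∂(Measure.pi fun _ => μ) - ∫ u, Φ u ∂(Measure.pi fun _ => μ')| ≤ n * ε := by
  induction n with
  | zero =>
    have h0 : (fun _ : Fin 0 => μ) = fun _ => μ' := Subsingleton.elim _ _
    simp [h0]
  | succ n ih =>
    have hcm := hm.comp (measurable_fin_cons (V := V) n)
    have hint : ∀ (ρ : Measure V) [IsProbabilityMeasure ρ] (u : Fin n → V),
        Integrable (fun x => Φ (Fin.cons x u)) ρ := fun ρ _ u =>
      Integrable.of_bound (hcm.comp measurable_prodMk_right).aestronglyMeasurable B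
        (ae_of_all _ fun x => hB _)
    have hIm : ∀ (ρ : Measure V) [IsProbabilityMeasure ρ],
        Measurable fun u : Fin n → V => ∫ x, Φ (Fin.cons x u) ∂ρ := fun ρ _ =>
      ((hcm.comp measurable_swap).stronglyMeasurable.integral_prod_right' (ν := ρ)).measurable
    have hIB : ∀ (ρ : Measure V) [IsProbabilityMeasure ρ] (u : Fin n → V),
        |∫ x, Φ (Fin.cons x u) ∂ρ| ≤ B := fun ρ _ u =>
      abs_integral_le_of_abs_le fun x => hB _
    rw [integral_pi_fin_succ μ hm hB, integral_pi_fin_succ μ' hm hB]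
    -- Coordinate 0 is replaced first, the other coordinates still having law μ.
    have h1 : |∫ u, ∫ x, Φ (Fin.cons x u) ∂μ ∂(Measure.pi fun _ : Fin n => μ) -
        ∫ u, ∫ x, Φ (Fin.cons x u) ∂μ' ∂(Measure.pi fun _ : Fin n => μ)| ≤ ε := by
      rw [← integral_sub
        (Integrable.of_bound (hIm μ).aestronglyMeasurable B (ae_of_all _ (hIB μ)))
        (Integrable.of_bound (hIm μ').aestronglyMeasurable B (ae_of_all _ (hIB μ')))]
      refine abs_integral_le_of_abs_le fun u => ?_
      rcases isEmpty_or_nonempty V with hV | ⟨⟨x₀⟩⟩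
      · exact absurd (measure_univ (μ := μ)) (by simp [Set.eq_empty_of_isEmpty])
      · have := h 0 (Fin.cons x₀ u)
        simpa only [Fin.update_cons_zero] using this
    -- The induction hypothesis is used for the average of Φ over coordinate 0 under μ'; Fubini
    -- pulls this average outside, so the single-coordinate bound is inherited.
    have h2 := ih (hIm μ') (hIB μ') (fun i u => by
      have hsw : ∀ (ρ : Measure V) [IsProbabilityMeasure ρ],
          ∫ y, ∫ x, Φ (Fin.cons x (Function.update u i y)) ∂μ' ∂ρ =
          ∫ x, ∫ y, Φ (Fin.cons x (Function.update u i y)) ∂ρ ∂μ' := by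
        intro ρ _
        refine integral_integral_swap (Integrable.of_bound (Measurable.aestronglyMeasurable ?_) B
          (ae_of_all _ fun p => hB _))
        exact hcm.comp (measurable_snd.prodMk ((measurable_update u).comp measurable_fst))
      rw [hsw μ, hsw μ']
      have hIi : ∀ (ρ : Measure V) [IsProbabilityMeasure ρ], Integrable (fun x =>
          ∫ y, Φ (Fin.cons x (Function.update u i y)) ∂ρ) μ' := by
        intro ρ _
        refine Integrable.of_bound ?_ B (ae_of_all _ fun x =>
          abs_integral_le_of_abs_le fun y => hB _)
        have : Measurable fun p : V × V => Φ (Fin.cons p.1 (Function.update u i p.2)) :=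
          hcm.comp (measurable_fst.prodMk ((measurable_update u).comp measurable_snd))
        exact this.stronglyMeasurable.integral_prod_right.aestronglyMeasurable
      rw [← integral_sub (hIi μ) (hIi μ')]
      refine abs_integral_le_of_abs_le fun x => ?_
      have := h i.succ (Fin.cons x u)
      simpa only [← Fin.cons_update] using this)
    have h3 := abs_sub_le (∫ u, ∫ x, Φ (Fin.cons x u) ∂μ ∂(Measure.pi fun _ : Fin n => μ))
      (∫ u, ∫ x, Φ (Fin.cons x u) ∂μ' ∂(Measure.pi fun _ : Fin n => μ))
      (∫ u, ∫ x, Φ (Fin.cons x u) ∂μ' ∂(Measure.pi fun _ : Fin n => μ'))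
    push_cast
    linarith

/-! ### Logarithms of partition functions -/

section Partition

/-- The inner products of `u` with the columns of `Θ` and of `Θs`. -/
def marginals {V : Type*} [NormedAddCommGroup V] [InnerProductSpace ℝ V] {k ks : ℕ}
    (Θ : Fin k → V) (Θs : Fin ks → V) (u : V) : Fin k ⊕ Fin ks → ℝ :=
  Sum.elim (fun j => inner ℝ (Θ j) u) (fun j => inner ℝ (Θs j) u)

/-- The moments of a partition function are averages of functions of finitely many marginals. -/
theorem exists_charFun_close_imp_pow_close (k ks : ℕ) (R c K₀ K A β ε : ℝ) (hR : 0 < R)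
    (hc : 0 < c) (hK : 0 ≤ K) (hβ : 0 < β) (hε : 0 < ε) (j : ℕ) :
    ∃ δ : ℝ, 0 < δ ∧ ∀ (V : Type) [NormedAddCommGroup V] [InnerProductSpace ℝ V]
      [FiniteDimensional ℝ V] [MeasurableSpace V] [BorelSpace V] (q : Seminorm ℝ V)
      (μ μ' : Measure V) [IsProbabilityMeasure μ] [IsProbabilityMeasure μ'],
      SubgaussianOn μ q R c K₀ → SubgaussianOn μ' q R c K₀ →
      (∀ θ, ‖charFun μ θ - charFun μ' θ‖ ≤ δ * (1 + q θ ^ 2)) →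
      ∀ h : (Fin k ⊕ Fin ks → ℝ) → ℝ, (∀ x y, |h x - h y| ≤ K * ‖x - y‖) → (∀ x, |h x| ≤ A) →
      ∀ Θs : Fin ks → V, (∀ i, q (Θs i) ≤ R) → ∀ N : Finset (Fin k → V),
        (∀ Θ ∈ N, ∀ i, q (Θ i) ≤ R) → ∀ w : (Fin k → V) → ℝ, (∀ Θ ∈ N, 0 ≤ w Θ) →
        ∑ Θ ∈ N, w Θ = 1 →
        |∫ u, (∑ Θ ∈ N, w Θ * Real.exp (-(β * h (marginals Θ Θs u)))) ^ j ∂μ -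
          ∫ u, (∑ Θ ∈ N, w Θ * Real.exp (-(β * h (marginals Θ Θs u)))) ^ j ∂μ'| ≤ ε := by
  -- The j-th power expands over j replicas of Θ, each with its own k columns, sharing the ks
  -- columns of Θs. A product of j Boltzmann factors is bounded by exp(jβA) and Lipschitz with that
  -- bound times jβK.
  obtain ⟨δ, hδ, H⟩ := exists_charFun_close_imp_marginals_close ((Fin j × Fin k) ⊕ Fin ks)
    R c K₀ (Real.exp (j * (β * A))) (Real.exp (j * (β * A)) * (j * (β * K))) ε hR hc hε
  refine ⟨δ, hδ, ?_⟩
  intro V _ _ _ _ _ q μ μ' _ _ hμ hμ' hcf h hL hB Θs hΘs N hN w hw hw1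
  classical
  have hhc : Continuous h :=
    (LipschitzWith.of_dist_le_mul (K := ⟨K, hK⟩) fun x y => by
      rw [Real.dist_eq, dist_eq_norm]; exact hL x y).continuous
  set sel : Fin j → ((Fin j × Fin k) ⊕ Fin ks → ℝ) → (Fin k ⊕ Fin ks → ℝ) := fun l x =>
    Sum.elim (fun i => x (Sum.inl (l, i))) (fun i => x (Sum.inr i)) with hsel
  have hselL : ∀ l x y, ‖sel l x - sel l y‖ ≤ ‖x - y‖ := by
    intro l x y
    refine (pi_norm_le_iff_of_nonneg (norm_nonneg _)).2 fun i => ?_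
    rcases i with i | i
    · exact norm_le_pi_norm (x - y) (Sum.inl (l, i))
    · exact norm_le_pi_norm (x - y) (Sum.inr i)
  have hselc : ∀ l, Continuous (sel l) := fun l =>
    (LipschitzWith.of_dist_le_mul (K := 1) fun x y => by
      rw [dist_eq_norm, dist_eq_norm]; simpa using hselL l x y).continuous
  set φ : ((Fin j × Fin k) ⊕ Fin ks → ℝ) → ℝ := fun x =>
    Real.exp (∑ l, -(β * h (sel l x))) with hφ
  have hsum : ∀ x, ∑ l : Fin j, -(β * h (sel l x)) ≤ j * (β * A) := by
    intro x
    calc _ ≤ ∑ _l : Fin j, β * A := Finset.sum_le_sum fun l _ => by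
          have := neg_le_of_abs_le (hB (sel l x))
          nlinarith
      _ = _ := by simp
  have hφB : ∀ x, |φ x| ≤ Real.exp (j * (β * A)) := fun x => by
    rw [hφ, abs_of_pos (Real.exp_pos _)]
    exact Real.exp_le_exp.2 (hsum x)
  have hexp : ∀ a b M : ℝ, a ≤ M → b ≤ M → |Real.exp a - Real.exp b| ≤
      Real.exp M * |a - b| := by
    intro a b M ha hb
    have := (convex_Iic M).norm_image_sub_le_of_norm_hasDerivWithin_le
      (f := Real.exp) (f' := Real.exp) (C := Real.exp M)
      (fun x _ => (Real.hasDerivAt_exp x).hasDerivWithinAt)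
      (fun x hx => by
        rw [Real.norm_of_nonneg (Real.exp_pos x).le]
        exact Real.exp_le_exp.2 hx) (x := b) (y := a) hb ha
    simpa using this
  have hφL : ∀ x y, |φ x - φ y| ≤ Real.exp (j * (β * A)) * (j * (β * K)) * ‖x - y‖ := by
    intro x y
    refine (hexp _ _ _ (hsum x) (hsum y)).trans ?_
    rw [mul_assoc]
    gcongr
    rw [← Finset.sum_sub_distrib]
    calc |∑ l : Fin j, (-(β * h (sel l x)) - -(β * h (sel l y)))|
        ≤ ∑ l : Fin j, |-(β * h (sel l x)) - -(β * h (sel l y))| :=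
          Finset.abs_sum_le_sum_abs _ _
      _ ≤ ∑ _l : Fin j, β * K * ‖x - y‖ := Finset.sum_le_sum fun l _ => by
          have h1 : -(β * h (sel l x)) - -(β * h (sel l y)) =
            -(β * (h (sel l x) - h (sel l y))) := by ring
          rw [h1, abs_neg, abs_mul, abs_of_pos hβ, mul_assoc]
          gcongr
          refine (hL _ _).trans ?_
          gcongr
          exact hselL l x y
      _ = _ := by simp; ring
  have hφc : Continuous φ := by
    simp only [hφ]
    exact Real.continuous_exp.comp (continuous_finsetSum _ fun l _ =>
      ((continuous_const.mul (hhc.comp (hselc l))).neg))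
  set I : Finset (Fin j → Fin k → V) := Fintype.piFinset fun _ : Fin j => N with hI
  set cols : (Fin j → Fin k → V) → (Fin j × Fin k) ⊕ Fin ks → V := fun f =>
    Sum.elim (fun a => f a.1 a.2) Θs with hcols
  -- The weights of the replicas multiply and still sum to 1, so the bound for one choice of
  -- replicas survives averaging, independently of the size of `N`.
  have hpow : ∀ u, (∑ Θ ∈ N, w Θ * Real.exp (-(β * h (marginals Θ Θs u)))) ^ j =
      ∑ f ∈ I, (∏ l, w (f l)) * φ (fun a => inner ℝ (cols f a) u) := by
    intro u
    have h1 := Finset.prod_univ_sum (fun _ : Fin j => N)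
      (fun _ Θ => w Θ * Real.exp (-(β * h (marginals Θ Θs u))))
    rw [Finset.prod_const, Finset.card_univ, Fintype.card_fin] at h1
    rw [h1]
    refine Finset.sum_congr rfl fun f _ => ?_
    rw [Finset.prod_mul_distrib, ← Real.exp_sum]
    congr 3
  have hint : ∀ (ρ : Measure V) [IsProbabilityMeasure ρ] (f : Fin j → Fin k → V),
      Integrable (fun u => (∏ l, w (f l)) * φ (fun a => inner ℝ (cols f a) u)) ρ := by
    intro ρ _ f
    refine (Integrable.of_bound ?_ (Real.exp (j * (β * A)))
      (ae_of_all _ fun u => hφB (fun a => inner ℝ (cols f a) u))).const_mul _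
    exact (hφc.comp (by fun_prop : Continuous fun u : V =>
      fun a => (inner ℝ (cols f a) u : ℝ))).aestronglyMeasurable
  simp_rw [hpow]
  rw [integral_finsetSum _ fun f _ => hint μ f, integral_finsetSum _ fun f _ => hint μ' f,
    ← Finset.sum_sub_distrib]
  have hw0 : ∀ f ∈ I, 0 ≤ ∏ l, w (f l) := fun f hf =>
    Finset.prod_nonneg fun l _ => hw _ (Fintype.mem_piFinset.1 hf l)
  calc _ ≤ ∑ f ∈ I, |∫ u, (∏ l, w (f l)) * φ (fun a => inner ℝ (cols f a) u) ∂μ -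
        ∫ u, (∏ l, w (f l)) * φ (fun a => inner ℝ (cols f a) u) ∂μ'| :=
        Finset.abs_sum_le_sum_abs _ _
    _ ≤ ∑ f ∈ I, (∏ l, w (f l)) * ε := by
        refine Finset.sum_le_sum fun f hf => ?_
        rw [integral_const_mul, integral_const_mul, ← mul_sub, abs_mul, abs_of_nonneg (hw0 f hf)]
        refine mul_le_mul_of_nonneg_left ?_ (hw0 f hf)
        refine H V q μ μ' hμ hμ' hcf (cols f) (fun a => ?_) φ hφL hφB
        rcases a with a | a
        · exact hN _ (Fintype.mem_piFinset.1 hf a.1) a.2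
        · exact hΘs a
    _ = ε := by
        rw [← Finset.sum_mul]
        have h1 := Finset.prod_univ_sum (fun _ : Fin j => N) (fun _ Θ => w Θ)
        rw [← h1, hw1]
        simp

lemma partition_mem_Icc {α : Type*} {N : Finset α} {w f : α → ℝ} (hw : ∀ x ∈ N, 0 ≤ w x)
    (hw1 : ∑ x ∈ N, w x = 1) {M : ℝ} (hf : ∀ x ∈ N, |f x| ≤ M) :
    ∑ x ∈ N, w x * Real.exp (-f x) ∈ Set.Icc (Real.exp (-M)) (Real.exp M) := by
  constructor
  · calc Real.exp (-M) = ∑ x ∈ N, w x * Real.exp (-M) := by rw [← Finset.sum_mul, hw1, one_mul]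
      _ ≤ _ := by
          refine Finset.sum_le_sum fun x hx => mul_le_mul_of_nonneg_left ?_ (hw x hx)
          exact Real.exp_le_exp.2 (neg_le_neg (le_of_abs_le (hf x hx)))
  · calc _ ≤ ∑ x ∈ N, w x * Real.exp M := by
          refine Finset.sum_le_sum fun x hx => mul_le_mul_of_nonneg_left ?_ (hw x hx)
          exact Real.exp_le_exp.2 (neg_le.1 (neg_le_of_abs_le (hf x hx)))
      _ = Real.exp M := by rw [← Finset.sum_mul, hw1, one_mul]

/-- Uniform closeness of characteristic functions controls the means of logarithms of partition
functions. -/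
theorem exists_charFun_close_imp_log_close (k ks : ℕ) (R c K₀ K A β ε : ℝ) (hR : 0 < R)
    (hc : 0 < c) (hK : 0 ≤ K) (hA : 0 ≤ A) (hβ : 0 < β) (hε : 0 < ε) :
    ∃ δ : ℝ, 0 < δ ∧ ∀ (V : Type) [NormedAddCommGroup V] [InnerProductSpace ℝ V]
      [FiniteDimensional ℝ V] [MeasurableSpace V] [BorelSpace V] (q : Seminorm ℝ V)
      (μ μ' : Measure V) [IsProbabilityMeasure μ] [IsProbabilityMeasure μ'],
      SubgaussianOn μ q R c K₀ → SubgaussianOn μ' q R c K₀ →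
      (∀ θ, ‖charFun μ θ - charFun μ' θ‖ ≤ δ * (1 + q θ ^ 2)) →
      ∀ h : (Fin k ⊕ Fin ks → ℝ) → ℝ, (∀ x y, |h x - h y| ≤ K * ‖x - y‖) → (∀ x, |h x| ≤ A) →
      ∀ Θs : Fin ks → V, (∀ i, q (Θs i) ≤ R) → ∀ N : Finset (Fin k → V),
        (∀ Θ ∈ N, ∀ i, q (Θ i) ≤ R) → ∀ w : (Fin k → V) → ℝ, (∀ Θ ∈ N, 0 ≤ w Θ) →
        ∑ Θ ∈ N, w Θ = 1 →
        |∫ u, Real.log (∑ Θ ∈ N, w Θ * Real.exp (-(β * h (marginals Θ Θs u)))) ∂μ -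
          ∫ u, Real.log (∑ Θ ∈ N, w Θ * Real.exp (-(β * h (marginals Θ Θs u)))) ∂μ'| ≤ ε := by
  set a := Real.exp (-(β * A))
  set b := Real.exp (β * A)
  have ha : 0 < a := Real.exp_pos _
  -- Bounded losses confine the partition function to [exp(-βA), exp(βA)], where Weierstrass
  -- approximation of log applies. The polynomial depends on A, β and ε alone, so finitely many
  -- moments suffice and δ is the minimum over them.
  obtain ⟨Q, hQ⟩ := exists_polynomial_near_of_continuousOn a b Real.log
    (Real.continuousOn_log.mono fun x hx => by
      simpa using (ha.trans_le hx.1).ne') (ε / 4) (by positivity)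
  set D := Finset.range (Q.natDegree + 1) with hD
  set S := ∑ j ∈ D, |Q.coeff j| with hS
  have hS0 : 0 ≤ S := Finset.sum_nonneg fun _ _ => abs_nonneg _
  have hpow := fun j => exists_charFun_close_imp_pow_close k ks R c K₀ K A β (ε / 2 / (S + 1))
    hR hc hK hβ (by positivity) j
  choose δ hδ hpow using hpow
  have hDne : D.Nonempty := ⟨0, by simp [hD]⟩
  refine ⟨D.inf' hDne δ, (Finset.lt_inf'_iff _).2 fun j _ => hδ j, ?_⟩
  intro V _ _ _ _ _ q μ μ' _ _ hμ hμ' hcf h hL hB Θs hΘs N hN w hw hw1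
  have hhc : Continuous h :=
    (LipschitzWith.of_dist_le_mul (K := ⟨K, hK⟩) fun x y => by
      rw [Real.dist_eq, dist_eq_norm]; exact hL x y).continuous
  set F : V → ℝ := fun u => ∑ Θ ∈ N, w Θ * Real.exp (-(β * h (marginals Θ Θs u))) with hF
  have hmc : ∀ Θ : Fin k → V, Continuous (marginals Θ Θs) := fun Θ => by
    refine continuous_pi fun i => ?_
    rcases i with i | i
    · exact (by fun_prop : Continuous fun u : V => (inner ℝ (Θ i) u : ℝ))
    · exact (by fun_prop : Continuous fun u : V => (inner ℝ (Θs i) u : ℝ))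
  have hFc : Continuous F := continuous_finsetSum _ fun Θ _ =>
    continuous_const.mul (Real.continuous_exp.comp
      (continuous_const.mul (hhc.comp (hmc Θ))).neg)
  have hFI : ∀ u, F u ∈ Set.Icc a b := fun u => partition_mem_Icc hw hw1 fun Θ _ => by
    rw [abs_mul, abs_of_pos hβ]
    exact mul_le_mul_of_nonneg_left (hB _) hβ.le
  have hlogB : ∀ u, |Real.log (F u)| ≤ β * A := fun u => by
    rw [abs_le]
    constructor
    · rw [Real.le_log_iff_exp_le (ha.trans_le (hFI u).1)]
      exact (hFI u).1
    · rw [Real.log_le_iff_le_exp (ha.trans_le (hFI u).1)]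
      exact (hFI u).2
  have hlogm : Measurable fun u => Real.log (F u) := Real.measurable_log.comp hFc.measurable
  have hpowi : ∀ (ρ : Measure V) [IsProbabilityMeasure ρ] (j : ℕ),
      Integrable (fun u => F u ^ j) ρ := by
    intro ρ _ j
    refine Integrable.of_bound (hFc.pow j).aestronglyMeasurable (b ^ j) (ae_of_all _ fun u => ?_)
    have h0 : 0 ≤ F u := ha.le.trans (hFI u).1
    rw [norm_pow, Real.norm_of_nonneg h0]
    exact pow_le_pow_left₀ h0 (hFI u).2 j
  have hQe : ∀ u, Q.eval (F u) = ∑ j ∈ D, Q.coeff j * F u ^ j := fun u => by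
    rw [Polynomial.eval_eq_sum_range]
  have hQi : ∀ (ρ : Measure V) [IsProbabilityMeasure ρ], Integrable (fun u => Q.eval (F u)) ρ := by
    intro ρ _
    simp_rw [hQe]
    exact integrable_finsetSum _ fun j _ => (hpowi ρ j).const_mul _
  have happrox : ∀ (ρ : Measure V) [IsProbabilityMeasure ρ],
      |∫ u, Real.log (F u) ∂ρ - ∫ u, Q.eval (F u) ∂ρ| ≤ ε / 4 := by
    intro ρ _
    rw [← integral_sub (Integrable.of_bound hlogm.aestronglyMeasurable _ (ae_of_all _ hlogB))
      (hQi ρ)]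
    refine abs_integral_le_of_abs_le fun u => ?_
    rw [abs_sub_comm]
    exact (hQ _ (hFI u)).le
  have hpoly : |∫ u, Q.eval (F u) ∂μ - ∫ u, Q.eval (F u) ∂μ'| ≤ ε / 2 := by
    simp_rw [hQe]
    rw [integral_finsetSum _ fun j _ => (hpowi μ j).const_mul _,
      integral_finsetSum _ fun j _ => (hpowi μ' j).const_mul _, ← Finset.sum_sub_distrib]
    calc _ ≤ ∑ j ∈ D, |∫ u, Q.coeff j * F u ^ j ∂μ - ∫ u, Q.coeff j * F u ^ j ∂μ'| :=
          Finset.abs_sum_le_sum_abs _ _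
      _ ≤ ∑ j ∈ D, |Q.coeff j| * (ε / 2 / (S + 1)) := by
          refine Finset.sum_le_sum fun j hj => ?_
          rw [integral_const_mul, integral_const_mul, ← mul_sub, abs_mul]
          gcongr
          refine hpow j V q μ μ' hμ hμ' (fun θ => (hcf θ).trans ?_) h hL hB Θs hΘs N hN w hw hw1
          gcongr
          exact Finset.inf'_le _ hj
      _ = S * (ε / 2 / (S + 1)) := by rw [← Finset.sum_mul]
      _ ≤ ε / 2 := by
          rw [mul_div_assoc', div_le_iff₀ (by positivity)]
          nlinarith
  have h1 := happrox μ
  have h2 := happrox μ'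
  rw [abs_le] at *
  constructor <;> linarith [h1.1, h1.2, h2.1, h2.2, hpoly.1, hpoly.2]

end Partition

/-! ### Empirical risks and their free energies -/

/-- The sum of exponentials lies between its largest term and the number of terms times it; this
makes the free energy a soft minimum with error log(card)/s. -/
lemma one_div_mul_log_sum_exp {α : Type*} {N : Finset α} (hN : N.Nonempty) (f : α → ℝ) {s : ℝ}
    (hs : 0 < s) :
    (∀ x ∈ N, -(1 / s) * Real.log (∑ y ∈ N, Real.exp (-(s * f y))) ≤ f x) ∧
      ∃ x ∈ N, f x - Real.log N.card / s ≤
        -(1 / s) * Real.log (∑ y ∈ N, Real.exp (-(s * f y))) := by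
  have hpos : 0 < ∑ y ∈ N, Real.exp (-(s * f y)) := Finset.sum_pos (fun _ _ => Real.exp_pos _) hN
  have hcard : (0 : ℝ) < N.card := by exact_mod_cast hN.card_pos
  constructor
  · intro x hx
    have h1 : Real.exp (-(s * f x)) ≤ ∑ y ∈ N, Real.exp (-(s * f y)) :=
      Finset.single_le_sum (f := fun y => Real.exp (-(s * f y)))
        (fun _ _ => (Real.exp_pos _).le) hx
    have h2 := (Real.le_log_iff_exp_le hpos).2 h1
    rw [neg_mul, one_div, neg_le, inv_mul_eq_div, le_div_iff₀ hs]
    linarith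
  · obtain ⟨x, hx, hmin⟩ := N.exists_min_image f hN
    refine ⟨x, hx, ?_⟩
    have h1 : ∑ y ∈ N, Real.exp (-(s * f y)) ≤ N.card * Real.exp (-(s * f x)) := by
      rw [← nsmul_eq_mul]
      refine Finset.sum_le_card_nsmul _ _ _ fun y hy => Real.exp_le_exp.2 ?_
      have := hmin y hy
      nlinarith
    have h2 := Real.log_le_log hpos h1
    rw [Real.log_mul hcard.ne' (Real.exp_pos _).ne', Real.log_exp] at h2
    have h3 : -(1 / s) * Real.log (∑ y ∈ N, Real.exp (-(s * f y))) =
        (-Real.log (∑ y ∈ N, Real.exp (-(s * f y)))) / s := by ring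
    rw [h3, sub_le_iff_le_add, ← add_div, le_div_iff₀ hs]
    linarith

/-- The infimum of a function over a set is close to the free energy of an approximation on a
net. -/
lemma abs_sInf_sub_freeEnergy_le {α : Type*} {S : Set α} {N : Finset α} {f g : α → ℝ}
    {e₁ e₂ s : ℝ} (hs : 0 < s) (hN : N.Nonempty) (hNS : ∀ x ∈ N, x ∈ S)
    (hfg : ∀ x ∈ N, |f x - g x| ≤ e₁) (hnet : ∀ x ∈ S, ∃ y ∈ N, f y ≤ f x + e₂) :
    |sInf (f '' S) - -(1 / s) * Real.log (∑ y ∈ N, Real.exp (-(s * g y)))| ≤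
      e₁ + e₂ + Real.log N.card / s := by
  obtain ⟨hle, x₀, hx₀, hge⟩ := one_div_mul_log_sum_exp hN g hs
  set F := -(1 / s) * Real.log (∑ y ∈ N, Real.exp (-(s * g y)))
  have hlog : 0 ≤ Real.log N.card / s :=
    div_nonneg (Real.log_nonneg (by exact_mod_cast hN.card_pos)) hs.le
  have hlow : ∀ y ∈ f '' S, F - e₁ - e₂ ≤ y := by
    rintro _ ⟨x, hx, rfl⟩
    obtain ⟨y, hy, hxy⟩ := hnet x hx
    have h1 := hle y hy
    have h2 := (abs_le.1 (hfg y hy)).1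
    linarith
  have he₂ : 0 ≤ e₁ := (abs_nonneg _).trans (hfg x₀ hx₀)
  obtain ⟨x₁, hx₁, hx₁min⟩ := N.exists_min_image f hN
  have he₂' : 0 ≤ e₂ := by
    obtain ⟨y, hy, hxy⟩ := hnet x₁ (hNS _ hx₁)
    have := hx₁min y hy
    linarith
  rw [abs_le]
  constructor
  · have := le_csInf (⟨f x₀, x₀, hNS _ hx₀, rfl⟩ : (f '' S).Nonempty) hlow
    linarith
  · have h1 : sInf (f '' S) ≤ f x₀ := csInf_le ⟨_, hlow⟩ ⟨x₀, hNS _ hx₀, rfl⟩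
    have h2 := (abs_le.1 (hfg x₀ hx₀)).2
    linarith

/-- Truncation of a real number to `[-A, A]`. -/
def clip (A t : ℝ) : ℝ := max (-A) (min t A)

lemma abs_clip_le {A : ℝ} (hA : 0 ≤ A) (t : ℝ) : |clip A t| ≤ A :=
  abs_le.2 ⟨le_max_left _ _, max_le (by linarith) (min_le_right _ _)⟩

lemma abs_clip_sub_clip_le (A s t : ℝ) : |clip A s - clip A t| ≤ |s - t| := by
  have h1 := abs_max_sub_max_le_abs (min s A) (min t A) (-A)
  have h2 := abs_min_sub_min_le_max s A t A
  rw [sub_self, abs_zero, max_eq_left (abs_nonneg _)] at h2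
  rw [clip, clip, max_comm (-A), max_comm (-A)]
  exact h1.trans h2

/-- The bound is quadratic so that the mean clipping error is controlled by the sum of squares of
the losses, hence by the quadratic forms of the rows. -/
lemma abs_sub_clip_le {A : ℝ} (hA : 0 < A) (t : ℝ) : |t - clip A t| ≤ t ^ 2 / A := by
  rw [le_div_iff₀ hA]
  rcases le_or_gt (-A) t with h1 | h1
  · rcases le_or_gt t A with h2 | h2
    · rw [clip, min_eq_left h2, max_eq_right h1, sub_self, abs_zero, zero_mul]
      positivity
    · rw [clip, min_eq_right h2.le, max_eq_right (by linarith), abs_of_pos (by linarith)]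
      nlinarith
  · rw [clip, min_eq_left (by linarith), max_eq_left h1.le, abs_of_neg (by linarith)]
    nlinarith

section Risk

variable {V : Type*} [NormedAddCommGroup V] [InnerProductSpace ℝ V] {k ks n : ℕ}

/-- The empirical risk of `Θ`, for losses `h i` of the marginals of the rows `u i`. -/
def risk (h : Fin n → (Fin k ⊕ Fin ks → ℝ) → ℝ) (r : (Fin k → V) → ℝ) (Θs : Fin ks → V)
    (u : Fin n → V) (Θ : Fin k → V) : ℝ :=
  (1 / (n : ℝ)) * ∑ i, h i (marginals Θ Θs (u i)) + r Θ

/-- The infimum of the empirical risk over `C^k`. -/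
def optRisk (C : Set V) (h : Fin n → (Fin k ⊕ Fin ks → ℝ) → ℝ) (r : (Fin k → V) → ℝ)
    (Θs : Fin ks → V) (u : Fin n → V) : ℝ :=
  sInf (risk h r Θs u '' {Θ | ∀ j, Θ j ∈ C})

/-- The free energy at inverse temperature `n * β` of the empirical risk with truncated losses. -/
def freeEnergy (A β : ℝ) (N : Finset (Fin k → V)) (h : Fin n → (Fin k ⊕ Fin ks → ℝ) → ℝ)
    (r : (Fin k → V) → ℝ) (Θs : Fin ks → V) (u : Fin n → V) : ℝ :=
  -(1 / (n * β)) * Real.log (∑ Θ ∈ N,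
    Real.exp (-((n * β) * risk (fun i x => clip A (h i x)) r Θs u Θ)))

lemma norm_sq_le_sum_sq {ι : Type*} [Fintype ι] (x : ι → ℝ) : ‖x‖ ^ 2 ≤ ∑ i, x i ^ 2 := by
  have h0 : 0 ≤ ∑ i, x i ^ 2 := Finset.sum_nonneg fun _ _ => sq_nonneg _
  refine (Real.le_sqrt (norm_nonneg _) h0).1 ?_
  refine (pi_norm_le_iff_of_nonneg (Real.sqrt_nonneg _)).2 fun i => ?_
  refine Real.le_sqrt_of_sq_le ?_
  rw [Real.norm_eq_abs, sq_abs]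
  exact Finset.single_le_sum (f := fun i => x i ^ 2) (fun _ _ => sq_nonneg _) (Finset.mem_univ i)

lemma norm_le_sum_abs {ι : Type*} [Fintype ι] (x : ι → ℝ) : ‖x‖ ≤ ∑ i, |x i| := by
  refine (pi_norm_le_iff_of_nonneg (Finset.sum_nonneg fun _ _ => abs_nonneg _)).2 fun i => ?_
  exact Finset.single_le_sum (f := fun i => |x i|) (fun _ _ => abs_nonneg _) (Finset.mem_univ i)

variable {q : Seminorm ℝ V} {R M : ℝ} {u : Fin n → V}
  {h : Fin n → (Fin k ⊕ Fin ks → ℝ) → ℝ} {r : (Fin k → V) → ℝ} {Θs : Fin ks → V} {K : ℝ}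

lemma RowsBounded.sum_norm_marginals_sq_le (hu : RowsBounded q R M u) (hΘs : ∀ j, q (Θs j) ≤ R)
    {Θ : Fin k → V} (hΘ : ∀ j, q (Θ j) ≤ R) :
    ∑ i, ‖marginals Θ Θs (u i)‖ ^ 2 ≤ (k + ks) * (M * n) := by
  calc _ ≤ ∑ i, ∑ a, marginals Θ Θs (u i) a ^ 2 :=
        Finset.sum_le_sum fun i _ => norm_sq_le_sum_sq _
    _ = ∑ a, ∑ i, marginals Θ Θs (u i) a ^ 2 := Finset.sum_comm
    _ ≤ ∑ _a : Fin k ⊕ Fin ks, M * n := by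
        refine Finset.sum_le_sum fun a _ => ?_
        rcases a with a | a
        · exact hu _ (hΘ a)
        · exact hu _ (hΘs a)
    _ = _ := by simp

/-- A loss that vanishes at zero is at most K times the norm of the marginals, so the quadratic
clipping error is summed by `RowsBounded.sum_norm_marginals_sq_le`. -/
lemma RowsBounded.abs_risk_sub_clip_le (hn : 0 < n) (hu : RowsBounded q R M u)
    (hL : ∀ i x y, |h i x - h i y| ≤ K * ‖x - y‖) (h0 : ∀ i, h i 0 = 0)
    (hΘs : ∀ j, q (Θs j) ≤ R) {Θ : Fin k → V} (hΘ : ∀ j, q (Θ j) ≤ R) {A : ℝ} (hA : 0 < A) :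
    |risk h r Θs u Θ - risk (fun i x => clip A (h i x)) r Θs u Θ| ≤
      K ^ 2 * ((k + ks) * M) / A := by
  have hn0 : (0 : ℝ) < n := by exact_mod_cast hn
  have h1 : risk h r Θs u Θ - risk (fun i x => clip A (h i x)) r Θs u Θ =
      (1 / (n : ℝ)) * ∑ i, (h i (marginals Θ Θs (u i)) - clip A (h i (marginals Θ Θs (u i)))) := by
    simp only [risk]
    rw [Finset.sum_sub_distrib]
    ring
  rw [h1, abs_mul, abs_of_pos (by positivity)]
  calc (1 / (n : ℝ)) * |∑ i, (h i (marginals Θ Θs (u i)) - clip A (h i (marginals Θ Θs (u i))))|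
      ≤ (1 / (n : ℝ)) * ∑ i, K ^ 2 / A * ‖marginals Θ Θs (u i)‖ ^ 2 := by
        gcongr
        refine (Finset.abs_sum_le_sum_abs _ _).trans (Finset.sum_le_sum fun i _ => ?_)
        refine (abs_sub_clip_le hA _).trans ?_
        have := hL i (marginals Θ Θs (u i)) 0
        rw [h0, sub_zero, sub_zero] at this
        rw [div_mul_eq_mul_div, ← mul_pow, ← sq_abs (h i _)]
        gcongr
    _ ≤ (1 / (n : ℝ)) * (K ^ 2 / A * ((k + ks) * (M * n))) := by
        rw [← Finset.mul_sum]
        gcongr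
        exact hu.sum_norm_marginals_sq_le hΘs hΘ
    _ = _ := by field_simp

/-- Cauchy–Schwarz over the rows, after rescaling θ into the ball of radius R by homogeneity of `q`.
-/
lemma RowsBounded.sum_abs_inner_le (hn : 0 < n) (hu : RowsBounded q R M u) {α : ℝ}
    (hα : 0 < α) {θ : V} (hθ : q θ ≤ α * R) :
    (1 / (n : ℝ)) * ∑ i, |inner ℝ θ (u i)| ≤ α * Real.sqrt M := by
  have hn0 : (0 : ℝ) < n := by exact_mod_cast hn
  have h1 := hu (α⁻¹ • θ) (by
    rw [map_smul_eq_mul, Real.norm_of_nonneg (by positivity), inv_mul_le_iff₀ hα]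
    exact hθ)
  simp only [inner_smul_left, mul_pow, RCLike.conj_to_real] at h1
  rw [← Finset.mul_sum, inv_pow, inv_mul_le_iff₀ (by positivity)] at h1
  have hCS := sq_sum_le_card_mul_sum_sq (s := Finset.univ) (f := fun i => |inner ℝ θ (u i)|)
  simp only [sq_abs, Finset.card_univ, Fintype.card_fin] at hCS
  have hM : 0 ≤ M := by
    have h2 : (0 : ℝ) ≤ ∑ i, inner ℝ θ (u i) ^ 2 := Finset.sum_nonneg fun _ _ => sq_nonneg _
    by_contra! hneg
    have : α ^ 2 * (M * n) < 0 :=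
      mul_neg_of_pos_of_neg (by positivity) (mul_neg_of_neg_of_pos hneg hn0)
    linarith
  rw [one_div, inv_mul_le_iff₀ hn0]
  refine le_of_sq_le_sq ?_ (by positivity)
  calc (∑ i, |inner ℝ θ (u i)|) ^ 2 ≤ n * (α ^ 2 * (M * n)) := hCS.trans (by gcongr)
    _ = (n * (α * Real.sqrt M)) ^ 2 := by
        rw [mul_pow, mul_pow, Real.sq_sqrt hM]
        ring

/-- Equicontinuity of the risk in Θ, used to restrict the infimum to a net. The marginals along Θs
cancel, so only averages of |⟨Θ j - Θ' j, u i⟩| remain. -/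
lemma RowsBounded.abs_risk_sub_risk_le (hn : 0 < n) (hR : 0 < R) (hu : RowsBounded q R M u)
    (hq : ∀ θ, ‖θ‖ ≤ q θ) (hK : 0 ≤ K) (hL : ∀ i x y, |h i x - h i y| ≤ K * ‖x - y‖)
    {Lr : ℝ} (hLr : 0 ≤ Lr) {Θ Θ' : Fin k → V} (hr : |r Θ - r Θ'| ≤ Lr * ∑ j, ‖Θ j - Θ' j‖)
    {α : ℝ} (hα : 0 < α) (hΘ : ∀ j, q (Θ j - Θ' j) ≤ α * R) :
    |risk h r Θs u Θ - risk h r Θs u Θ'| ≤ K * (k * (α * Real.sqrt M)) + Lr * (k * (α * R)) := by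
  have hn0 : (0 : ℝ) < n := by exact_mod_cast hn
  have h1 : risk h r Θs u Θ - risk h r Θs u Θ' = (1 / (n : ℝ)) * ∑ i,
      (h i (marginals Θ Θs (u i)) - h i (marginals Θ' Θs (u i))) + (r Θ - r Θ') := by
    simp only [risk]
    rw [Finset.sum_sub_distrib]
    ring
  rw [h1]
  refine (abs_add_le _ _).trans (add_le_add ?_ ?_)
  · rw [abs_mul, abs_of_pos (by positivity)]
    calc (1 / (n : ℝ)) * |∑ i, (h i (marginals Θ Θs (u i)) - h i (marginals Θ' Θs (u i)))|
        ≤ (1 / (n : ℝ)) * ∑ i, K * ∑ j, |inner ℝ (Θ j - Θ' j) (u i)| := by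
          gcongr
          refine (Finset.abs_sum_le_sum_abs _ _).trans (Finset.sum_le_sum fun i _ => ?_)
          refine (hL _ _ _).trans ?_
          gcongr
          refine (norm_le_sum_abs _).trans ?_
          rw [Fintype.sum_sum_type]
          simp [marginals, inner_sub_left]
      _ = K * ∑ j, (1 / (n : ℝ)) * ∑ i, |inner ℝ (Θ j - Θ' j) (u i)| := by
          rw [← Finset.mul_sum, Finset.sum_comm, ← Finset.mul_sum]
          ring
      _ ≤ K * ∑ _j : Fin k, α * Real.sqrt M := by
          refine mul_le_mul_of_nonneg_left (Finset.sum_le_sum fun j _ => ?_) hK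
          exact hu.sum_abs_inner_le hn hα (hΘ j)
      _ = _ := by simp
  · refine hr.trans ?_
    gcongr
    calc ∑ j, ‖Θ j - Θ' j‖ ≤ ∑ _j : Fin k, α * R :=
          Finset.sum_le_sum fun j _ => (hq _).trans (hΘ j)
      _ = _ := by simp

/-- On well-conditioned rows, the minimal empirical risk is close to a free energy. -/
theorem RowsBounded.abs_optRisk_sub_freeEnergy_le (hn : 0 < n) (hR : 0 < R)
    (hu : RowsBounded q R M u) (hq : ∀ θ, ‖θ‖ ≤ q θ) (hK : 0 ≤ K)
    (hL : ∀ i x y, |h i x - h i y| ≤ K * ‖x - y‖) (h0 : ∀ i, h i 0 = 0)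
    (hΘs : ∀ j, q (Θs j) ≤ R) {C : Set V} (hC : ∀ x ∈ C, q x ≤ R) (hCne : C.Nonempty)
    {Lr : ℝ} (hLr : 0 ≤ Lr) (hr : ∀ Θ Θ' : Fin k → V, (∀ j, Θ j ∈ C) → (∀ j, Θ' j ∈ C) →
      |r Θ - r Θ'| ≤ Lr * ∑ j, ‖Θ j - Θ' j‖)
    {N₀ : Finset V} {α : ℝ} (hα : 0 < α) (hN₀ : ∀ x ∈ N₀, x ∈ C)
    (hnet : ∀ a ∈ C, ∃ x ∈ N₀, q (a - x) ≤ α * R) {A β : ℝ} (hA : 0 < A) (hβ : 0 < β) :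
    |optRisk C h r Θs u - freeEnergy A β (Fintype.piFinset fun _ : Fin k => N₀) h r Θs u| ≤
      K ^ 2 * ((k + ks) * M) / A + (K * (k * (α * Real.sqrt M)) + Lr * (k * (α * R))) +
        k * Real.log N₀.card / (n * β) := by
  have hn0 : (0 : ℝ) < n := by exact_mod_cast hn
  have hcard : Real.log ((Fintype.piFinset fun _ : Fin k => N₀).card) = k * Real.log N₀.card := by
    rw [Fintype.card_piFinset, Finset.prod_const, Finset.card_univ, Fintype.card_fin]
    push_cast
    rw [Real.log_pow]
  rw [← hcard]
  have hN₀ne : N₀.Nonempty := by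
    obtain ⟨a, ha⟩ := hCne
    obtain ⟨x, hx, _⟩ := hnet a ha
    exact ⟨x, hx⟩
  -- The three errors are the clipping of the losses, the mesh of the net, and the entropy of the
  -- net divided by nβ.
  refine abs_sInf_sub_freeEnergy_le (by positivity)
    (Fintype.piFinset_nonempty.2 fun _ => hN₀ne)
    (fun Θ hΘ j => hN₀ _ (Fintype.mem_piFinset.1 hΘ j))
    (fun Θ hΘ => hu.abs_risk_sub_clip_le hn hL h0 hΘs
      (fun j => hC _ (hN₀ _ (Fintype.mem_piFinset.1 hΘ j))) hA) fun Θ hΘ => ?_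
  choose y hy hyq using fun j => hnet (Θ j) (hΘ j)
  refine ⟨y, Fintype.mem_piFinset.2 hy, ?_⟩
  have h1 := hu.abs_risk_sub_risk_le (Θs := Θs) hn hR hq hK hL hLr
    (hr Θ y hΘ fun j => hN₀ _ (hy j)) hα hyq
  have h2 := (abs_le.1 h1).1
  linarith

end Risk

/-! ### Universality of the minimal empirical risk for independent rows -/

/-- `ψ` is bounded by `B` and has a derivative bounded by `C₁` and Lipschitz with constant `L₂`. -/
structure IsSmoothTest (ψ : ℝ → ℝ) (B C₁ L₂ : ℝ) where
  /-- The derivative. -/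
  deriv : ℝ → ℝ
  hasDerivAt : ∀ x, HasDerivAt ψ (deriv x) x
  abs_le : ∀ x, |ψ x| ≤ B
  abs_deriv_le : ∀ x, |deriv x| ≤ C₁
  abs_deriv_sub_le : ∀ x y, |deriv x - deriv y| ≤ L₂ * |x - y|

lemma IsSmoothTest.abs_sub_le {ψ : ℝ → ℝ} {B C₁ L₂ : ℝ} (h : IsSmoothTest ψ B C₁ L₂) (x y : ℝ) :
    |ψ x - ψ y| ≤ C₁ * |x - y| := by
  have := convex_univ.norm_image_sub_le_of_norm_hasDerivWithin_le (f := ψ) (f' := h.deriv)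
    (C := C₁) (fun z _ => (h.hasDerivAt z).hasDerivWithinAt) (fun z _ => h.abs_deriv_le z)
    (Set.mem_univ y) (Set.mem_univ x)
  simpa using this

lemma IsSmoothTest.abs_taylor_le {ψ : ℝ → ℝ} {B C₁ L₂ : ℝ} (h : IsSmoothTest ψ B C₁ L₂)
    (hL : 0 ≤ L₂) (x t : ℝ) : |ψ (x + t) - ψ x - h.deriv x * t| ≤ L₂ * t ^ 2 := by
  have h1 := (convex_closedBall (0 : ℝ) |t|).norm_image_sub_le_of_norm_hasDerivWithin_le
    (f := fun s => ψ (x + s) - h.deriv x * s) (f' := fun s => h.deriv (x + s) - h.deriv x)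
    (C := L₂ * |t|) (fun s _ => by
      have h2 := (h.hasDerivAt (x + s)).comp_const_add x s
      have h3 := h2.sub ((hasDerivAt_id s).const_mul (h.deriv x))
      rw [mul_one] at h3
      exact h3.hasDerivWithinAt) (fun s hs => by
      refine (h.abs_deriv_sub_le _ _).trans ?_
      rw [add_sub_cancel_left]
      exact mul_le_mul_of_nonneg_left (by simpa using hs) hL) (x := 0) (y := t) (by simp) (by simp)
  simp only [Real.norm_eq_abs, add_zero, mul_zero, sub_zero] at h1
  rw [mul_assoc, abs_mul_abs_self, ← pow_two] at h1
  convert h1 using 2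
  ring

/-- A bounded Lipschitz function is a uniform limit of smooth test functions. -/
lemma exists_isSmoothTest {ψ : ℝ → ℝ} {B : ℝ} {L : ℝ≥0} (hB : ∀ x, |ψ x| ≤ B)
    (hL : LipschitzWith L ψ) {ε : ℝ} (hε : 0 < ε) :
    ∃ (φ : ℝ → ℝ) (L₂ : ℝ), 0 ≤ L₂ ∧ (∀ x, |φ x - ψ x| ≤ ε) ∧
      Nonempty (IsSmoothTest φ B L L₂) := by
  obtain ⟨τ, hτ, hτL⟩ : ∃ τ : ℝ, 0 < τ ∧ L * τ ≤ ε := by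
    refine ⟨ε / (L + 1), by positivity, ?_⟩
    rw [mul_div_assoc', div_le_iff₀ (by positivity)]
    nlinarith
  have hd : ∀ x y, |ψ x - ψ y| ≤ L * |x - y| := fun x y => by
    simpa [Real.dist_eq] using hL.dist_le_mul x y
  have hF : ∀ x, HasDerivAt (fun x => ∫ t in (0 : ℝ)..x, ψ t) (ψ x) x := fun x =>
    hL.continuous.integral_hasStrictDerivAt 0 x |>.hasDerivAt
  have hint : ∀ a b, IntervalIntegrable ψ volume a b := fun a b =>
    hL.continuous.intervalIntegrable a b
  have hsub : ∀ x, (∫ t in (0 : ℝ)..(x + τ), ψ t) - ∫ t in (0 : ℝ)..x, ψ t =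
      ∫ t in x..(x + τ), ψ t := fun x =>
    intervalIntegral.integral_interval_sub_left (hint _ _) (hint _ _)
  -- Mollification by the average over [x, x + τ]: its derivative is a difference quotient of ψ,
  -- bounded by L and Lipschitz with constant 2L/τ.
  refine ⟨fun x => τ⁻¹ * ((∫ t in (0 : ℝ)..(x + τ), ψ t) - ∫ t in (0 : ℝ)..x, ψ t),
    τ⁻¹ * (2 * L), by positivity, fun x => ?_, ⟨⟨fun x => τ⁻¹ * (ψ (x + τ) - ψ x),
      fun x => (((hF (x + τ)).comp_add_const x τ).sub (hF x)).const_mul _, fun x => ?_,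
      fun x => ?_, fun x y => ?_⟩⟩⟩
  · have h1 : τ⁻¹ * ((∫ t in (0 : ℝ)..(x + τ), ψ t) - ∫ t in (0 : ℝ)..x, ψ t) - ψ x =
        τ⁻¹ * ∫ t in x..(x + τ), (ψ t - ψ x) := by
      rw [hsub, intervalIntegral.integral_sub (hint _ _) (by simp),
        intervalIntegral.integral_const, smul_eq_mul]
      field_simp
      ring
    simp only
    rw [h1, abs_mul, abs_of_pos (inv_pos.2 hτ), inv_mul_le_iff₀ hτ]
    have := intervalIntegral.norm_integral_le_of_norm_le_const (a := x) (b := x + τ)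
      (f := fun t => ψ t - ψ x) (C := ε) (fun t ht => by
        rw [Set.uIoc_of_le (by linarith)] at ht
        refine (hd t x).trans (le_trans ?_ hτL)
        gcongr
        rw [abs_of_pos (by linarith [ht.1])]
        linarith [ht.2])
    rw [Real.norm_eq_abs, add_sub_cancel_left, abs_of_pos hτ] at this
    linarith
  · rw [hsub, abs_mul, abs_of_pos (inv_pos.2 hτ), inv_mul_le_iff₀ hτ]
    have := intervalIntegral.norm_integral_le_of_norm_le_const (a := x) (b := x + τ)
      (f := ψ) (C := B) (fun t _ => hB t)
    rw [Real.norm_eq_abs, add_sub_cancel_left, abs_of_pos hτ] at this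
    linarith
  · rw [abs_mul, abs_of_pos (inv_pos.2 hτ), inv_mul_le_iff₀ hτ]
    have := hd (x + τ) x
    rw [add_sub_cancel_left, abs_of_pos hτ] at this
    linarith
  · rw [← mul_sub, abs_mul, abs_of_pos (inv_pos.2 hτ), mul_assoc]
    refine mul_le_mul_of_nonneg_left ?_ (by positivity)
    have h1 := hd (x + τ) (y + τ)
    have h2 := hd x y
    rw [add_sub_add_right_eq_sub] at h1
    have h3 := abs_sub (ψ (x + τ) - ψ (y + τ)) (ψ x - ψ y)
    have h4 : ψ (x + τ) - ψ x - (ψ (y + τ) - ψ y) =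
      (ψ (x + τ) - ψ (y + τ)) - (ψ x - ψ y) := by ring
    rw [h4]
    linarith

/-- Used with exceptional sets whose measurability is not established, hence the passage to the
measurable hull. -/
lemma abs_integral_le_of_abs_le_off {Ω : Type*} [MeasurableSpace Ω] {μ : Measure Ω}
    [IsProbabilityMeasure μ] {f : Ω → ℝ} (S : Set Ω) {a b : ℝ} (ha : 0 ≤ a)
    (h1 : ∀ x, x ∉ S → |f x| ≤ a) (h2 : ∀ x, |f x| ≤ b) :
    |∫ x, f x ∂μ| ≤ a + b * μ.real S := by
  have hm := measurableSet_toMeasurable μ S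
  have hi : Integrable ((toMeasurable μ S).indicator fun _ => b) μ :=
    (integrable_const b).indicator hm
  calc |∫ x, f x ∂μ| ≤ ∫ x, (a + (toMeasurable μ S).indicator (fun _ => b) x) ∂μ := by
        refine norm_integral_le_of_norm_le (f := f) ((integrable_const a).add hi)
          (ae_of_all _ fun x => ?_)
        by_cases hx : x ∈ toMeasurable μ S
        · rw [Set.indicator_of_mem hx]
          have := h2 x
          rw [Real.norm_eq_abs]
          linarith
        · rw [Set.indicator_of_notMem hx, add_zero]
          exact h1 x fun hxS => hx (subset_toMeasurable μ S hxS)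
    _ = a + b * μ.real S := by
        rw [integral_add (integrable_const a) hi, integral_const, integral_indicator_const _ hm,
          measureReal_def μ (toMeasurable μ S), measure_toMeasurable]
        simp [measureReal_def, mul_comm]

/-! ### Replacing one row in the free energy -/

section FreeEnergy

variable {V : Type*} [NormedAddCommGroup V] [InnerProductSpace ℝ V] {k ks n : ℕ}

/-- As a function of a single row, the free energy is the logarithm of a partition function. -/
lemma freeEnergy_update {N : Finset (Fin k → V)} (hN : N.Nonempty) {A β : ℝ} (hn : 0 < n)
    (hβ : 0 < β) (h : Fin n → (Fin k ⊕ Fin ks → ℝ) → ℝ) (r : (Fin k → V) → ℝ) (Θs : Fin ks → V)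
    (u : Fin n → V) (i : Fin n) :
    ∃ (f₀ : ℝ) (w : (Fin k → V) → ℝ), (∀ Θ ∈ N, 0 ≤ w Θ) ∧ ∑ Θ ∈ N, w Θ = 1 ∧
      ∀ x, freeEnergy A β N h r Θs (Function.update u i x) = f₀ + -(1 / (n * β)) *
        Real.log (∑ Θ ∈ N, w Θ * Real.exp (-(β * clip A (h i (marginals Θ Θs x))))) := by
  classical
  have hn0 : (0 : ℝ) < n := by exact_mod_cast hn
  -- The energy of the other rows and of the regularizer, which define the Gibbs weights `w`. The
  -- factor n in the inverse temperature cancels the 1/n of the empirical mean, so a single row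
  -- carries the factor β.
  set E : (Fin k → V) → ℝ := fun Θ =>
    β * ∑ l ∈ Finset.univ.erase i, clip A (h l (marginals Θ Θs (u l))) + (n * β) * r Θ with hE
  set Z := ∑ Θ ∈ N, Real.exp (-E Θ) with hZ
  have hZpos : 0 < Z := Finset.sum_pos (fun _ _ => Real.exp_pos _) hN
  refine ⟨-(1 / (n * β)) * Real.log Z, fun Θ => Real.exp (-E Θ) / Z,
    fun _ _ => by positivity, by rw [← Finset.sum_div, div_self hZpos.ne'], fun x => ?_⟩
  have hVpos : 0 < ∑ Θ ∈ N, Real.exp (-E Θ) / Z *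
      Real.exp (-(β * clip A (h i (marginals Θ Θs x)))) :=
    Finset.sum_pos (fun _ _ => by positivity) hN
  rw [freeEnergy, ← mul_add, ← Real.log_mul hZpos.ne' hVpos.ne', Finset.mul_sum]
  congr 2
  refine Finset.sum_congr rfl fun Θ _ => ?_
  rw [← mul_assoc, mul_div_cancel₀ _ hZpos.ne', ← Real.exp_add]
  congr 1
  rw [risk, ← Finset.add_sum_erase _ _ (Finset.mem_univ i), Function.update_self]
  have : ∀ l ∈ Finset.univ.erase i, clip A (h l (marginals Θ Θs (Function.update u i x l))) =
      clip A (h l (marginals Θ Θs (u l))) := fun l hl => by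
    rw [Function.update_of_ne (Finset.ne_of_mem_erase hl)]
  rw [Finset.sum_congr rfl this, hE]
  field_simp
  ring

end FreeEnergy

/-- Uniform closeness of the characteristic functions of the row laws makes the expectations of
smooth functions of the free energy close, whatever the number of rows. -/
theorem exists_charFun_close_imp_freeEnergy_close (k ks : ℕ) (R c K₀ K A β B C₁ L₂ ε : ℝ)
    (hR : 0 < R) (hc : 0 < c) (hK : 0 ≤ K) (hA : 0 ≤ A) (hβ : 0 < β) (hC₁ : 0 ≤ C₁) (hL₂ : 0 ≤ L₂)
    (hε : 0 < ε) :
    ∃ δ : ℝ, 0 < δ ∧ ∀ (V : Type) [NormedAddCommGroup V] [InnerProductSpace ℝ V]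
      [FiniteDimensional ℝ V] [MeasurableSpace V] [BorelSpace V] (q : Seminorm ℝ V)
      (μ μ' : Measure V) [IsProbabilityMeasure μ] [IsProbabilityMeasure μ'],
      SubgaussianOn μ q R c K₀ → SubgaussianOn μ' q R c K₀ →
      (∀ θ, ‖charFun μ θ - charFun μ' θ‖ ≤ δ * (1 + q θ ^ 2)) →
      ∀ (n : ℕ), 0 < n → ∀ h : Fin n → (Fin k ⊕ Fin ks → ℝ) → ℝ,
        (∀ i x y, |h i x - h i y| ≤ K * ‖x - y‖) →
      ∀ Θs : Fin ks → V, (∀ i, q (Θs i) ≤ R) → ∀ N : Finset (Fin k → V), N.Nonempty →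
        (∀ Θ ∈ N, ∀ i, q (Θ i) ≤ R) → ∀ r : (Fin k → V) → ℝ,
      Measurable (freeEnergy A β N h r Θs) ∧ ∀ ψ, IsSmoothTest ψ B C₁ L₂ →
        |∫ u, ψ (freeEnergy A β N h r Θs u) ∂(Measure.pi fun _ => μ) -
          ∫ u, ψ (freeEnergy A β N h r Θs u) ∂(Measure.pi fun _ => μ')| ≤
            ε + 2 * L₂ * A ^ 2 / n := by
  -- The logarithm enters with the prefactor 1/(nβ) and is multiplied by a derivative of size at
  -- most C₁; this tolerance therefore makes each replacement cost ε/n, and all n of them ε.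
  obtain ⟨δ, hδ, H⟩ := exists_charFun_close_imp_log_close k ks R c K₀ K A β
    (ε * β / (C₁ + 1)) hR hc hK hA hβ (by positivity)
  refine ⟨δ, hδ, ?_⟩
  intro V _ _ _ _ _ q μ μ' _ _ hμ hμ' hcf n hn h hL Θs hΘs N hN hNq r
  have hn0 : (0 : ℝ) < n := by exact_mod_cast hn
  have hL' : ∀ i x y, |clip A (h i x) - clip A (h i y)| ≤ K * ‖x - y‖ := fun i x y =>
    (abs_clip_sub_clip_le _ _ _).trans (hL i x y)
  have hhc : ∀ i, Continuous fun x => clip A (h i x) := fun i =>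
    (LipschitzWith.of_dist_le_mul (K := ⟨K, hK⟩) fun x y => by
      rw [Real.dist_eq, dist_eq_norm]; exact hL' i x y).continuous
  have hmc : ∀ Θ : Fin k → V, Continuous (marginals Θ Θs) := fun Θ => by
    refine continuous_pi fun i => ?_
    rcases i with i | i
    · exact (by fun_prop : Continuous fun u : V => (inner ℝ (Θ i) u : ℝ))
    · exact (by fun_prop : Continuous fun u : V => (inner ℝ (Θs i) u : ℝ))
  have hmeas : Measurable (freeEnergy A β N h r Θs) := by
    refine measurable_const.mul (Real.measurable_log.comp ?_)
    refine Finset.measurable_sum _ fun Θ _ => Real.measurable_exp.comp (Measurable.neg ?_)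
    refine measurable_const.mul ((measurable_const.mul ?_).add_const _)
    exact Finset.measurable_sum _ fun i _ =>
      ((hhc i).comp (hmc Θ)).measurable.comp (measurable_pi_apply i)
  refine ⟨hmeas, fun ψ hψ => ?_⟩
  have hψc : Continuous ψ := continuous_iff_continuousAt.2 fun x => (hψ.hasDerivAt x).continuousAt
  have hstep := abs_integral_pi_sub_le μ μ' (Φ := fun u => ψ (freeEnergy A β N h r Θs u))
    (hψc.measurable.comp hmeas) (B := B) (ε := ε / n + 2 * (L₂ * (A / n) ^ 2))
    (fun u => hψ.abs_le _) ?_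
  · refine hstep.trans (le_of_eq ?_)
    field_simp
  intro i u
  obtain ⟨f₀, w, hw, hw1, hf⟩ := freeEnergy_update (A := A) hN hn hβ h r Θs u i
  have hlog := H V q μ μ' hμ hμ' hcf (fun x => clip A (h i x)) (hL' i)
    (fun x => abs_clip_le hA _) Θs hΘs N hNq w hw hw1
  set l : V → ℝ := fun x => Real.log (∑ Θ ∈ N, w Θ *
    Real.exp (-(β * clip A (h i (marginals Θ Θs x))))) with hl
  have hlm : Measurable l := by
    refine Real.measurable_log.comp (Finset.measurable_sum _ fun Θ _ => measurable_const.mul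
      (Real.measurable_exp.comp (Measurable.neg (measurable_const.mul ?_))))
    exact ((hhc i).comp (hmc Θ)).measurable
  have hlB : ∀ x, |l x| ≤ β * A := fun x => by
    have hI := partition_mem_Icc (f := fun Θ => β * clip A (h i (marginals Θ Θs x))) hw hw1
      (M := β * A) fun Θ _ => by
        rw [abs_mul, abs_of_pos hβ]
        exact mul_le_mul_of_nonneg_left (abs_clip_le hA _) hβ.le
    have hpos := (Real.exp_pos _).trans_le hI.1
    rw [abs_le]
    exact ⟨(Real.le_log_iff_exp_le hpos).2 hI.1, (Real.log_le_iff_le_exp hpos).2 hI.2⟩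
  set s : ℝ := -(1 / (n * β)) with hs
  have hsabs : |s| = 1 / (n * β) := by rw [hs, abs_neg, abs_of_pos (by positivity)]
  -- Expansion around f₀, the free energy without the row, which is common to both laws. The row
  -- moves the free energy by at most βA/(nβ) = A/n, so the second order terms sum to O(1/n).
  have htaylor : ∀ (ρ : Measure V) [IsProbabilityMeasure ρ],
      |∫ x, ψ (f₀ + s * l x) ∂ρ - (ψ f₀ + hψ.deriv f₀ * (s * ∫ x, l x ∂ρ))| ≤
        L₂ * (A / n) ^ 2 := by
    intro ρ _
    have hli : Integrable l ρ := Integrable.of_bound hlm.aestronglyMeasurable _ (ae_of_all _ hlB)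
    have hψi : Integrable (fun x => ψ (f₀ + s * l x)) ρ := Integrable.of_bound
      (hψc.measurable.comp (measurable_const.add
        (measurable_const.mul hlm))).aestronglyMeasurable B (ae_of_all _ fun _ => hψ.abs_le _)
    have h1 : ∫ x, ψ (f₀ + s * l x) ∂ρ - (ψ f₀ + hψ.deriv f₀ * (s * ∫ x, l x ∂ρ)) =
        ∫ x, (ψ (f₀ + s * l x) - ψ f₀ - hψ.deriv f₀ * (s * l x)) ∂ρ := by
      have h5 := integral_sub (hψi.sub (integrable_const (ψ f₀)))
        ((hli.const_mul s).const_mul (hψ.deriv f₀))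
      simp only [Pi.sub_apply] at h5
      rw [h5, integral_sub hψi (integrable_const _), integral_const_mul, integral_const_mul]
      simp
      ring
    rw [h1]
    refine abs_integral_le_of_abs_le fun x => (hψ.abs_taylor_le hL₂ _ _).trans ?_
    rw [← sq_abs (s * l x)]
    gcongr
    rw [abs_mul, hsabs, one_div, inv_mul_le_iff₀ (by positivity)]
    calc |l x| ≤ β * A := hlB x
      _ = n * β * (A / n) := by field_simp
  simp_rw [hf]
  have h1 := htaylor μ
  have h2 := htaylor μ'
  have h3 : |(ψ f₀ + hψ.deriv f₀ * (s * ∫ x, l x ∂μ)) -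
      (ψ f₀ + hψ.deriv f₀ * (s * ∫ x, l x ∂μ'))| ≤ ε / n := by
    have h4 : (ψ f₀ + hψ.deriv f₀ * (s * ∫ x, l x ∂μ)) -
      (ψ f₀ + hψ.deriv f₀ * (s * ∫ x, l x ∂μ')) =
      hψ.deriv f₀ * s * (∫ x, l x ∂μ - ∫ x, l x ∂μ') := by ring
    rw [h4, abs_mul, abs_mul, hsabs]
    calc |hψ.deriv f₀| * (1 / (n * β)) * |∫ x, l x ∂μ - ∫ x, l x ∂μ'|
        ≤ (C₁ + 1) * (1 / (n * β)) * (ε * β / (C₁ + 1)) := by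
          gcongr
          linarith [hψ.abs_deriv_le f₀]
      _ = ε / n := by field_simp
  rw [abs_le] at *
  constructor <;> linarith [h1.1, h1.2, h2.1, h2.2, h3.1, h3.2]

/-- **Universality.** If two row laws are subgaussian and have uniformly close characteristic
functions, then the minimal empirical risks have close distributions. -/
theorem exists_charFun_close_imp_optRisk_close (k ks : ℕ) (R γ c K₀ K Lr ε : ℝ)
    (hR : 0 < R) (hγ : 0 ≤ γ) (hc : 0 < c) (hK₀ : 1 ≤ K₀) (hK : 0 ≤ K) (hLr : 0 ≤ Lr) (hε : 0 < ε)
    (ψ : ℝ → ℝ) {B : ℝ} (hB : ∀ x, |ψ x| ≤ B) {L : ℝ≥0} (hψL : LipschitzWith L ψ) :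
    ∃ δ : ℝ, 0 < δ ∧ ∃ n₀ : ℕ, ∀ (V : Type) [NormedAddCommGroup V] [InnerProductSpace ℝ V]
      [FiniteDimensional ℝ V] [MeasurableSpace V] [BorelSpace V] (q : Seminorm ℝ V)
      (μ μ' : Measure V) [IsProbabilityMeasure μ] [IsProbabilityMeasure μ'],
      (∀ θ, ‖θ‖ ≤ q θ) → SubgaussianOn μ q R c K₀ → SubgaussianOn μ' q R c K₀ →
      (∀ θ, ‖charFun μ θ - charFun μ' θ‖ ≤ δ * (1 + q θ ^ 2)) →
      ∀ n : ℕ, n₀ ≤ n → ∀ p : ℕ, HasNets q p → (p : ℝ) ≤ γ * n →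
      ∀ h : Fin n → (Fin k ⊕ Fin ks → ℝ) → ℝ, (∀ i x y, |h i x - h i y| ≤ K * ‖x - y‖) →
        (∀ i, h i 0 = 0) →
      ∀ Θs : Fin ks → V, (∀ i, q (Θs i) ≤ R) →
      ∀ C : Set V, C.Nonempty → (∀ x ∈ C, q x ≤ R) →
      ∀ r : (Fin k → V) → ℝ, (∀ Θ Θ' : Fin k → V, (∀ j, Θ j ∈ C) → (∀ j, Θ' j ∈ C) →
        |r Θ - r Θ'| ≤ Lr * ∑ j, ‖Θ j - Θ' j‖) →
      Measurable (optRisk C h r Θs) →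
        |∫ u, ψ (optRisk C h r Θs u) ∂(Measure.pi fun _ => μ) -
          ∫ u, ψ (optRisk C h r Θs u) ∂(Measure.pi fun _ => μ')| ≤ ε := by
  have hB0 : 0 ≤ B := (abs_nonneg _).trans (hB 0)
  obtain ⟨φ, L₂, hL₂, hφψ, ⟨hφ⟩⟩ := exists_isSmoothTest hB hψL (show (0 : ℝ) < ε / 8 by positivity)
  set e : ℝ := ε / (8 * (L + 1)) with he
  have he0 : 0 < e := by positivity
  have hLe : L * e ≤ ε / 8 := by
    rw [he, mul_div_assoc', div_le_div_iff₀ (by positivity) (by positivity)]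
    nlinarith [L.coe_nonneg]
  -- Order of the choices: M bounds the rows off an event of probability exp(-n); the clipping level
  -- A, the relative mesh α and the inverse temperature β then each make one error at most e/4; δ
  -- comes after them. The net has at most (1 + 2/α)^p points with p ≤ γn, so its entropy
  -- contributes at most kγ log(1 + 2/α)/β uniformly in n.
  set M : ℝ := 4 * ((γ * Real.log 5 + Real.log K₀ + 1) / c) with hM
  have hM0 : 0 ≤ M := by
    have := Real.log_nonneg hK₀
    have := Real.log_nonneg (show (1 : ℝ) ≤ 5 by norm_num)
    positivity
  obtain ⟨A, hA, hAe⟩ : ∃ A : ℝ, 0 < A ∧ K ^ 2 * ((k + ks) * M) / A ≤ e / 4 := by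
    refine ⟨4 * (K ^ 2 * ((k + ks) * M) + 1) / e, by positivity, ?_⟩
    rw [div_div_eq_mul_div, div_le_iff₀ (by positivity)]
    nlinarith
  obtain ⟨α, hα, hαe⟩ : ∃ α : ℝ, 0 < α ∧
      K * (k * (α * Real.sqrt M)) + Lr * (k * (α * R)) ≤ e / 4 := by
    set D := K * (k * Real.sqrt M) + Lr * (k * R)
    have hD : 0 ≤ D := by positivity
    refine ⟨e / (4 * (D + 1)), by positivity, ?_⟩
    calc _ = D * (e / (4 * (D + 1))) := by ring
      _ ≤ e / 4 := by
        rw [mul_div_assoc', div_le_div_iff₀ (by positivity) (by positivity)]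
        nlinarith
  have hlogα : 0 ≤ Real.log (1 + 2 / α) := Real.log_nonneg (by
    have : 0 < 2 / α := by positivity
    linarith)
  obtain ⟨β, hβ, hβe⟩ : ∃ β : ℝ, 0 < β ∧ k * (γ * Real.log (1 + 2 / α)) / β ≤ e / 4 := by
    refine ⟨4 * (k * (γ * Real.log (1 + 2 / α)) + 1) / e, by positivity, ?_⟩
    rw [div_div_eq_mul_div, div_le_iff₀ (by positivity)]
    nlinarith
  obtain ⟨δ, hδ, H⟩ := exists_charFun_close_imp_freeEnergy_close k ks R c K₀ K A β B L L₂ (ε / 4)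
    hR hc hK hA.le hβ L.coe_nonneg hL₂ (by positivity)
  -- Large n absorbs the second order Lindeberg error and, through exp(-n) ≤ 1/n, the exceptional
  -- events for both row laws.
  obtain ⟨n₀, hn₀⟩ := exists_nat_gt (4 * (4 * B + 2 * L₂ * A ^ 2) / ε)
  refine ⟨δ, hδ, n₀, ?_⟩
  intro V _ _ _ _ _ q μ μ' _ _ hq hμ hμ' hcf n hn p hnet hp h hL h0 Θs hΘs C hCne hC r hr hmeas
  have hn0 : (0 : ℝ) < n := by
    refine lt_of_lt_of_le (lt_of_le_of_lt ?_ hn₀) (Nat.cast_le.2 hn)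
    positivity
  have hn' : 0 < n := by exact_mod_cast hn0
  obtain ⟨N₀, hN₀, hN₀net, hN₀card⟩ := hnet C R (α * R) hR.le (by positivity) hC
  have hN₀ne : N₀.Nonempty := by
    obtain ⟨a, ha⟩ := hCne
    obtain ⟨x, hx, _⟩ := hN₀net a ha
    exact ⟨x, hx⟩
  have hcard : k * Real.log N₀.card / (n * β) ≤ e / 4 := by
    refine le_trans ?_ hβe
    rw [div_le_div_iff₀ (by positivity) hβ]
    have h1 : Real.log N₀.card ≤ p * Real.log (1 + 2 / α) := by
      rw [← Real.log_pow]
      refine Real.log_le_log (by exact_mod_cast hN₀ne.card_pos) (hN₀card.trans (le_of_eq ?_))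
      congr 2
      field_simp
    calc k * Real.log N₀.card * β ≤ k * (γ * n * Real.log (1 + 2 / α)) * β := by
          gcongr
          exact h1.trans (by gcongr)
      _ = _ := by ring
  set N := Fintype.piFinset fun _ : Fin k => N₀ with hN
  have hNne : N.Nonempty := Fintype.piFinset_nonempty.2 fun _ => hN₀ne
  obtain ⟨hfm, hf⟩ := H V q μ μ' hμ hμ' hcf n hn' h hL Θs hΘs N hNne
    (fun Θ hΘ i => hC _ (hN₀ _ (Fintype.mem_piFinset.1 hΘ i))) r
  have hf := hf φ hφ
  have hφc : Continuous φ := continuous_iff_continuousAt.2 fun x => (hφ.hasDerivAt x).continuousAt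
  have hclose : ∀ (ρ : Measure V) [IsProbabilityMeasure ρ], SubgaussianOn ρ q R c K₀ →
      |∫ u, ψ (optRisk C h r Θs u) ∂(Measure.pi fun _ => ρ) -
        ∫ u, φ (freeEnergy A β N h r Θs u) ∂(Measure.pi fun _ => ρ)| ≤
          ε / 4 + 2 * B * (1 / n) := by
    intro ρ _ hρ
    have hbad := measure_not_rowsBounded_le hq hR hc hK₀ hρ hnet hp
    have hi1 : Integrable (fun u => ψ (optRisk C h r Θs u)) (Measure.pi fun _ : Fin n => ρ) :=
      Integrable.of_bound (hψL.continuous.measurable.comp hmeas).aestronglyMeasurable B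
        (ae_of_all _ fun _ => hB _)
    have hi2 : Integrable (fun u => φ (freeEnergy A β N h r Θs u))
        (Measure.pi fun _ : Fin n => ρ) :=
      Integrable.of_bound (hφc.measurable.comp hfm).aestronglyMeasurable B
        (ae_of_all _ fun _ => hφ.abs_le _)
    rw [← integral_sub hi1 hi2]
    refine (abs_integral_le_of_abs_le_off {u | ¬ RowsBounded q R M u} (a := ε / 4) (b := 2 * B)
      (by positivity) (fun u hu => ?_) (fun u => ?_)).trans ?_
    · have hu' : RowsBounded q R M u := not_not.1 hu
      have h1 := hu'.abs_optRisk_sub_freeEnergy_le hn' hR hq hK hL h0 hΘs hC hCne hLr hr hα hN₀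
        hN₀net hA hβ
      have h2 := hφψ (optRisk C h r Θs u)
      have h3 := hφ.abs_sub_le (optRisk C h r Θs u) (freeEnergy A β N h r Θs u)
      have h4 : L * |optRisk C h r Θs u - freeEnergy A β N h r Θs u| ≤ L * e := by
        gcongr
        linarith
      rw [abs_sub_comm] at h2
      have h5 := abs_sub_le (ψ (optRisk C h r Θs u)) (φ (optRisk C h r Θs u))
        (φ (freeEnergy A β N h r Θs u))
      linarith
    · have h1 := abs_sub (ψ (optRisk C h r Θs u)) (φ (freeEnergy A β N h r Θs u))
      linarith [hB (optRisk C h r Θs u), hφ.abs_le (freeEnergy A β N h r Θs u)]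
    · gcongr
      refine hbad.trans ?_
      rw [Real.exp_neg, one_div]
      gcongr
      linarith [Real.add_one_le_exp (n : ℝ)]
  have h1 := hclose μ hμ
  have h2 := hclose μ' hμ'
  have h3 : (4 * B + 2 * L₂ * A ^ 2) / n ≤ ε / 4 := by
    rw [div_le_iff₀ hn0]
    have : 4 * (4 * B + 2 * L₂ * A ^ 2) / ε < n := hn₀.trans_le (Nat.cast_le.2 hn)
    rw [div_lt_iff₀ hε] at this
    linarith
  rw [add_div] at h3
  have h4 : 2 * B * (1 / (n : ℝ)) = 4 * B / n / 2 := by ring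
  rw [h4] at h1 h2
  rw [abs_le] at *
  constructor <;> linarith [h1.1, h1.2, h2.1, h2.2, hf.1, hf.2]

/-! ### Moments of Gaussian measures -/

lemma lintegral_exp_sq_div_four_gaussianReal :
    ∫⁻ x, ENNReal.ofReal (Real.exp (x ^ 2 / 4)) ∂(gaussianReal 0 1) =
      ENNReal.ofReal (Real.sqrt 2) := by
  rw [gaussianReal_of_var_ne_zero _ one_ne_zero,
    lintegral_withDensity_eq_lintegral_mul _ (measurable_gaussianPDF _ _) (by fun_prop)]
  have h1 : ∀ x : ℝ, (gaussianPDF 0 1 * fun x => ENNReal.ofReal (Real.exp (x ^ 2 / 4))) x =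
      ENNReal.ofReal ((Real.sqrt (2 * Real.pi))⁻¹ * Real.exp (-(1 / 4) * x ^ 2)) := by
    intro x
    rw [Pi.mul_apply, gaussianPDF, ← ENNReal.ofReal_mul (gaussianPDFReal_nonneg _ _ _),
      gaussianPDFReal, mul_assoc, ← Real.exp_add]
    congr 3
    · simp
    · simp
      ring
  simp_rw [h1]
  rw [← ofReal_integral_eq_lintegral_ofReal
    ((integrable_exp_neg_mul_sq (by norm_num)).const_mul _) (ae_of_all _ fun x => by positivity),
    integral_const_mul, integral_gaussian]
  congr 1
  rw [show Real.pi / (1 / 4) = (2 * Real.pi) * 2 by ring,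
    Real.sqrt_mul (show 0 ≤ 2 * Real.pi by positivity),
    inv_mul_cancel_left₀ (show Real.sqrt (2 * Real.pi) ≠ 0 by positivity)]

lemma lintegral_exp_mul_sq_gaussianReal_le (v : ℝ≥0) {t : ℝ} (ht : t * v ≤ 1 / 4) :
    ∫⁻ x, ENNReal.ofReal (Real.exp (t * x ^ 2)) ∂(gaussianReal 0 v) ≤ 2 := by
  have hv : gaussianReal 0 v = (gaussianReal 0 1).map (Real.sqrt v * ·) := by
    rw [gaussianReal_map_const_mul, mul_zero, mul_one]
    congr 1
    ext
    simp
  rw [hv, lintegral_map (by fun_prop) (by fun_prop)]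
  calc _ ≤ ∫⁻ x, ENNReal.ofReal (Real.exp (x ^ 2 / 4)) ∂(gaussianReal 0 1) := by
        refine lintegral_mono fun x => ENNReal.ofReal_le_ofReal (Real.exp_le_exp.2 ?_)
        rw [mul_pow, Real.sq_sqrt v.coe_nonneg]
        nlinarith [sq_nonneg x]
    _ ≤ 2 := by
        rw [lintegral_exp_sq_div_four_gaussianReal]
        refine ENNReal.ofReal_le_of_le_toReal ?_
        rw [ENNReal.toReal_ofNat, Real.sqrt_le_left (by norm_num)]
        norm_num

lemma lintegral_exp_mul_sq_le {E : Type*} [NormedAddCommGroup E] [NormedSpace ℝ E]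
    [MeasurableSpace E] [BorelSpace E] {μ : Measure E} [IsGaussian μ] (L : StrongDual ℝ E)
    (h0 : ∫ x, L x ∂μ = 0) {t : ℝ} (ht : t * Var[L; μ] ≤ 1 / 4) :
    ∫⁻ x, ENNReal.ofReal (Real.exp (t * L x ^ 2)) ∂μ ≤ 2 := by
  have h := lintegral_exp_mul_sq_gaussianReal_le (Var[L; μ]).toNNReal (t := t)
    (by rwa [Real.coe_toNNReal _ (variance_nonneg _ _)])
  rw [← h0, ← IsGaussian.map_eq_gaussianReal L, lintegral_map (by fun_prop) (by fun_prop)] at h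
  exact h

section StdGaussian

variable {V : Type*} [NormedAddCommGroup V] [InnerProductSpace ℝ V] [FiniteDimensional ℝ V]
  [MeasurableSpace V] [BorelSpace V]

lemma lintegral_exp_mul_inner_sq_stdGaussian_le (u : V) {t : ℝ}
    (ht : t * ‖u‖ ^ 2 ≤ 1 / 4) :
    ∫⁻ z, ENNReal.ofReal (Real.exp (t * inner ℝ u z ^ 2)) ∂(stdGaussian V) ≤ 2 := by
  have h := lintegral_exp_mul_sq_le (μ := stdGaussian V) (innerSL ℝ u)
    (integral_strongDual_stdGaussian _) (by
      rw [variance_dual_stdGaussian, innerSL_apply_norm]; exact ht)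
  simpa only [innerSL_apply_apply ℝ] using h

lemma polyGrowth_inner (u : V) : PolyGrowth fun z : V => inner ℝ u z :=
  PolyGrowth.clm (innerSL ℝ u)

lemma integral_inner_sq_stdGaussian (u : V) :
    ∫ z, inner ℝ u z ^ 2 ∂(stdGaussian V) = ‖u‖ ^ 2 := by
  have h := integral_inner_smul_stdGaussian (Φ := fun z : V => inner ℝ u z)
    (Φ' := fun _ => innerSL ℝ u) (fun x => (innerSL ℝ u).hasFDerivAt) continuous_const
    (polyGrowth_inner u) (PolyGrowth.const _) u
  simp only [smul_eq_mul, innerSL_apply_apply ℝ, integral_const, probReal_univ, one_mul,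
    real_inner_self_eq_norm_sq] at h
  simpa only [pow_two] using h

lemma integral_inner_pow_four_stdGaussian (u : V) :
    ∫ z, inner ℝ u z ^ 4 ∂(stdGaussian V) = 3 * ‖u‖ ^ 4 := by
  have h := integral_inner_smul_stdGaussian (Φ := fun z : V => (inner ℝ u z : ℝ) ^ 3)
    (Φ' := fun z => (3 * (inner ℝ u z : ℝ) ^ 2) • innerSL ℝ u) (fun x => by
      have := (innerSL ℝ u).hasFDerivAt (x := x) |>.pow 3
      simpa [innerSL_apply_apply ℝ] using this) (by fun_prop) ((polyGrowth_inner u).pow 3)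
    (((PolyGrowth.const 3).mul ((polyGrowth_inner u).pow 2)).smul
      (PolyGrowth.const (innerSL ℝ u))) u
  simp only [smul_eq_mul, FunLike.coe_smul, Pi.smul_apply, innerSL_apply_apply ℝ,
    real_inner_self_eq_norm_sq] at h
  rw [integral_mul_const, integral_const_mul, integral_inner_sq_stdGaussian] at h
  calc _ = ∫ z, inner ℝ u z * inner ℝ u z ^ 3 ∂(stdGaussian V) := by
        congr 1; ext z; ring
    _ = _ := by rw [h]; ring

end StdGaussian

lemma input_norm_sq {d : ℕ} (z : Input d) : ‖z‖ ^ 2 = ∑ a, z a ^ 2 :=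
  EuclideanSpace.real_norm_sq_eq z

lemma polyGrowth_norm {E : Type*} [NormedAddCommGroup E] : PolyGrowth fun z : E => ‖z‖ :=
  ⟨1, 1, fun z => by simp⟩

lemma integral_norm_pow_four_stdGaussian_le (d : ℕ) :
    ∫ z, ‖z‖ ^ 4 ∂(stdGaussian (Input d)) ≤ 3 * (d : ℝ) ^ 2 := by
  set b := EuclideanSpace.basisFun (Fin d) ℝ
  have hb : ∀ (z : Input d) a, z a = inner ℝ (b a) z := fun z a => by
    simp [b, EuclideanSpace.inner_single_left]
  have hi : ∀ a, Integrable (fun z : Input d => inner ℝ (b a) z ^ 4) (stdGaussian (Input d)) :=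
    fun a => ((polyGrowth_inner (b a)).pow 4).integrable
      (by fun_prop : Continuous fun z : Input d => inner ℝ (b a) z ^ 4).aestronglyMeasurable
  calc ∫ z, ‖z‖ ^ 4 ∂(stdGaussian (Input d))
      ≤ ∫ z, d * ∑ a, inner ℝ (b a) z ^ 4 ∂(stdGaussian (Input d)) := by
        refine integral_mono ((polyGrowth_norm.pow 4).integrable
          (by fun_prop : Continuous fun z : Input d => ‖z‖ ^ 4).aestronglyMeasurable)
          ((integrable_finsetSum _ fun a _ => hi a).const_mul _) fun z => ?_
        have h1 := sq_sum_le_card_mul_sum_sq (s := Finset.univ) (f := fun a => z a ^ 2)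
        rw [← input_norm_sq, Finset.card_univ, Fintype.card_fin] at h1
        calc ‖z‖ ^ 4 = (‖z‖ ^ 2) ^ 2 := by ring
          _ ≤ d * ∑ a, (z a ^ 2) ^ 2 := h1
          _ = d * ∑ a, inner ℝ (b a) z ^ 4 := by
            congr 1
            refine Finset.sum_congr rfl fun a _ => ?_
            rw [← hb]
            ring
    _ = _ := by
        rw [integral_const_mul, integral_finsetSum _ fun a _ => hi a]
        simp_rw [integral_inner_pow_four_stdGaussian, b.norm_eq_one]
        simp
        ring

lemma integrable_exp_norm_sq_stdGaussian (d : ℕ) :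
    Integrable (fun z : Input d => Real.exp (‖z‖ ^ 2 / 4)) (stdGaussian (Input d)) ∧
      ∫ z, Real.exp (‖z‖ ^ 2 / 4) ∂(stdGaussian (Input d)) = Real.sqrt 2 ^ d := by
  have h1i : Integrable (fun x : ℝ => Real.exp (x ^ 2 / 4)) (gaussianReal 0 1) := by
    rw [← lintegral_ofReal_ne_top_iff_integrable (by fun_prop)
      (ae_of_all _ fun x => (Real.exp_pos _).le), lintegral_exp_sq_div_four_gaussianReal]
    exact ENNReal.ofReal_ne_top
  have h1e : ∫ x, Real.exp (x ^ 2 / 4) ∂(gaussianReal 0 1) = Real.sqrt 2 := by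
    rw [integral_eq_lintegral_of_nonneg_ae (ae_of_all _ fun x => (Real.exp_pos _).le)
      h1i.aestronglyMeasurable, lintegral_exp_sq_div_four_gaussianReal,
      ENNReal.toReal_ofReal (Real.sqrt_nonneg _)]
  have hprod : ∀ x : Fin d → ℝ, Real.exp (‖(WithLp.toLp 2 x : Input d)‖ ^ 2 / 4) =
      ∏ a, Real.exp (x a ^ 2 / 4) := fun x => by
    rw [← Real.exp_sum, EuclideanSpace.real_norm_sq_eq, Finset.sum_div]
  have hE : ∫ z, Real.exp (‖z‖ ^ 2 / 4) ∂(stdGaussian (Input d)) = Real.sqrt 2 ^ d := by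
    rw [← map_pi_eq_stdGaussian, integral_map (by fun_prop)
      (by fun_prop : Continuous fun z : Input d =>
        Real.exp (‖z‖ ^ 2 / 4)).aestronglyMeasurable]
    simp_rw [hprod]
    rw [integral_fintype_prod_eq_prod (f := fun (_ : Fin d) x => Real.exp (x ^ 2 / 4))]
    simp [h1e]
  have hi : Integrable (fun z => Real.exp (‖z‖ ^ 2 / 4)) (stdGaussian (Input d)) := by
    rw [← map_pi_eq_stdGaussian, integrable_map_measure
      (by fun_prop : Continuous fun z : Input d =>
        Real.exp (‖z‖ ^ 2 / 4)).aestronglyMeasurable (by fun_prop)]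
    refine (Integrable.fintype_prod (f := fun (_ : Fin d) x => Real.exp (x ^ 2 / 4))
      fun _ => h1i).congr (ae_of_all _ fun x => ?_)
    exact (hprod x).symm
  exact ⟨hi, hE⟩

lemma measure_norm_sq_gt_stdGaussian_le (d : ℕ) :
    (stdGaussian (Input d)).real {z | 2 * (d : ℝ) ≤ ‖z‖ ^ 2} ≤ Real.exp (-(d / 8)) := by
  obtain ⟨hi, hE⟩ := integrable_exp_norm_sq_stdGaussian d
  have hM := mul_meas_ge_le_integral_of_nonneg (ae_of_all _ fun z => (Real.exp_pos _).le) hi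
    (Real.exp (d / 2))
  rw [hE] at hM
  have hsub : {z : Input d | 2 * (d : ℝ) ≤ ‖z‖ ^ 2} ⊆
      {z | Real.exp (d / 2) ≤ Real.exp (‖z‖ ^ 2 / 4)} := fun z hz => by
    have hz' : 2 * (d : ℝ) ≤ ‖z‖ ^ 2 := hz
    exact Real.exp_le_exp.2 (by linarith)
  -- Equivalent to log 2 ≤ 3/4. Markov's inequality at level exp(d/2) then leaves the exponent 3d/8
  -- - d/2 = -d/8.
  have hsqrt : Real.sqrt 2 ≤ Real.exp (3 / 8) := by
    rw [Real.sqrt_le_left (Real.exp_pos _).le, ← Real.exp_nat_mul, ← Real.log_le_iff_le_exp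
      (by norm_num)]
    have := Real.log_two_lt_d9
    norm_num
    linarith
  have h2 : Real.exp (d / 2) * (stdGaussian (Input d)).real {z | 2 * (d : ℝ) ≤ ‖z‖ ^ 2} ≤
      Real.exp (3 / 8) ^ d :=
    ((mul_le_mul_of_nonneg_left (measureReal_mono hsub (measure_ne_top _ _))
      (Real.exp_pos _).le).trans hM).trans (pow_le_pow_left₀ (Real.sqrt_nonneg _) hsqrt d)
  rw [← Real.exp_nat_mul, mul_comm, ← le_div_iff₀ (Real.exp_pos _), ← Real.exp_sub] at h2
  refine h2.trans (le_of_eq ?_)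
  congr 1
  ring

/-! ### Families of vectors with bounded Gram matrix -/

section Families

variable {V : Type*} [NormedAddCommGroup V] [InnerProductSpace ℝ V] {m : ℕ}

/-- The linear map `c ↦ ∑ j, c j • T j` on Euclidean space has norm at most `τ`. -/
def BddFamily (τ : ℝ) (T : Fin m → V) : Prop :=
  0 ≤ τ ∧ ∀ c : Fin m → ℝ, ‖∑ j, c j • T j‖ ^ 2 ≤ τ ^ 2 * ∑ j, c j ^ 2

variable {τ : ℝ} {T : Fin m → V}

/-- The adjoint of c ↦ ∑ c_j T_j has the same norm; testing the hypothesis on c_j = ⟨T_j, u⟩ avoids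
introducing it. -/
lemma BddFamily.sum_inner_sq_le (h : BddFamily τ T) (u : V) :
    ∑ j, inner ℝ (T j) u ^ 2 ≤ τ ^ 2 * ‖u‖ ^ 2 := by
  set S := ∑ j, (inner ℝ (T j) u : ℝ) ^ 2 with hS
  have hS0 : 0 ≤ S := Finset.sum_nonneg fun _ _ => sq_nonneg _
  have h1 : S = inner ℝ (∑ j, (inner ℝ (T j) u : ℝ) • T j) u := by
    rw [sum_inner]
    simp [hS, real_inner_smul_left, pow_two]
  have h2 := h.2 fun j => inner ℝ (T j) u
  have h3 : S ^ 2 ≤ (τ ^ 2 * S) * ‖u‖ ^ 2 := by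
    calc S ^ 2 ≤ (‖∑ j, (inner ℝ (T j) u : ℝ) • T j‖ * ‖u‖) ^ 2 := by
          rw [h1]
          refine sq_le_sq' ?_ (real_inner_le_norm _ _)
          exact (abs_le.1 (abs_real_inner_le_norm _ _)).1
      _ ≤ _ := by
          rw [mul_pow]
          gcongr
  rcases hS0.eq_or_lt with h0 | h0
  · rw [← h0]
    positivity
  · nlinarith

lemma BddFamily.norm_le (h : BddFamily τ T) (j : Fin m) : ‖T j‖ ≤ τ := by
  classical
  have h1 := h.2 (Pi.single j 1)
  have h2 : ∑ i, (Pi.single j (1 : ℝ) : Fin m → ℝ) i • T i = T j := by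
    rw [Finset.sum_eq_single j] <;> simp +contextual
  have h3 : ∑ i, (Pi.single j (1 : ℝ) : Fin m → ℝ) i ^ 2 = 1 := by
    rw [Finset.sum_eq_single j] <;> simp +contextual
  rw [h2, h3, mul_one] at h1
  exact le_of_sq_le_sq h1 h.1

lemma BddFamily.norm_sum_smul_le (h : BddFamily τ T) (c : Fin m → ℝ) {B : ℝ} (hB : 0 ≤ B)
    (hc : ∑ j, c j ^ 2 ≤ B ^ 2) : ‖∑ j, c j • T j‖ ≤ τ * B := by
  have h0 := h.1
  refine le_of_sq_le_sq ((h.2 c).trans ?_) (by positivity)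
  rw [mul_pow]
  gcongr

end Families

/-! ### Linear functionals of the neural tangent features -/

/-- `s` is twice continuously differentiable, with derivatives `s₁` and `s₂`, and everything is
bounded by `M`. -/
structure IsActivation (s s₁ s₂ : ℝ → ℝ) (M : ℝ) : Prop where
  hasDerivAt : ∀ t, HasDerivAt s (s₁ t) t
  hasDerivAt₁ : ∀ t, HasDerivAt s₁ (s₂ t) t
  continuous₂ : Continuous s₂
  abs_le : ∀ t, |s t| ≤ M
  abs_le₁ : ∀ t, |s₁ t| ≤ M
  abs_le₂ : ∀ t, |s₂ t| ≤ M

section Functional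

variable {V : Type*} [NormedAddCommGroup V] [InnerProductSpace ℝ V] {m : ℕ}

/-- The function `z ↦ ∑ j, ⟨T j, z⟩ s(⟨w j, z⟩)`. -/
def ntkF (s : ℝ → ℝ) (T w : Fin m → V) (z : V) : ℝ :=
  ∑ j, inner ℝ (T j) z * s (inner ℝ (w j) z)

/-- The gradient of `ntkF`. -/
def ntkGrad (s s₁ : ℝ → ℝ) (T w : Fin m → V) (z : V) : V :=
  ∑ j, s (inner ℝ (w j) z) • T j + ∑ j, (inner ℝ (T j) z * s₁ (inner ℝ (w j) z)) • w j

/-- The Hessian of `ntkF`. -/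
def ntkHess (s₁ s₂ : ℝ → ℝ) (T w : Fin m → V) (z : V) : V →L[ℝ] V :=
  ∑ j, (s₁ (inner ℝ (w j) z) • innerSL ℝ (w j)).smulRight (T j) +
    ∑ j, ((inner ℝ (T j) z * s₂ (inner ℝ (w j) z)) • innerSL ℝ (w j) +
      s₁ (inner ℝ (w j) z) • innerSL ℝ (T j)).smulRight (w j)

variable {s s₁ s₂ : ℝ → ℝ} {M : ℝ} {T w : Fin m → V}

namespace IsActivation

lemma nonneg (hs : IsActivation s s₁ s₂ M) : 0 ≤ M := (abs_nonneg _).trans (hs.abs_le 0)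

lemma continuous (hs : IsActivation s s₁ s₂ M) : Continuous s :=
  continuous_iff_continuousAt.2 fun t => (hs.hasDerivAt t).continuousAt

lemma continuous₁ (hs : IsActivation s s₁ s₂ M) : Continuous s₁ :=
  continuous_iff_continuousAt.2 fun t => (hs.hasDerivAt₁ t).continuousAt

end IsActivation

lemma hasFDerivAt_inner_left (u z : V) :
    HasFDerivAt (fun z : V => (inner ℝ u z : ℝ)) (innerSL ℝ u) z := (innerSL ℝ u).hasFDerivAt

lemma hasFDerivAt_ntkF (hs : IsActivation s s₁ s₂ M) (z : V) :
    HasFDerivAt (ntkF s T w) (innerSL ℝ (ntkGrad s s₁ T w z)) z := by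
  have h1 : ∀ j, HasFDerivAt (fun z : V => inner ℝ (T j) z * s (inner ℝ (w j) z))
      ((inner ℝ (T j) z : ℝ) • (s₁ (inner ℝ (w j) z) • innerSL ℝ (w j)) +
        s (inner ℝ (w j) z) • innerSL ℝ (T j)) z := fun j =>
    (hasFDerivAt_inner_left (T j) z).mul
      ((hs.hasDerivAt _).comp_hasFDerivAt z (hasFDerivAt_inner_left (w j) z))
  refine (HasFDerivAt.fun_sum fun j _ => h1 j).congr_fderiv ?_
  ext v
  simp only [ntkGrad, innerSL_apply_apply ℝ, inner_add_left, sum_inner, real_inner_smul_left,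
    FunLike.coe_add, FunLike.coe_sum, Finset.sum_apply, Pi.add_apply, FunLike.coe_smul,
    Pi.smul_apply, smul_eq_mul]
  rw [← Finset.sum_add_distrib]
  exact Finset.sum_congr rfl fun j _ => by ring

lemma hasFDerivAt_ntkGrad (hs : IsActivation s s₁ s₂ M) (z : V) :
    HasFDerivAt (ntkGrad s s₁ T w) (ntkHess s₁ s₂ T w z) z := by
  refine (HasFDerivAt.fun_sum fun j _ => ?_).add (HasFDerivAt.fun_sum fun j _ => ?_)
  · exact ((hs.hasDerivAt _).comp_hasFDerivAt z (hasFDerivAt_inner_left (w j) z)).smul_const (T j)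
  · have h := (hasFDerivAt_inner_left (T j) z).mul
      ((hs.hasDerivAt₁ _).comp_hasFDerivAt z (hasFDerivAt_inner_left (w j) z))
    rw [smul_smul] at h
    exact h.smul_const (w j)

lemma continuous_ntkGrad (hs : IsActivation s s₁ s₂ M) : Continuous (ntkGrad s s₁ T w) :=
  continuous_iff_continuousAt.2 fun z => (hasFDerivAt_ntkGrad hs z).continuousAt

lemma continuous_ntkF (hs : IsActivation s s₁ s₂ M) : Continuous (ntkF s T w) :=
  continuous_iff_continuousAt.2 fun z => (hasFDerivAt_ntkF hs z).continuousAt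

lemma ntkHess_apply (z v : V) : ntkHess s₁ s₂ T w z v =
    ∑ j, (s₁ (inner ℝ (w j) z) * inner ℝ (w j) v) • T j +
      ∑ j, (inner ℝ (T j) z * s₂ (inner ℝ (w j) z) * inner ℝ (w j) v +
        s₁ (inner ℝ (w j) z) * inner ℝ (T j) v) • w j := by
  simp [ntkHess, innerSL_apply_apply ℝ]

lemma inner_ntkHess_comm (z u v : V) :
    inner ℝ (ntkHess s₁ s₂ T w z u) v = inner ℝ (ntkHess s₁ s₂ T w z v) u := by
  simp only [ntkHess_apply, inner_add_left, sum_inner, real_inner_smul_left]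
  rw [← Finset.sum_add_distrib, ← Finset.sum_add_distrib]
  exact Finset.sum_congr rfl fun j _ => by ring

lemma continuous_ntkHess (hs : IsActivation s s₁ s₂ M) : Continuous (ntkHess s₁ s₂ T w) := by
  have h1 := hs.continuous₁
  have h2 := hs.continuous₂
  have hr : ∀ v : V, Continuous fun f : V →L[ℝ] ℝ => f.smulRight v := fun v =>
    (ContinuousLinearMap.smulRightL ℝ V V).flip v |>.continuous
  refine (continuous_finsetSum _ fun j _ => (hr (T j)).comp ?_).add
    (continuous_finsetSum _ fun j _ => (hr (w j)).comp ?_)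
  · exact (by fun_prop : Continuous fun z : V => s₁ (inner ℝ (w j) z) • innerSL ℝ (w j))
  · exact (by fun_prop : Continuous fun z : V =>
      (inner ℝ (T j) z * s₂ (inner ℝ (w j) z)) • innerSL ℝ (w j) +
        s₁ (inner ℝ (w j) z) • innerSL ℝ (T j))

lemma polyGrowth_bdd_comp {f : ℝ → ℝ} (hf : ∀ t, |f t| ≤ M) (u : V) :
    PolyGrowth fun z : V => f (inner ℝ u z) := PolyGrowth.of_bdd (C := M) fun _ => hf _

lemma polyGrowth_innerSL (u : V) : PolyGrowth fun z : V => (inner ℝ u z : ℝ) :=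
  PolyGrowth.clm (innerSL ℝ u)

lemma polyGrowth_ntkF (hs : IsActivation s s₁ s₂ M) : PolyGrowth (ntkF s T w) :=
  PolyGrowth.sum _ fun j _ => (polyGrowth_innerSL (T j)).mul (polyGrowth_bdd_comp hs.abs_le _)

lemma polyGrowth_ntkGrad (hs : IsActivation s s₁ s₂ M) : PolyGrowth (ntkGrad s s₁ T w) :=
  (PolyGrowth.sum _ fun _ _ => (polyGrowth_bdd_comp hs.abs_le _).smul (PolyGrowth.const _)).add
    (PolyGrowth.sum _ fun j _ => ((polyGrowth_innerSL (T j)).mul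
      (polyGrowth_bdd_comp hs.abs_le₁ _)).smul (PolyGrowth.const _))

/-- Each of the two sums is a bounded family applied to a coefficient vector, of Euclidean norm at
most M√m for the first and Mτ‖z‖ for the second. -/
lemma norm_ntkGrad_le (hs : IsActivation s s₁ s₂ M) {τ ω : ℝ} (hT : BddFamily τ T)
    (hw : BddFamily ω w) (z : V) :
    ‖ntkGrad s s₁ T w z‖ ≤ τ * M * (Real.sqrt m + ω * ‖z‖) := by
  have hM := hs.nonneg
  have hτ := hT.1
  have h1 : ‖∑ j, s (inner ℝ (w j) z) • T j‖ ≤ τ * (M * Real.sqrt m) := by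
    refine hT.norm_sum_smul_le _ (by positivity) ?_
    calc ∑ j, s (inner ℝ (w j) z) ^ 2 ≤ ∑ _j : Fin m, M ^ 2 :=
          Finset.sum_le_sum fun j _ => sq_le_sq' (abs_le.1 (hs.abs_le _)).1
            (abs_le.1 (hs.abs_le _)).2
      _ = (M * Real.sqrt m) ^ 2 := by
          rw [mul_pow, Real.sq_sqrt (Nat.cast_nonneg _)]
          simp [mul_comm]
  have h2 : ‖∑ j, (inner ℝ (T j) z * s₁ (inner ℝ (w j) z)) • w j‖ ≤ ω * (M * (τ * ‖z‖)) := by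
    refine hw.norm_sum_smul_le _ (by positivity) ?_
    calc ∑ j, (inner ℝ (T j) z * s₁ (inner ℝ (w j) z)) ^ 2
        ≤ ∑ j, M ^ 2 * inner ℝ (T j) z ^ 2 := Finset.sum_le_sum fun j _ => by
          rw [mul_pow, mul_comm]
          exact mul_le_mul_of_nonneg_right (sq_le_sq' (abs_le.1 (hs.abs_le₁ _)).1
            (abs_le.1 (hs.abs_le₁ _)).2) (sq_nonneg _)
      _ ≤ M ^ 2 * (τ ^ 2 * ‖z‖ ^ 2) := by
          rw [← Finset.mul_sum]
          gcongr
          exact hT.sum_inner_sq_le z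
      _ = _ := by ring
  refine (norm_add_le _ _).trans ((add_le_add h1 h2).trans (le_of_eq ?_))
  ring

/-- The Hessian has three terms. Two of them involve only the operator norms of `T` and `w`; the one
containing s₂ needs in addition a bound on every ⟨T j, z⟩. -/
lemma norm_ntkHess_apply_le (hs : IsActivation s s₁ s₂ M) {τ ω : ℝ} (hT : BddFamily τ T)
    (hw : BddFamily ω w) (z v : V) {A : ℝ} (hA : ∀ j, |inner ℝ (T j) z| ≤ A) (hA0 : 0 ≤ A) :
    ‖ntkHess s₁ s₂ T w z v‖ ≤ M * ω * (2 * τ + ω * A) * ‖v‖ := by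
  have hM := hs.nonneg
  have hτ := hT.1
  have hω := hw.1
  have hb : ∀ (f : ℝ → ℝ), (∀ t, |f t| ≤ M) → ∀ t, f t ^ 2 ≤ M ^ 2 := fun f hf t =>
    sq_le_sq' (abs_le.1 (hf t)).1 (abs_le.1 (hf t)).2
  have h1 : ‖∑ j, (s₁ (inner ℝ (w j) z) * inner ℝ (w j) v) • T j‖ ≤ τ * (M * (ω * ‖v‖)) := by
    refine hT.norm_sum_smul_le _ (by positivity) ?_
    calc _ ≤ ∑ j, M ^ 2 * inner ℝ (w j) v ^ 2 := Finset.sum_le_sum fun j _ => by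
          rw [mul_pow]
          exact mul_le_mul_of_nonneg_right (hb _ hs.abs_le₁ _) (sq_nonneg _)
      _ ≤ M ^ 2 * (ω ^ 2 * ‖v‖ ^ 2) := by
          rw [← Finset.mul_sum]
          gcongr
          exact hw.sum_inner_sq_le v
      _ = _ := by ring
  have h2 : ‖∑ j, (inner ℝ (T j) z * s₂ (inner ℝ (w j) z) * inner ℝ (w j) v) • w j‖ ≤
      ω * (M * A * (ω * ‖v‖)) := by
    refine hw.norm_sum_smul_le _ (by positivity) ?_
    calc _ ≤ ∑ j, (A * M) ^ 2 * inner ℝ (w j) v ^ 2 := Finset.sum_le_sum fun j _ => by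
          rw [mul_pow _ (inner ℝ (w j) v : ℝ), mul_pow, mul_pow]
          refine mul_le_mul_of_nonneg_right (mul_le_mul ?_ (hb _ hs.abs_le₂ _) (sq_nonneg _)
            (sq_nonneg _)) (sq_nonneg _)
          exact sq_le_sq' (abs_le.1 (hA j)).1 (abs_le.1 (hA j)).2
      _ ≤ (A * M) ^ 2 * (ω ^ 2 * ‖v‖ ^ 2) := by
          rw [← Finset.mul_sum]
          gcongr
          exact hw.sum_inner_sq_le v
      _ = _ := by ring
  have h3 : ‖∑ j, (s₁ (inner ℝ (w j) z) * inner ℝ (T j) v) • w j‖ ≤ ω * (M * (τ * ‖v‖)) := by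
    refine hw.norm_sum_smul_le _ (by positivity) ?_
    calc _ ≤ ∑ j, M ^ 2 * inner ℝ (T j) v ^ 2 := Finset.sum_le_sum fun j _ => by
          rw [mul_pow]
          exact mul_le_mul_of_nonneg_right (hb _ hs.abs_le₁ _) (sq_nonneg _)
      _ ≤ M ^ 2 * (τ ^ 2 * ‖v‖ ^ 2) := by
          rw [← Finset.mul_sum]
          gcongr
          exact hT.sum_inner_sq_le v
      _ = _ := by ring
  rw [ntkHess_apply]
  simp_rw [add_smul]
  rw [Finset.sum_add_distrib]
  refine (norm_add_le _ _).trans ((add_le_add h1 ((norm_add_le _ _).trans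
    (add_le_add h2 h3))).trans (le_of_eq ?_))
  ring

lemma polyGrowth_ntkHess (hs : IsActivation s s₁ s₂ M) : PolyGrowth (ntkHess s₁ s₂ T w) := by
  have hr : ∀ v : V, PolyGrowth fun f : V →L[ℝ] ℝ => f.smulRight v := fun v =>
    PolyGrowth.clm (((ContinuousLinearMap.smulRightL ℝ V V).flip v : (V →L[ℝ] ℝ) →L[ℝ] (V →L[ℝ] V)))
  refine (PolyGrowth.sum _ fun j _ => (hr (T j)).comp ?_).add
    (PolyGrowth.sum _ fun j _ => (hr (w j)).comp ?_)
  · exact (polyGrowth_bdd_comp hs.abs_le₁ (w j)).smul (PolyGrowth.const (innerSL ℝ (w j)))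
  · exact (((polyGrowth_innerSL (T j)).mul (polyGrowth_bdd_comp hs.abs_le₂ (w j))).smul
      (PolyGrowth.const (innerSL ℝ (w j)))).add
      ((polyGrowth_bdd_comp hs.abs_le₁ (w j)).smul (PolyGrowth.const (innerSL ℝ (T j))))

variable [FiniteDimensional ℝ V] [MeasurableSpace V] [BorelSpace V]

/-- The functionals of the features are centered. -/
lemma integral_ntkF (hs : IsActivation s s₁ s₂ M) (hw : ∀ j, ‖w j‖ = 1)
    (h0 : ∫ t, t * s t ∂(gaussianReal 0 1) = 0) : ∫ z, ntkF s T w z ∂(stdGaussian V) = 0 := by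
  have hsc := hs.continuous
  have h1c := hs.continuous₁
  have hi : ∀ j, Integrable (fun z : V => inner ℝ (T j) z * s (inner ℝ (w j) z))
      (stdGaussian V) := fun j =>
    ((polyGrowth_innerSL (T j)).mul (polyGrowth_bdd_comp hs.abs_le _)).integrable
      (by fun_prop : Continuous fun z : V =>
        inner ℝ (T j) z * s (inner ℝ (w j) z)).aestronglyMeasurable
  have hibp : ∀ (u : V) j, ∫ z, inner ℝ u z * s (inner ℝ (w j) z) ∂(stdGaussian V) =
      (∫ z, s₁ (inner ℝ (w j) z) ∂(stdGaussian V)) * inner ℝ (w j) u := by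
    intro u j
    have h := integral_inner_smul_stdGaussian (Φ := fun z : V => s (inner ℝ (w j) z))
      (Φ' := fun z => s₁ (inner ℝ (w j) z) • innerSL ℝ (w j))
      (fun z => (hs.hasDerivAt _).comp_hasFDerivAt z (hasFDerivAt_inner_left (w j) z))
      (by fun_prop) (polyGrowth_bdd_comp hs.abs_le _)
      ((polyGrowth_bdd_comp hs.abs_le₁ (w j)).smul (PolyGrowth.const (innerSL ℝ (w j)))) u
    simp only [smul_eq_mul, FunLike.coe_smul, Pi.smul_apply, innerSL_apply_apply ℝ] at h
    rw [h, integral_mul_const]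
  have hlaw : ∀ j, (stdGaussian V).map (innerSL ℝ (w j)) = gaussianReal 0 1 := fun j => by
    rw [IsGaussian.map_eq_gaussianReal, integral_strongDual_stdGaussian, variance_dual_stdGaussian,
      innerSL_apply_norm, hw]
    simp
  -- Integration by parts in the direction of the unit vector w_j identifies this mean with E[G
  -- s(G)].
  have hz : ∀ j, ∫ z, s₁ (inner ℝ (w j) z) ∂(stdGaussian V) = 0 := fun j => by
    have h1 := hibp (w j) j
    rw [real_inner_self_eq_norm_sq, hw, one_pow, mul_one] at h1
    rw [← h1, ← h0, ← hlaw j, integral_map (by fun_prop)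
      (by fun_prop : Continuous fun t : ℝ => t * s t).aestronglyMeasurable]
    simp [innerSL_apply_apply ℝ]
  simp only [ntkF]
  rw [integral_finsetSum _ fun j _ => hi j]
  exact Finset.sum_eq_zero fun j _ => by rw [hibp, hz, zero_mul]

end Functional

/-! ### Asymptotic normality of the functionals of the features -/

lemma add_pow_four_le (x y : ℝ) : (x + y) ^ 4 ≤ 8 * (x ^ 4 + y ^ 4) := by
  have h1 : (x + y) ^ 2 ≤ 2 * (x ^ 2 + y ^ 2) := add_sq_le
  have h2 : (x ^ 2 + y ^ 2) ^ 2 ≤ 2 * ((x ^ 2) ^ 2 + (y ^ 2) ^ 2) := add_sq_le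
  have h3 : 0 ≤ (x + y) ^ 2 := sq_nonneg _
  nlinarith

/-- Weighted arithmetic–geometric mean inequality. It separates a Hessian at one point from a
gradient at a correlated point, so that only moments of single Gaussian vectors are needed. -/
lemma norm_mul_norm_sq_le {a b t : ℝ} (ht : 0 < t) :
    (a * b) ^ 2 ≤ (t * a ^ 4 + b ^ 4 / t) / 2 := by
  rw [le_div_iff₀ (by norm_num), ← sub_nonneg]
  have : t * a ^ 4 + b ^ 4 / t - (a * b) ^ 2 * 2 = (t * a ^ 2 - b ^ 2) ^ 2 / t := by
    field_simp
    ring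
  rw [this]
  positivity

lemma integral_id_stdGaussian_prod {V : Type*} [NormedAddCommGroup V] [InnerProductSpace ℝ V]
    [FiniteDimensional ℝ V] [MeasurableSpace V] [BorelSpace V] :
    ((stdGaussian V).prod (stdGaussian V))[id] = 0 := by
  have hi : Integrable (fun p : V × V => p) ((stdGaussian V).prod (stdGaussian V)) :=
    (PolyGrowth.clm (ContinuousLinearMap.id ℝ (V × V))).integrable
      continuous_id.aestronglyMeasurable
  have h1 : (∫ p : V × V, p ∂((stdGaussian V).prod (stdGaussian V))).1 = 0 := by
    rw [fst_integral hi, integral_fun_fst (fun x : V => x)]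
    simp
  have h2 : (∫ p : V × V, p ∂((stdGaussian V).prod (stdGaussian V))).2 = 0 := by
    rw [snd_integral hi, integral_fun_snd (fun x : V => x)]
    simp
  exact Prod.ext h1 h2

section CLT

variable {m d : ℕ} {s s₁ s₂ : ℝ → ℝ} {M τ ω : ℝ} {T w : Fin m → Input d}

/-- The maximum of |⟨T j, y⟩| is replaced by the ℓ⁴ norm over j, whose fourth power has an explicit
mean; no maximal inequality is required. -/
lemma norm_ntkHess_apply_ntkGrad_sq_le (hs : IsActivation s s₁ s₂ M) (hT : BddFamily τ T)
    (hw : BddFamily ω w) {t : ℝ} (ht : 0 < t) (y z : Input d) :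
    ‖ntkHess s₁ s₂ T w y (ntkGrad s s₁ T w z)‖ ^ 2 ≤
      (t * (8 * (M * ω) ^ 4 * (16 * τ ^ 4 + ω ^ 4 * ∑ j, inner ℝ (T j) y ^ 4)) +
        8 * (τ * M) ^ 4 * (m ^ 2 + ω ^ 4 * ‖z‖ ^ 4) / t) / 2 := by
  have hM := hs.nonneg
  have hτ := hT.1
  have hω := hw.1
  set A := Real.sqrt (Real.sqrt (∑ j, inner ℝ (T j) y ^ 4)) with hA
  have hS : 0 ≤ ∑ j, (inner ℝ (T j) y : ℝ) ^ 4 := Finset.sum_nonneg fun _ _ => by positivity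
  have hA4 : A ^ 4 = ∑ j, inner ℝ (T j) y ^ 4 := by
    rw [show A ^ 4 = (A ^ 2) ^ 2 by ring, Real.sq_sqrt (Real.sqrt_nonneg _), Real.sq_sqrt hS]
  have hAj : ∀ j, |(inner ℝ (T j) y : ℝ)| ≤ A := fun j => by
    refine Real.le_sqrt_of_sq_le (Real.le_sqrt_of_sq_le ?_)
    rw [sq_abs, ← pow_mul]
    exact Finset.single_le_sum (f := fun j => (inner ℝ (T j) y : ℝ) ^ 4)
      (fun _ _ => by positivity) (Finset.mem_univ j)
  have h1 := norm_ntkHess_apply_le hs hT hw y (ntkGrad s s₁ T w z) hAj (Real.sqrt_nonneg _)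
  have h2 := norm_ntkGrad_le hs hT hw z
  calc _ ≤ (M * ω * (2 * τ + ω * A) * (τ * M * (Real.sqrt m + ω * ‖z‖))) ^ 2 := by
        have h3 : 0 ≤ M * ω * (2 * τ + ω * A) := by positivity
        gcongr
        exact h1.trans (by gcongr)
    _ ≤ (t * (M * ω * (2 * τ + ω * A)) ^ 4 + (τ * M * (Real.sqrt m + ω * ‖z‖)) ^ 4 / t) / 2 :=
        norm_mul_norm_sq_le ht
    _ ≤ _ := by
        have h4 : (M * ω * (2 * τ + ω * A)) ^ 4 ≤
            8 * (M * ω) ^ 4 * (16 * τ ^ 4 + ω ^ 4 * ∑ j, inner ℝ (T j) y ^ 4) := by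
          rw [mul_pow, mul_comm 8, mul_assoc]
          refine mul_le_mul_of_nonneg_left ((add_pow_four_le _ _).trans (le_of_eq ?_))
            (by positivity)
          rw [← hA4]
          ring
        have h5 : (τ * M * (Real.sqrt m + ω * ‖z‖)) ^ 4 ≤
            8 * (τ * M) ^ 4 * (m ^ 2 + ω ^ 4 * ‖z‖ ^ 4) := by
          rw [mul_pow, mul_comm 8, mul_assoc]
          refine mul_le_mul_of_nonneg_left ((add_pow_four_le _ _).trans (le_of_eq ?_))
            (by positivity)
          rw [show Real.sqrt m ^ 4 = (Real.sqrt m ^ 2) ^ 2 by ring,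
            Real.sq_sqrt (Nat.cast_nonneg _)]
          ring
        gcongr

set_option maxHeartbeats 800000 in
/-- The functionals of the neural tangent features are approximately Gaussian. -/
theorem norm_integral_cexp_ntkF_sub_le {ρ Γ : ℝ} (hs : IsActivation s s₁ s₂ M) (hd : 0 < d)
    (hΓ : (m : ℝ) ≤ Γ * d) (hT : BddFamily (ρ / Real.sqrt d) T) (hw : BddFamily ω w)
    (hw1 : ∀ j, ‖w j‖ = 1) (h0 : ∫ t, t * s t ∂(gaussianReal 0 1) = 0) :
    ‖∫ z, Complex.exp (ntkF s T w z * Complex.I) ∂(stdGaussian (Input d)) -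
      Complex.exp (-(∫ z, ntkF s T w z ^ 2 ∂(stdGaussian (Input d)) : ℝ) / 2)‖ ≤
      2 * (Real.sqrt (5 * (8 * (M * ω) ^ 4 * (16 + 3 * Γ * ω ^ 4) +
        8 * M ^ 4 * (Γ ^ 2 + 3 * ω ^ 4))) * ρ ^ 2 / Real.sqrt (Real.sqrt d)) := by
  have hM := hs.nonneg
  have hω := hw.1
  have hd0 : (0 : ℝ) < d := by exact_mod_cast hd
  have hΓ0 : 0 ≤ Γ := by
    by_contra! h
    have := mul_neg_of_neg_of_pos h hd0
    linarith [Nat.cast_nonneg (α := ℝ) m]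
  set γ := stdGaussian (Input d) with hγ
  set F := ntkF s T w
  set G := ntkGrad s s₁ T w
  set D := ntkHess s₁ s₂ T w
  have hGc : Continuous G := continuous_ntkGrad hs
  have hDc : Continuous D := continuous_ntkHess hs
  set C₀ := 5 * (8 * (M * ω) ^ 4 * (16 + 3 * Γ * ω ^ 4) + 8 * M ^ 4 * (Γ ^ 2 + 3 * ω ^ 4)) with hC₀
  have hC₀0 : 0 ≤ C₀ := by positivity
  set κ := Real.sqrt C₀ * ρ ^ 2 / Real.sqrt (Real.sqrt d) with hκ
  refine norm_integral_cexp_sub_le (fun z => hasFDerivAt_ntkF hs z) hGc (polyGrowth_ntkF hs)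
    (polyGrowth_ntkGrad hs) (integral_ntkF hs hw1 h0) (κ := 2 * κ) fun a _ => ?_
  set L : Input d × Input d →L[ℝ] Input d := Real.cos a • ContinuousLinearMap.fst ℝ _ _ -
    Real.sin a • ContinuousLinearMap.snd ℝ _ _ with hL
  have hLa : ∀ p, L p = Real.cos a • p.1 - Real.sin a • p.2 := fun p => by simp [hL]
  -- Symmetry of the Hessian moves it from the increment onto the gradient; `α` and `-sin a • u` are
  -- the two components of the gradient of p ↦ ⟨G (L p), G p.1⟩.
  set α : Input d × Input d → Input d := fun p =>
    D p.1 (G (L p)) + Real.cos a • D (L p) (G p.1) with hα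
  set u : Input d × Input d → Input d := fun p => D (L p) (G p.1) with hu
  set H' : Input d × Input d → Input d × Input d →L[ℝ] ℝ := fun p =>
    (innerSL ℝ (α p)).comp (ContinuousLinearMap.fst ℝ _ _) +
      (-Real.sin a) • (innerSL ℝ (u p)).comp (ContinuousLinearMap.snd ℝ _ _) with hH'
  have hH'a : ∀ p q, H' p q = inner ℝ (α p) q.1 + -Real.sin a * inner ℝ (u p) q.2 := by
    intro p q
    simp [hH', innerSL_apply_apply ℝ]
  have hH : ∀ p, HasFDerivAt (fun p : Input d × Input d => (inner ℝ (G (L p)) (G p.1) : ℝ))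
      (H' p) p := fun p => by
    refine (((hasFDerivAt_ntkGrad hs (L p)).comp p L.hasFDerivAt).inner ℝ
      ((hasFDerivAt_ntkGrad hs p.1).comp p hasFDerivAt_fst)).congr_fderiv ?_
    refine ContinuousLinearMap.ext fun q => ?_
    rw [hH'a]
    simp only [ContinuousLinearMap.comp_apply, ContinuousLinearMap.prod_apply,
      fderivInnerCLM_apply, ContinuousLinearMap.coe_fst']
    change inner ℝ (G (L p)) (D p.1 q.1) + inner ℝ (D (L p) (L q)) (G p.1) = _
    rw [real_inner_comm, inner_ntkHess_comm, inner_ntkHess_comm (L p), hLa q, hα, inner_add_left,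
      inner_sub_right, real_inner_smul_right, real_inner_smul_right, real_inner_smul_left]
    ring
  have huc : Continuous u := (hDc.comp L.continuous).clm_apply (hGc.comp continuous_fst)
  have hαc : Continuous α := by
    have h1 : Continuous fun p : Input d × Input d => D p.1 (G (L p)) :=
      (hDc.comp continuous_fst).clm_apply (hGc.comp L.continuous)
    have h2 : Continuous fun p => Real.cos a • u p := by fun_prop
    exact h1.add h2
  have hH'c : Continuous H' := by
    have h1 : Continuous fun p => (innerSL ℝ (α p)).comp
        (ContinuousLinearMap.fst ℝ (Input d) (Input d)) :=
      ((innerSL ℝ).continuous.comp hαc).clm_comp continuous_const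
    have h2 : Continuous fun p => (innerSL ℝ (u p)).comp
        (ContinuousLinearMap.snd ℝ (Input d) (Input d)) :=
      ((innerSL ℝ).continuous.comp huc).clm_comp continuous_const
    exact h1.add (by fun_prop)
  -- The balancing weight: the mean fourth power is of order 1/d for the Hessian factor and of order
  -- 1 for the gradient factor, so both weighted terms are of order d^(-1/2).
  set t := Real.sqrt d with ht
  have ht0 : 0 < t := Real.sqrt_pos.2 hd0
  have ht2 : t ^ 2 = d := Real.sq_sqrt hd0.le
  set τ := ρ / t with hτ
  set B4 : Input d → ℝ := fun y =>
    t * (8 * (M * ω) ^ 4 * (16 * τ ^ 4 + ω ^ 4 * ∑ j, inner ℝ (T j) y ^ 4)) with hB4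
  set G4 : Input d → ℝ := fun z => 8 * (τ * M) ^ 4 * (m ^ 2 + ω ^ 4 * ‖z‖ ^ 4) / t with hG4
  have hDG : ∀ y z, ‖D y (G z)‖ ^ 2 ≤ (B4 y + G4 z) / 2 := fun y z =>
    norm_ntkHess_apply_ntkGrad_sq_le hs hT hw ht0 y z
  have hB4c : Continuous B4 := by fun_prop
  have hG4c : Continuous G4 := by fun_prop
  have hB4g : PolyGrowth B4 :=
    (PolyGrowth.const t).mul ((PolyGrowth.const _).mul ((PolyGrowth.const _).add
      ((PolyGrowth.const _).mul (PolyGrowth.sum _ fun j _ => (polyGrowth_inner (T j)).pow 4))))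
  have hG4g : PolyGrowth G4 := by
    simp only [hG4, div_eq_mul_inv]
    exact ((PolyGrowth.const _).mul ((PolyGrowth.const _).add
      ((PolyGrowth.const _).mul (polyGrowth_norm.pow 4)))).mul (PolyGrowth.const t⁻¹)
  have hB4i : Integrable B4 γ := hB4g.integrable hB4c.aestronglyMeasurable
  have hG4i : Integrable G4 γ := hG4g.integrable hG4c.aestronglyMeasurable
  have hB40 : ∀ y, 0 ≤ B4 y := fun y => by
    have : 0 ≤ ∑ j, (inner ℝ (T j) y : ℝ) ^ 4 := Finset.sum_nonneg fun _ _ => by positivity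
    simp only [hB4]
    positivity
  have hG40 : ∀ y, 0 ≤ G4 y := fun y => by
    simp only [hG4]
    positivity
  have hB4e : ∫ y, B4 y ∂γ ≤ t * (8 * (M * ω) ^ 4 * (16 * τ ^ 4 + ω ^ 4 * (m * (3 * τ ^ 4)))) := by
    have hi : ∀ j, Integrable (fun y : Input d => (inner ℝ (T j) y : ℝ) ^ 4) γ := fun j =>
      ((polyGrowth_inner (T j)).pow 4).integrable
        (by fun_prop : Continuous fun y : Input d => (inner ℝ (T j) y : ℝ) ^ 4).aestronglyMeasurable
    simp only [hB4]
    rw [integral_const_mul, integral_const_mul, integral_add (integrable_const _)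
      ((integrable_finsetSum _ fun j _ => hi j).const_mul _), integral_const_mul (ω ^ 4),
      integral_finsetSum _ fun j _ => hi j]
    simp only [integral_const, probReal_univ, one_smul]
    gcongr
    calc _ ≤ ∑ _j : Fin m, 3 * τ ^ 4 := Finset.sum_le_sum fun j _ => by
          rw [hγ, integral_inner_pow_four_stdGaussian]
          gcongr
          exact hT.norm_le j
      _ = _ := by simp
  have hG4e : ∫ y, G4 y ∂γ ≤ 8 * (τ * M) ^ 4 * (m ^ 2 + ω ^ 4 * (3 * d ^ 2)) / t := by
    have hi : Integrable (fun y : Input d => ‖y‖ ^ 4) γ := (polyGrowth_norm.pow 4).integrable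
        (by fun_prop : Continuous fun y : Input d => ‖y‖ ^ 4).aestronglyMeasurable
    simp only [hG4]
    rw [integral_div, integral_const_mul, integral_add (integrable_const _) (hi.const_mul _),
      integral_const_mul]
    simp only [integral_const, probReal_univ, one_smul]
    gcongr
    exact integral_norm_pow_four_stdGaussian_le d
  -- The combination cos a • x - sin a • y is again standard Gaussian, so the same moment bounds
  -- hold at both points.
  have hrot : ∀ f : Input d → ℝ, Continuous f → ∫ p, f (L p) ∂(γ.prod γ) = ∫ y, f y ∂γ := by
    intro f hf
    have h1 := integral_comp_rotation (γ := γ) (V := Input d) (by simp [hγ]) (-a)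
      (f := fun p : Input d × Input d => f p.1)
      (hf.comp continuous_fst).aestronglyMeasurable
    rw [integral_fun_fst] at h1
    simp only [probReal_univ, one_smul] at h1
    rw [← h1]
    congr 1
    ext p
    rw [hLa]
    simp [sub_eq_add_neg, ContinuousLinearMap.rotation_apply]
  have hfst : ∀ f : Input d → ℝ, ∫ p, f p.1 ∂(γ.prod γ) = ∫ y, f y ∂γ := fun f => by
    rw [integral_fun_fst]
    simp
  have hLi : ∀ f : Input d → ℝ, Continuous f → PolyGrowth f →
      Integrable (fun p => f (L p)) (γ.prod γ) := fun f hf hfg =>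
    (hfg.comp_clm L).integrable (hf.comp L.continuous).aestronglyMeasurable
  -- Integrating the squared directional derivative gives at most 2‖α‖² + 2‖u‖² ≤ 4‖D p.1 (G (L
  -- p))‖² + 6‖u‖²; with the factor 1/2 in `hDG` the weights become 2 and 3.
  set U : Input d × Input d → ℝ := fun p =>
    2 * (B4 p.1 + G4 (L p)) + 3 * (B4 (L p) + G4 p.1) with hU
  have hUi : Integrable U (γ.prod γ) :=
    (((hB4i.comp_fst γ).add (hLi _ hG4c hG4g)).const_mul 2).add
      (((hLi _ hB4c hB4g).add (hG4i.comp_fst γ)).const_mul 3)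
  have hUe : ∫ p, U p ∂(γ.prod γ) ≤ κ ^ 2 := by
    have h1 : ∫ p, U p ∂(γ.prod γ) = 5 * (∫ y, B4 y ∂γ + ∫ y, G4 y ∂γ) := by
      simp only [hU]
      have e1 := integral_add (((hB4i.comp_fst γ).add (hLi _ hG4c hG4g)).const_mul 2)
        (((hLi _ hB4c hB4g).add (hG4i.comp_fst γ)).const_mul 3)
      have e2 := integral_add (hB4i.comp_fst γ) (hLi _ hG4c hG4g)
      have e3 := integral_add (hLi _ hB4c hB4g) (hG4i.comp_fst γ)
      simp only [Pi.add_apply] at e1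
      rw [e1, integral_const_mul, integral_const_mul, e2, e3, hrot _ hG4c, hrot _ hB4c, hfst, hfst]
      ring
    rw [h1]
    have hκ2 : κ ^ 2 = C₀ * ρ ^ 4 / t := by
      rw [hκ, div_pow, mul_pow, Real.sq_sqrt hC₀0, Real.sq_sqrt (Real.sqrt_nonneg _)]
      ring
    have hd4 : (d : ℝ) = t ^ 2 := ht2.symm
    have h2 : t * (8 * (M * ω) ^ 4 * (16 * τ ^ 4 + ω ^ 4 * (m * (3 * τ ^ 4)))) ≤
        8 * (M * ω) ^ 4 * (16 + 3 * Γ * ω ^ 4) * ρ ^ 4 / t := by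
      have h3 : (1 : ℝ) ≤ d := by exact_mod_cast hd
      calc _ = t * (8 * (M * ω) ^ 4 * (16 * 1 + 3 * ω ^ 4 * m)) * τ ^ 4 := by ring
        _ ≤ t * (8 * (M * ω) ^ 4 * (16 * d + 3 * ω ^ 4 * (Γ * d))) * τ ^ 4 := by gcongr
        _ = _ := by
          rw [hτ, hd4]
          field_simp
    have h3 : 8 * (τ * M) ^ 4 * (m ^ 2 + ω ^ 4 * (3 * d ^ 2)) / t ≤
        8 * M ^ 4 * (Γ ^ 2 + 3 * ω ^ 4) * ρ ^ 4 / t := by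
      calc _ ≤ 8 * (τ * M) ^ 4 * ((Γ * d) ^ 2 + ω ^ 4 * (3 * d ^ 2)) / t := by gcongr
        _ = _ := by
          rw [hτ, hd4]
          field_simp
    calc 5 * (∫ y, B4 y ∂γ + ∫ y, G4 y ∂γ) ≤
        5 * (8 * (M * ω) ^ 4 * (16 + 3 * Γ * ω ^ 4) * ρ ^ 4 / t +
          8 * M ^ 4 * (Γ ^ 2 + 3 * ω ^ 4) * ρ ^ 4 / t) := by
          gcongr
          · exact hB4e.trans h2
          · exact hG4e.trans h3
      _ = κ ^ 2 := by
          rw [hκ2, hC₀]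
          ring
  have hinner : ∀ p, ∫⁻ q, ENNReal.ofReal (H' p q ^ 2) ∂(γ.prod γ) ≤ ENNReal.ofReal (U p) := by
    intro p
    have hi1 : Integrable (fun x : Input d => (inner ℝ (α p) x : ℝ) ^ 2) γ :=
      ((polyGrowth_inner (α p)).pow 2).integrable
        (by fun_prop : Continuous fun x : Input d => (inner ℝ (α p) x : ℝ) ^ 2).aestronglyMeasurable
    have hi2 : Integrable (fun x : Input d => (inner ℝ (u p) x : ℝ) ^ 2) γ :=
      ((polyGrowth_inner (u p)).pow 2).integrable
        (by fun_prop : Continuous fun x : Input d => (inner ℝ (u p) x : ℝ) ^ 2).aestronglyMeasurable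
    have hsin : Real.sin a ^ 2 ≤ 1 := Real.sin_sq_le_one a
    calc _ ≤ ∫⁻ q, ENNReal.ofReal (2 * inner ℝ (α p) q.1 ^ 2 + 2 * inner ℝ (u p) q.2 ^ 2)
          ∂(γ.prod γ) := by
          refine lintegral_mono fun q => ENNReal.ofReal_le_ofReal ?_
          rw [hH'a]
          refine add_sq_le.trans ?_
          rw [mul_add, mul_pow, neg_sq]
          nlinarith [mul_nonneg (sub_nonneg.2 hsin) (sq_nonneg (inner ℝ (u p) q.2 : ℝ))]
      _ = ENNReal.ofReal (2 * ‖α p‖ ^ 2 + 2 * ‖u p‖ ^ 2) := by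
          have h1 := (hi1.comp_fst γ).const_mul 2
          have h2 := (hi2.comp_snd γ).const_mul 2
          have h3 := ofReal_integral_eq_lintegral_ofReal (h1.add h2)
            (ae_of_all _ fun q => by simp only [Pi.zero_apply, Pi.add_apply]; positivity)
          simp only [Pi.add_apply] at h3
          rw [← h3]
          congr 1
          rw [integral_add h1 h2, integral_const_mul, integral_const_mul,
            integral_fun_fst (fun x : Input d => (inner ℝ (α p) x : ℝ) ^ 2),
            integral_fun_snd (fun x : Input d => (inner ℝ (u p) x : ℝ) ^ 2), hγ,
            integral_inner_sq_stdGaussian, integral_inner_sq_stdGaussian]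
          simp
      _ ≤ ENNReal.ofReal (U p) := by
          refine ENNReal.ofReal_le_ofReal ?_
          have h1 : ‖α p‖ ^ 2 ≤ 2 * ‖D p.1 (G (L p))‖ ^ 2 + 2 * ‖u p‖ ^ 2 := by
            have h3 : ‖α p‖ ≤ ‖D p.1 (G (L p))‖ + ‖u p‖ := by
              refine (norm_add_le _ _).trans ?_
              gcongr
              rw [norm_smul, Real.norm_eq_abs]
              exact mul_le_of_le_one_left (norm_nonneg _) (Real.abs_cos_le_one a)
            calc ‖α p‖ ^ 2 ≤ (‖D p.1 (G (L p))‖ + ‖u p‖) ^ 2 := by gcongr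
              _ ≤ _ := add_sq_le.trans (by rw [mul_add])
          have h2 := hDG p.1 (L p)
          have h3 := hDG (L p) p.1
          simp only [hU, hu] at *
          linarith
  have hPD : ∫⁻ p, ENNReal.ofReal ((H' p.1 p.2) ^ 2) ∂((γ.prod γ).prod (γ.prod γ)) ≤
      ENNReal.ofReal (κ ^ 2) := by
    have hcont : Continuous fun p : (Input d × Input d) × (Input d × Input d) =>
        (H' p.1 p.2) ^ 2 := ((hH'c.comp continuous_fst).clm_apply continuous_snd).pow 2
    rw [lintegral_prod _ hcont.measurable.ennreal_ofReal.aemeasurable]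
    refine (lintegral_mono hinner).trans ?_
    rw [← ofReal_integral_eq_lintegral_ofReal hUi (ae_of_all _ fun p => ?_)]
    · exact ENNReal.ofReal_le_ofReal hUe
    · have := hB40 p.1
      have := hB40 (L p)
      have := hG40 p.1
      have := hG40 (L p)
      simp only [hU, Pi.zero_apply]
      positivity
  have hHi : Integrable (fun p : Input d × Input d => (inner ℝ (G (L p)) (G p.1) : ℝ))
      (γ.prod γ) := by
    have hg1 : PolyGrowth fun p : Input d × Input d => G (L p) :=
      (polyGrowth_ntkGrad hs).comp_clm L
    have hg2 : PolyGrowth fun p : Input d × Input d => G p.1 := (polyGrowth_ntkGrad hs).comp_fst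
    have hc : Continuous fun p : Input d × Input d => (inner ℝ (G (L p)) (G p.1) : ℝ) := by
      fun_prop
    exact (hg1.inner hg2).integrable hc.aestronglyMeasurable
  have hfinal := integral_abs_sub_integral_le (γ := γ.prod γ)
    integral_id_stdGaussian_prod hH hH'c hHi
    (D := κ) (by positivity) hPD
  simpa only [hLa] using hfinal

end CLT

/-! ### Subgaussian tails -/

lemma convexOn_exp_mul_sq {a : ℝ} (ha : 0 ≤ a) :
    ConvexOn ℝ Set.univ fun x : ℝ => Real.exp (a * x ^ 2) := by
  have h1 : ConvexOn ℝ Set.univ fun x : ℝ => a * x ^ 2 := by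
    simpa using (even_two.convexOn_pow (𝕜 := ℝ)).smul ha
  exact ⟨convex_univ, fun x hx y hy p q hp hq hpq =>
    (Real.exp_le_exp.2 (h1.2 hx hy hp hq hpq)).trans
      (convexOn_exp.2 (Set.mem_univ _) (Set.mem_univ _) hp hq hpq)⟩

section Concentration

variable {V : Type*} [NormedAddCommGroup V] [InnerProductSpace ℝ V] [FiniteDimensional ℝ V]
  [MeasurableSpace V] [BorelSpace V]

/-- Smooth functions with bounded gradient of a standard Gaussian vector are subgaussian. -/
theorem lintegral_exp_mul_sq_le_of_gradient {H : V → ℝ} {g : V → V} {B Λ v c : ℝ}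
    (hH : ∀ x, HasFDerivAt H (innerSL ℝ (g x)) x) (hg : Continuous g) (hHB : ∀ x, |H x| ≤ B)
    (hgΛ : ∀ x, ‖g x‖ ≤ Λ) (hv : (∫ x, H x ∂(stdGaussian V)) ^ 2 ≤ v) (hc : 0 ≤ c)
    (hcΛ : 20 * c * (Λ ^ 2 + v) ≤ 1) :
    ∫⁻ x, ENNReal.ofReal (Real.exp (c * H x ^ 2)) ∂(stdGaussian V) ≤ 4 := by
  set γ := stdGaussian V with hγ
  set e := ∫ x, H x ∂γ with he
  have hHc : Continuous H := continuous_iff_continuousAt.2 fun x => (hH x).continuousAt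
  have hHi : Integrable H γ := Integrable.of_bound hHc.aestronglyMeasurable B (ae_of_all _ hHB)
  have hB0 : 0 ≤ B := (abs_nonneg _).trans (hHB 0)
  have hv0 : 0 ≤ v := (sq_nonneg _).trans hv
  set Ψ : ℝ → ℝ := fun x => Real.exp (2 * c * x ^ 2) with hΨ
  have hΨconv : ConvexOn ℝ Set.univ Ψ := convexOn_exp_mul_sq (by positivity)
  have hΨc : Continuous Ψ := by fun_prop
  have hΨi : ∀ y, Integrable (fun x => Ψ (H x - H y)) γ := fun y => by
    refine Integrable.of_bound (by fun_prop : Continuous fun x => Ψ (H x - H y)).aestronglyMeasurable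
      (Real.exp (2 * c * (2 * B) ^ 2)) (ae_of_all _ fun x => ?_)
    rw [Real.norm_of_nonneg (Real.exp_pos _).le]
    refine Real.exp_le_exp.2 (mul_le_mul_of_nonneg_left ?_ (by positivity))
    rw [← sq_abs (H x - H y)]
    have := abs_sub (H x) (H y)
    have := hHB x
    have := hHB y
    gcongr
    linarith
  -- H² is at most 2e² + 2(H - e)² with e the mean, and Jensen's inequality replaces e by an
  -- independent copy in the second term.
  have hJ : ∀ y, Real.exp (c * H y ^ 2) ≤ Real.exp (2 * c * v) * ∫ x, Ψ (H x - H y) ∂γ := by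
    intro y
    have h1 := hΨconv.map_integral_le hΨc.continuousOn isClosed_univ
      (ae_of_all γ fun x => Set.mem_univ (H x - H y)) (hHi.sub (integrable_const _)) (hΨi y)
    rw [integral_sub hHi (integrable_const _)] at h1
    simp only [integral_const, probReal_univ, one_smul, ← he] at h1
    refine le_trans ?_ (mul_le_mul_of_nonneg_left h1 (Real.exp_pos _).le)
    rw [hΨ, ← Real.exp_add]
    refine Real.exp_le_exp.2 ?_
    have h2 : H y ^ 2 ≤ 2 * (e ^ 2 + (H y - e) ^ 2) := by
      have := add_sq_le (a := e) (b := H y - e)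
      rwa [add_sub_cancel] at this
    have h3 : (e - H y) ^ 2 = (H y - e) ^ 2 := by ring
    rw [h3]
    nlinarith
  have hMP := lintegral_convex_sub_le (γ := γ) stdGaussian_id_eq_zero hH
    ((innerSL ℝ).continuous.comp hg) hΨconv hΨc fun x => (Real.exp_pos _).le
  have hright : ∫⁻ p, ENNReal.ofReal (Ψ (Real.pi / 2 * innerSL ℝ (g p.1) p.2)) ∂(γ.prod γ) ≤ 2 := by
    have hm : Continuous fun p : V × V => Ψ (Real.pi / 2 * innerSL ℝ (g p.1) p.2) := by
      simp only [innerSL_apply_apply ℝ]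
      fun_prop
    rw [lintegral_prod _ hm.measurable.ennreal_ofReal.aemeasurable]
    calc _ ≤ ∫⁻ _x, 2 ∂γ := by
          refine lintegral_mono fun x => ?_
          -- The exponent is admissible because cΛ² ≤ 1/20 and π² ≤ 10 give 2c(π/2)²Λ² ≤ 1/4; this
          -- is where the constant 20 comes from.
          have h1 := lintegral_exp_mul_inner_sq_stdGaussian_le (g x)
            (t := 2 * c * (Real.pi / 2) ^ 2) (by
              have h2 : ‖g x‖ ^ 2 ≤ Λ ^ 2 := by
                have := hgΛ x
                gcongr
              have h3 : Real.pi ^ 2 ≤ 10 := by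
                nlinarith [Real.pi_lt_d2, Real.pi_gt_three]
              have h4 : c * ‖g x‖ ^ 2 ≤ 1 / 20 := by nlinarith
              nlinarith [mul_nonneg hc (sq_nonneg ‖g x‖)])
          refine le_trans (le_of_eq ?_) h1
          refine lintegral_congr fun y => ?_
          simp only [hΨ, innerSL_apply_apply ℝ, mul_pow]
          ring_nf
      _ = 2 := by simp
  have hleft : ∫⁻ p, ENNReal.ofReal (Ψ (H p.2 - H p.1)) ∂(γ.prod γ) =
      ∫⁻ y, ENNReal.ofReal (∫ x, Ψ (H x - H y) ∂γ) ∂γ := by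
    have hm : Continuous fun p : V × V => Ψ (H p.2 - H p.1) := by fun_prop
    rw [lintegral_prod _ hm.measurable.ennreal_ofReal.aemeasurable]
    exact lintegral_congr fun y => (ofReal_integral_eq_lintegral_ofReal (hΨi y)
      (ae_of_all _ fun x => (Real.exp_pos _).le)).symm
  calc _ ≤ ∫⁻ y, ENNReal.ofReal (Real.exp (2 * c * v)) *
        ENNReal.ofReal (∫ x, Ψ (H x - H y) ∂γ) ∂γ := by
        refine lintegral_mono fun y => ?_
        rw [← ENNReal.ofReal_mul (Real.exp_pos _).le]
        exact ENNReal.ofReal_le_ofReal (hJ y)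
    _ = ENNReal.ofReal (Real.exp (2 * c * v)) *
        ∫⁻ p, ENNReal.ofReal (Ψ (H p.2 - H p.1)) ∂(γ.prod γ) := by
        rw [lintegral_const_mul' _ _ ENNReal.ofReal_ne_top, hleft]
    _ ≤ 2 * 2 := by
        refine mul_le_mul' ?_ (hMP.trans hright)
        refine ENNReal.ofReal_le_of_le_toReal ?_
        rw [ENNReal.toReal_ofNat, ← Real.le_log_iff_exp_le (by norm_num)]
        have := Real.log_two_gt_d9
        nlinarith [sq_nonneg Λ, mul_nonneg hc (sq_nonneg Λ)]
    _ = 4 := by norm_num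

end Concentration

/-- `χ` is a smooth function with values in `[0, 1]`, equal to `1` on `[0, 2]`, and vanishing on
`[3, ∞)`. -/
structure IsCutoff (χ χ' : ℝ → ℝ) (L : ℝ) : Prop where
  hasDerivAt : ∀ t, HasDerivAt χ (χ' t) t
  continuous_deriv : Continuous χ'
  abs_deriv_le : ∀ t, |χ' t| ≤ L
  mem_Icc : ∀ t, χ t ∈ Set.Icc (0 : ℝ) 1
  eq_one : ∀ t, 0 ≤ t → t ≤ 2 → χ t = 1
  eq_zero : ∀ t, 3 < t → χ t = 0
  deriv_eq_zero : ∀ t, 3 < t → χ' t = 0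

lemma exists_isCutoff : ∃ (χ χ' : ℝ → ℝ) (L : ℝ), IsCutoff χ χ' L := by
  set f : ContDiffBump (0 : ℝ) := ⟨2, 3, by norm_num, by norm_num⟩ with hf
  have hcd : ContDiff ℝ 1 f := f.contDiff
  have hdc : Continuous (deriv f) := hcd.continuous_deriv le_rfl
  obtain ⟨L, hL⟩ := hdc.bounded_above_of_compact_support f.hasCompactSupport.deriv
  have hz : ∀ t, 3 < t → f t = 0 := fun t ht => f.zero_of_le_dist (by
    rw [Real.dist_eq, sub_zero, abs_of_pos (by linarith)]
    exact ht.le)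
  refine ⟨f, deriv f, L, fun t => (hcd.differentiable (by norm_num) t).hasDerivAt, hdc, hL,
    fun t => ⟨f.nonneg, f.le_one⟩, fun t h0 h2 => ?_, hz, fun t ht => ?_⟩
  · refine f.one_of_mem_closedBall ?_
    rw [mem_closedBall_zero_iff, Real.norm_of_nonneg h0]
    exact h2
  · have : f =ᶠ[𝓝 t] fun _ => (0 : ℝ) := by
      filter_upwards [lt_mem_nhds ht] with x hx using hz x hx
    rw [this.deriv_eq, deriv_const]

/-! ### Variance and subgaussian tails of the truncated functionals -/

section Truncation

variable {m d : ℕ} {s s₁ s₂ χ χ' : ℝ → ℝ} {M ρ ω Γ L : ℝ} {T w : Fin m → Input d}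

lemma abs_ntkF_le {V : Type*} [NormedAddCommGroup V] [InnerProductSpace ℝ V] {T w : Fin m → V}
    {τ : ℝ} (hs : IsActivation s s₁ s₂ M) (hT : BddFamily τ T) (z : V) :
    |ntkF s T w z| ≤ τ * M * Real.sqrt m * ‖z‖ := by
  have hM := hs.nonneg
  have h1 : ‖∑ j, s (inner ℝ (w j) z) • T j‖ ≤ τ * (M * Real.sqrt m) := by
    refine hT.norm_sum_smul_le _ (by positivity) ?_
    calc ∑ j, s (inner ℝ (w j) z) ^ 2 ≤ ∑ _j : Fin m, M ^ 2 :=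
          Finset.sum_le_sum fun j _ => sq_le_sq' (abs_le.1 (hs.abs_le _)).1
            (abs_le.1 (hs.abs_le _)).2
      _ = (M * Real.sqrt m) ^ 2 := by
          rw [mul_pow, Real.sq_sqrt (Nat.cast_nonneg _)]
          simp [mul_comm]
  have h2 : ntkF s T w z = inner ℝ (∑ j, s (inner ℝ (w j) z) • T j) z := by
    simp only [ntkF, sum_inner, real_inner_smul_left]
    exact Finset.sum_congr rfl fun j _ => mul_comm _ _
  rw [h2]
  refine (abs_real_inner_le_norm _ _).trans ?_
  rw [mul_assoc τ M]
  gcongr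

lemma integral_norm_sq_stdGaussian_le (hd : 0 < d) :
    ∫ z, ‖z‖ ^ 2 ∂(stdGaussian (Input d)) ≤ 2 * d := by
  have hd0 : (0 : ℝ) < d := by exact_mod_cast hd
  have hi4 : Integrable (fun z : Input d => ‖z‖ ^ 4) (stdGaussian (Input d)) :=
    (polyGrowth_norm.pow 4).integrable
      (by fun_prop : Continuous fun z : Input d => ‖z‖ ^ 4).aestronglyMeasurable
  have hi2 : Integrable (fun z : Input d => ‖z‖ ^ 2) (stdGaussian (Input d)) :=
    (polyGrowth_norm.pow 2).integrable
      (by fun_prop : Continuous fun z : Input d => ‖z‖ ^ 2).aestronglyMeasurable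
  have h1 : ∫ z, 2 * d * ‖z‖ ^ 2 ∂(stdGaussian (Input d)) ≤
      ∫ z, (‖z‖ ^ 4 + (d : ℝ) ^ 2) ∂(stdGaussian (Input d)) :=
    integral_mono (hi2.const_mul _) (hi4.add (integrable_const _)) fun z => by
      nlinarith [sq_nonneg (‖z‖ ^ 2 - (d : ℝ))]
  rw [integral_const_mul, integral_add hi4 (integrable_const _)] at h1
  have h2 := integral_norm_pow_four_stdGaussian_le d
  simp only [integral_const, probReal_univ, one_smul] at h1
  nlinarith

/-- The variance of the functionals of the features. -/
lemma integral_ntkF_sq_le (hs : IsActivation s s₁ s₂ M) (hd : 0 < d) (hΓ : (m : ℝ) ≤ Γ * d)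
    (hT : BddFamily (ρ / Real.sqrt d) T) (hw : BddFamily ω w) (hw1 : ∀ j, ‖w j‖ = 1)
    (h0 : ∫ t, t * s t ∂(gaussianReal 0 1) = 0) :
    ∫ z, ntkF s T w z ^ 2 ∂(stdGaussian (Input d)) ≤ 4 * (ρ * M) ^ 2 * (Γ + 2 * ω ^ 2) := by
  have hd0 : (0 : ℝ) < d := by exact_mod_cast hd
  set γ := stdGaussian (Input d) with hγ
  set F := ntkF s T w
  set G := ntkGrad s s₁ T w
  have hFc : Continuous F := continuous_ntkF hs
  have hGc : Continuous G := continuous_ntkGrad hs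
  have hFg : PolyGrowth F := polyGrowth_ntkF hs
  have hGg : PolyGrowth G := polyGrowth_ntkGrad hs
  have hF0 : ∫ z, F z ∂γ = 0 := integral_ntkF hs hw1 h0
  have hFi : Integrable F γ := hFg.integrable hFc.aestronglyMeasurable
  have hF2i : Integrable (fun z => F z ^ 2) γ :=
    (hFg.pow 2).integrable (hFc.pow 2).aestronglyMeasurable
  -- With the square function, the left side is twice the variance by independence of the copies,
  -- and the right side is (π/2)² E‖G‖².
  have hMP := lintegral_convex_sub_le (γ := γ) stdGaussian_id_eq_zero
    (fun z => hasFDerivAt_ntkF (T := T) (w := w) hs z)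
    ((innerSL ℝ).continuous.comp hGc) (even_two.convexOn_pow (𝕜 := ℝ)) (by fun_prop)
    fun x => sq_nonneg x
  have hi1 : Integrable (fun p : Input d × Input d => (F p.2 - F p.1) ^ 2) (γ.prod γ) := by
    have hg : PolyGrowth fun p : Input d × Input d => F p.2 + -1 * F p.1 :=
      hFg.comp_snd.add ((PolyGrowth.const (-1)).mul hFg.comp_fst)
    refine ((hg.pow 2).mono fun p => le_of_eq ?_).integrable
      (by fun_prop : Continuous _).aestronglyMeasurable
    congr 2
    ring
  have hi2 : Integrable (fun p : Input d × Input d =>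
      (Real.pi / 2 * (innerSL ℝ (G p.1)) p.2) ^ 2) (γ.prod γ) := by
    have hg : PolyGrowth fun p : Input d × Input d => (inner ℝ (G p.1) p.2 : ℝ) :=
      hGg.comp_fst.inner (PolyGrowth.clm (ContinuousLinearMap.snd ℝ (Input d) (Input d)))
    have hc : Continuous fun p : Input d × Input d => (inner ℝ (G p.1) p.2 : ℝ) := by fun_prop
    simp only [innerSL_apply_apply ℝ]
    exact (((PolyGrowth.const (Real.pi / 2)).mul hg).pow 2).integrable
      (by fun_prop : Continuous _).aestronglyMeasurable
  rw [← ofReal_integral_eq_lintegral_ofReal hi1 (ae_of_all _ fun _ => sq_nonneg _),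
    ← ofReal_integral_eq_lintegral_ofReal hi2 (ae_of_all _ fun _ => sq_nonneg _),
    ENNReal.ofReal_le_ofReal_iff (integral_nonneg fun _ => sq_nonneg _),
    integral_prod _ hi1, integral_prod _ hi2] at hMP
  have hL : ∫ x, ∫ y, (F y - F x) ^ 2 ∂γ ∂γ = 2 * ∫ z, F z ^ 2 ∂γ := by
    have h1 : ∀ x, ∫ y, (F y - F x) ^ 2 ∂γ = ∫ z, F z ^ 2 ∂γ + F x ^ 2 := by
      intro x
      have h2 : ∀ y, (F y - F x) ^ 2 = F y ^ 2 - 2 * F x * F y + F x ^ 2 := fun y => by ring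
      simp_rw [h2]
      have e1 := integral_add (hF2i.sub (hFi.const_mul (2 * F x))) (integrable_const (F x ^ 2))
      simp only [Pi.sub_apply] at e1
      rw [e1, integral_sub hF2i (hFi.const_mul (2 * F x)), integral_const_mul, hF0]
      simp
    simp_rw [h1]
    rw [integral_add (integrable_const _) hF2i]
    simp
    ring
  have hR : ∫ x, ∫ y, (Real.pi / 2 * (innerSL ℝ (G x)) y) ^ 2 ∂γ ∂γ =
      (Real.pi / 2) ^ 2 * ∫ x, ‖G x‖ ^ 2 ∂γ := by
    simp_rw [innerSL_apply_apply ℝ, mul_pow, integral_const_mul, hγ, integral_inner_sq_stdGaussian]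
  have hG2 : ∫ x, ‖G x‖ ^ 2 ∂γ ≤ 2 * (ρ * M) ^ 2 * (Γ + 2 * ω ^ 2) := by
    have hi3 : Integrable (fun z : Input d => ‖z‖ ^ 2) γ :=
      (polyGrowth_norm.pow 2).integrable
        (by fun_prop : Continuous fun z : Input d => ‖z‖ ^ 2).aestronglyMeasurable
    calc ∫ x, ‖G x‖ ^ 2 ∂γ
        ≤ ∫ x, (ρ / Real.sqrt d * M) ^ 2 * (2 * (m + ω ^ 2 * ‖x‖ ^ 2)) ∂γ := by
          refine integral_mono ((hGg.norm.pow 2).integrable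
            (by fun_prop : Continuous fun z : Input d => ‖G z‖ ^ 2).aestronglyMeasurable)
            ((((integrable_const _).add (hi3.const_mul _)).const_mul _).const_mul _) fun x => ?_
          have h1 := norm_ntkGrad_le hs hT hw x
          calc ‖G x‖ ^ 2 ≤ (ρ / Real.sqrt d * M * (Real.sqrt m + ω * ‖x‖)) ^ 2 := by gcongr
            _ ≤ _ := by
              rw [mul_pow _ (Real.sqrt m + ω * ‖x‖)]
              refine mul_le_mul_of_nonneg_left (add_sq_le.trans (le_of_eq ?_)) (sq_nonneg _)
              rw [Real.sq_sqrt (Nat.cast_nonneg _), mul_pow]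
      _ = (ρ / Real.sqrt d * M) ^ 2 * (2 * (m + ω ^ 2 * ∫ x, ‖x‖ ^ 2 ∂γ)) := by
          rw [integral_const_mul, integral_const_mul, integral_add (integrable_const _)
            (hi3.const_mul _), integral_const_mul]
          simp
      _ ≤ (ρ / Real.sqrt d * M) ^ 2 * (2 * (Γ * d + ω ^ 2 * (2 * d))) := by
          have := integral_norm_sq_stdGaussian_le hd
          gcongr
      _ = _ := by
          rw [mul_pow, div_pow, Real.sq_sqrt hd0.le]
          field_simp
  rw [hL, hR] at hMP
  have hpi : (Real.pi / 2) ^ 2 ≤ 4 := by nlinarith [Real.pi_le_four, Real.pi_pos]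
  have hG0 : 0 ≤ ∫ x, ‖G x‖ ^ 2 ∂γ := integral_nonneg fun _ => sq_nonneg _
  nlinarith

/-- The functionals of the features truncated to the ball of radius `√(3d)`. -/
def truncF (χ s : ℝ → ℝ) (T w : Fin m → Input d) (z : Input d) : ℝ :=
  χ (‖z‖ ^ 2 / d) * ntkF s T w z

/-- The subgaussian constant of the functionals of the features. -/
def subgaussianConst (M R ω Γ L : ℝ) : ℝ :=
  1 / (20 * ((R * M * (Real.sqrt Γ + 2 * ω + 6 * L * Real.sqrt Γ)) ^ 2 +
    4 * (R * M) ^ 2 * (Γ + 2 * ω ^ 2) + 1))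

/-- The available bound on the gradient of `ntkF` grows like ‖z‖/√d; the cutoff keeps it bounded,
and `lintegral_exp_mul_sq_le_of_gradient` applies. The squared mean is bounded by the second moment,
hence by the variance before truncation. -/
lemma lintegral_exp_truncF_le (hs : IsActivation s s₁ s₂ M) (hχ : IsCutoff χ χ' L) (hd : 0 < d)
    (hΓ : (m : ℝ) ≤ Γ * d) (hT : BddFamily (ρ / Real.sqrt d) T) (hw : BddFamily ω w)
    (hw1 : ∀ j, ‖w j‖ = 1) (h0 : ∫ t, t * s t ∂(gaussianReal 0 1) = 0) :
    ∫⁻ z, ENNReal.ofReal (Real.exp (subgaussianConst M ρ ω Γ L * truncF χ s T w z ^ 2))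
      ∂(stdGaussian (Input d)) ≤ 4 := by
  have hM := hs.nonneg
  have hω := hw.1
  have hd0 : (0 : ℝ) < d := by exact_mod_cast hd
  have hsd : 0 < Real.sqrt d := Real.sqrt_pos.2 hd0
  have hsd2 : Real.sqrt d ^ 2 = d := Real.sq_sqrt hd0.le
  have hρ : 0 ≤ ρ := by
    have := hT.1
    rwa [le_div_iff₀ hsd, zero_mul] at this
  have hΓ0 : 0 ≤ Γ := by
    by_contra! h
    have := mul_neg_of_neg_of_pos h hd0
    linarith [Nat.cast_nonneg (α := ℝ) m]
  have hL : 0 ≤ L := (abs_nonneg _).trans (hχ.abs_deriv_le 0)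
  have hsm : Real.sqrt m ≤ Real.sqrt Γ * Real.sqrt d := by
    rw [← Real.sqrt_mul hΓ0]
    exact Real.sqrt_le_sqrt hΓ
  have hχc : Continuous χ := continuous_iff_continuousAt.2 fun t => (hχ.hasDerivAt t).continuousAt
  have hχ'c := hχ.continuous_deriv
  set F := ntkF s T w with hF
  set G := ntkGrad s s₁ T w with hG
  have hFc : Continuous F := continuous_ntkF hs
  have hGc : Continuous G := continuous_ntkGrad hs
  set Λ := ρ * M * (Real.sqrt Γ + 2 * ω + 6 * L * Real.sqrt Γ) with hΛ
  set v := 4 * (ρ * M) ^ 2 * (Γ + 2 * ω ^ 2) with hv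
  have hv0 : 0 ≤ v := by positivity
  -- Product rule. Where ‖z‖² ≤ 3d one has ‖z‖ ≤ 2√d, so the first term is at most ρM(√Γ + 2ω); the
  -- second is at most ρM√Γ · 2L‖z‖²/d ≤ 6LρM√Γ.
  set g : Input d → Input d := fun z =>
    χ (‖z‖ ^ 2 / d) • G z + (F z * (χ' (‖z‖ ^ 2 / d) * (2 / d))) • z with hg
  have hnorm : ∀ z : Input d, ‖z‖ ^ 2 ≤ 3 * d → ‖z‖ ≤ 2 * Real.sqrt d := fun z hz => by
    refine le_of_sq_le_sq ?_ (by positivity)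
    rw [mul_pow, hsd2]
    linarith
  have hcut : ∀ z : Input d, 3 * (d : ℝ) < ‖z‖ ^ 2 → 3 < ‖z‖ ^ 2 / d := fun z hz => by
    rwa [lt_div_iff₀ hd0]
  refine lintegral_exp_mul_sq_le_of_gradient (g := g) (B := ρ * M * (Real.sqrt Γ * Real.sqrt d) * 2)
    (Λ := Λ) (v := v) (fun z => ?_) (by fun_prop) (fun z => ?_) (fun z => ?_) ?_
    (by rw [subgaussianConst]; positivity) ?_
  · have h1 : HasFDerivAt (fun z : Input d => ‖z‖ ^ 2 / d) ((2 / (d : ℝ)) • innerSL ℝ z) z := by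
      have h := (hasStrictFDerivAt_norm_sq z).hasFDerivAt.const_mul ((d : ℝ)⁻¹)
      refine (h.congr_fderiv ?_).congr_of_eventuallyEq (Eventually.of_forall fun y => ?_)
      · ext v
        simp
        ring
      · ring
    have h2 := ((hχ.hasDerivAt _).comp_hasFDerivAt z h1).mul
      (hasFDerivAt_ntkF (T := T) (w := w) hs z)
    refine h2.congr_fderiv ?_
    ext v
    simp only [hg, map_add, map_smul, FunLike.coe_add, FunLike.coe_smul, Pi.add_apply,
      Pi.smul_apply, smul_eq_mul, Function.comp]
    ring
  · rw [truncF, abs_mul, abs_of_nonneg (hχ.mem_Icc _).1]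
    rcases le_or_gt (‖z‖ ^ 2) (3 * d) with hz | hz
    · refine (mul_le_of_le_one_left (abs_nonneg _) (hχ.mem_Icc _).2).trans ?_
      refine (abs_ntkF_le hs hT z).trans ?_
      calc _ ≤ ρ / Real.sqrt d * M * (Real.sqrt Γ * Real.sqrt d) * (2 * Real.sqrt d) := by
            gcongr
            exact hnorm z hz
        _ = _ := by field_simp
    · rw [hχ.eq_zero _ (hcut z hz), zero_mul]
      positivity
  · rcases le_or_gt (‖z‖ ^ 2) (3 * d) with hz | hz
    · have hz2 := hnorm z hz
      have h1 : ‖χ (‖z‖ ^ 2 / d) • G z‖ ≤ ρ * M * (Real.sqrt Γ + 2 * ω) := by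
        rw [norm_smul, Real.norm_of_nonneg (hχ.mem_Icc _).1]
        refine (mul_le_of_le_one_left (norm_nonneg _) (hχ.mem_Icc _).2).trans ?_
        refine (norm_ntkGrad_le hs hT hw z).trans ?_
        calc _ ≤ ρ / Real.sqrt d * M * (Real.sqrt Γ * Real.sqrt d + ω * (2 * Real.sqrt d)) := by
              gcongr
          _ = _ := by field_simp
      have h2 : ‖(F z * (χ' (‖z‖ ^ 2 / d) * (2 / d))) • z‖ ≤ ρ * M * (6 * L * Real.sqrt Γ) := by
        rw [norm_smul, Real.norm_eq_abs, abs_mul, abs_mul, abs_of_pos (show 0 < 2 / (d : ℝ) by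
          positivity)]
        calc _ ≤ (ρ / Real.sqrt d * M * (Real.sqrt Γ * Real.sqrt d) * ‖z‖) *
              (L * (2 / d)) * ‖z‖ := by
              gcongr
              · exact (abs_ntkF_le hs hT z).trans (by gcongr)
              · exact hχ.abs_deriv_le _
          _ = ρ * M * (2 * L * Real.sqrt Γ) * (‖z‖ ^ 2 / d) := by field_simp
          _ ≤ ρ * M * (2 * L * Real.sqrt Γ) * 3 := by
              gcongr
              rwa [div_le_iff₀ hd0]
          _ = _ := by ring
      refine (norm_add_le _ _).trans ((add_le_add h1 h2).trans (le_of_eq ?_))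
      rw [hΛ]
      ring
    · have : g z = 0 := by
        simp [hg, hχ.eq_zero _ (hcut z hz), hχ.deriv_eq_zero _ (hcut z hz)]
      rw [this, norm_zero]
      positivity
  · have hF2i : Integrable (fun z => F z ^ 2) (stdGaussian (Input d)) :=
      ((polyGrowth_ntkF hs).pow 2).integrable (hFc.pow 2).aestronglyMeasurable
    have hvar := integral_ntkF_sq_le hs hd hΓ hT hw hw1 h0
    have hc : Continuous (truncF χ s T w) :=
      (by fun_prop : Continuous fun z : Input d => χ (‖z‖ ^ 2 / d)).mul hFc
    have hle : ∀ z, truncF χ s T w z ^ 2 ≤ F z ^ 2 := fun z => by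
      rw [truncF, mul_pow]
      refine mul_le_of_le_one_left (sq_nonneg _) ?_
      exact pow_le_one₀ (hχ.mem_Icc _).1 (hχ.mem_Icc _).2
    have hti : Integrable (fun z => truncF χ s T w z ^ 2) (stdGaussian (Input d)) :=
      hF2i.mono' (hc.pow 2).aestronglyMeasurable (ae_of_all _ fun z => by
        rw [Real.norm_of_nonneg (sq_nonneg _)]
        exact hle z)
    have hti1 : Integrable (truncF χ s T w) (stdGaussian (Input d)) :=
      ((memLp_two_iff_integrable_sq hc.aestronglyMeasurable).2 hti).integrable (by norm_num)
    have hJ := (even_two.convexOn_pow (𝕜 := ℝ)).map_integral_le (by fun_prop) isClosed_univ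
      (ae_of_all (stdGaussian (Input d)) fun z => Set.mem_univ (truncF χ s T w z)) hti1 hti
    exact hJ.trans ((integral_mono hti hF2i hle).trans hvar)
  · rw [subgaussianConst, ← hΛ, ← hv]
    have hpos : 0 < Λ ^ 2 + v + 1 := by positivity
    rw [mul_one_div, div_mul_eq_mul_div, div_le_one (by positivity)]
    nlinarith

end Truncation

/-! ### The operator seminorm on the feature space -/

section Feature

variable {m d : ℕ}

/-- The blocks `θ_(1), …, θ_(m)` of a vector of the feature space. -/
def blocks (θ : Feat m d) (j : Fin m) : Input d := WithLp.toLp 2 fun a => θ (j, a)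

lemma inner_feat (θ x : Feat m d) : (inner ℝ θ x : ℝ) = ∑ j, ∑ a, θ (j, a) * x (j, a) := by
  rw [PiLp.inner_apply, Fintype.sum_prod_type]
  simp [mul_comm]

lemma inner_featureMap (σ : ℝ → ℝ) (w : Fin m → Input d) (θ : Feat m d) (z : Input d) :
    inner ℝ θ (featureMap σ w z) = ntkF (deriv σ) (blocks θ) w z := by
  rw [inner_feat, ntkF]
  refine Finset.sum_congr rfl fun j _ => ?_
  rw [PiLp.inner_apply, Finset.sum_mul]
  refine Finset.sum_congr rfl fun a _ => ?_
  simp [featureMap, blocks]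
  ring

/-- `blockMatrix` as a linear equivalence. -/
def blockMatrixEquiv : Feat m d ≃ₗ[ℝ] Matrix (Fin d) (Fin m) ℝ where
  toFun := blockMatrix
  map_add' _ _ := rfl
  map_smul' _ _ := rfl
  invFun A := WithLp.toLp 2 fun q => A q.2 q.1
  left_inv _ := rfl
  right_inv _ := rfl

open scoped Matrix.Norms.L2Operator in
/-- The seminorm `√d ‖T_θ‖_op`. -/
def opSeminorm (m d : ℕ) : Seminorm ℝ (Feat m d) :=
  NNReal.mk (Real.sqrt d) (Real.sqrt_nonneg _) • (normSeminorm ℝ (Matrix (Fin d) (Fin m) ℝ)).comp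
    (blockMatrixEquiv : Feat m d ≃ₗ[ℝ] Matrix (Fin d) (Fin m) ℝ).toLinearMap

open scoped Matrix.Norms.L2Operator in
lemma opSeminorm_apply (θ : Feat m d) : opSeminorm m d θ = Real.sqrt d * ‖blockMatrix θ‖ :=
  rfl

lemma mem_paramSet_iff (hd : 0 < d) {R : ℝ} (θ : Feat m d) :
    θ ∈ paramSet m d R ↔ opSeminorm m d θ ≤ R := by
  have hsd : 0 < Real.sqrt d := Real.sqrt_pos.2 (by exact_mod_cast hd)
  rw [paramSet, Set.mem_ofPred_eq, le_div_iff₀ hsd, opSeminorm_apply, mul_comm]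

open scoped Matrix.Norms.L2Operator in
lemma bddFamily_blocks_norm (θ : Feat m d) : BddFamily ‖blockMatrix θ‖ (blocks θ) := by
  refine ⟨norm_nonneg _, fun c => ?_⟩
  have h1 := Matrix.l2_opNorm_mulVec (blockMatrix θ) (WithLp.toLp 2 c)
  have h2 : ∑ j, c j • blocks θ j = WithLp.toLp 2 (Matrix.mulVec (blockMatrix θ) c) := by
    ext a
    simp [blocks, blockMatrix, Matrix.mulVec, dotProduct, mul_comm]
  rw [h2]
  calc _ ≤ (‖blockMatrix θ‖ * ‖(WithLp.toLp 2 c : EuclideanSpace ℝ (Fin m))‖) ^ 2 := by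
        gcongr
        exact h1
    _ = _ := by rw [mul_pow, EuclideanSpace.real_norm_sq_eq]

lemma BddFamily.mono {V : Type*} [NormedAddCommGroup V] [InnerProductSpace ℝ V] {T : Fin m → V}
    {τ τ' : ℝ} (h : BddFamily τ T) (hτ : τ ≤ τ') : BddFamily τ' T :=
  ⟨h.1.trans hτ, fun c => (h.2 c).trans (by
    have := h.1
    have : 0 ≤ ∑ j, c j ^ 2 := Finset.sum_nonneg fun _ _ => sq_nonneg _
    gcongr)⟩

lemma bddFamily_blocks (hd : 0 < d) (θ : Feat m d) {R : ℝ} (hR : opSeminorm m d θ ≤ R) :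
    BddFamily (R / Real.sqrt d) (blocks θ) := by
  have hsd : 0 < Real.sqrt d := Real.sqrt_pos.2 (by exact_mod_cast hd)
  refine (bddFamily_blocks_norm θ).mono ?_
  rw [le_div_iff₀ hsd, mul_comm, ← opSeminorm_apply]
  exact hR

open scoped Matrix.Norms.L2Operator in
-- The left side is the Frobenius norm of a matrix with d rows, and each row has norm at most the
-- operator norm.
lemma norm_le_opSeminorm (θ : Feat m d) : ‖θ‖ ≤ opSeminorm m d θ := by
  rw [opSeminorm_apply]
  refine le_of_sq_le_sq ?_ (by positivity)
  rw [mul_pow, Real.sq_sqrt (Nat.cast_nonneg _), EuclideanSpace.real_norm_sq_eq,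
    Fintype.sum_prod_type, Finset.sum_comm]
  set b := EuclideanSpace.basisFun (Fin d) ℝ
  calc _ = ∑ a, ∑ j, inner ℝ (blocks θ j) (b a) ^ 2 := by
        simp [b, blocks, EuclideanSpace.inner_single_right]
    _ ≤ ∑ _a : Fin d, _ := Finset.sum_le_sum fun a _ =>
        (bddFamily_blocks_norm θ).sum_inner_sq_le (b a)
    _ = _ := by simp [b.norm_eq_one]

open scoped Matrix.Norms.L2Operator in
-- The volumetric bound holds for any norm, so it is applied to matrices with the operator norm;
-- only the dimension m d matters.
lemma hasNets_opSeminorm (m d : ℕ) (hd : 0 < d) : HasNets (opSeminorm m d) (m * d) := by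
  intro A ρ α hρ hα hA
  have hsd : 0 < Real.sqrt d := Real.sqrt_pos.2 (by exact_mod_cast hd)
  set Φ : Feat m d ≃ₗ[ℝ] Matrix (Fin d) (Fin m) ℝ := blockMatrixEquiv
  have hΦ : ∀ x, opSeminorm m d x = Real.sqrt d * ‖Φ x‖ := opSeminorm_apply
  obtain ⟨N, hNA, hN, hcard⟩ := exists_finset_net (A := Φ '' A) (ρ := ρ / Real.sqrt d)
    (α := α / Real.sqrt d) (by positivity) (by positivity) (by
      rintro _ ⟨x, hx, rfl⟩
      rw [le_div_iff₀ hsd, mul_comm, ← hΦ]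
      exact hA x hx)
  refine ⟨N.map Φ.symm.toEquiv.toEmbedding, fun x hx => ?_, fun a ha => ?_, ?_⟩
  · obtain ⟨y, hy, rfl⟩ := Finset.mem_map.1 hx
    obtain ⟨x, hx, hxy⟩ := hNA y hy
    rw [← hxy]
    simpa using hx
  · obtain ⟨y, hy, hya⟩ := hN (Φ a) ⟨a, ha, rfl⟩
    refine ⟨Φ.symm y, Finset.mem_map.2 ⟨y, hy, rfl⟩, ?_⟩
    rw [hΦ, map_sub, LinearEquiv.apply_symm_apply, mul_comm, ← le_div_iff₀ hsd]
    exact hya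
  · rw [Finset.card_map]
    refine hcard.trans (le_of_eq ?_)
    rw [Module.finrank_matrix, Module.finrank_self, Fintype.card_fin, Fintype.card_fin, mul_one,
      mul_comm d m]
    congr 2
    field_simp

/-! ### The laws of the features -/

/-- The truncated features. -/
def truncFeature (χ σ : ℝ → ℝ) (w : Fin m → Input d) (z : Input d) : Feat m d :=
  χ (‖z‖ ^ 2 / d) • featureMap σ w z

lemma inner_truncFeature (χ σ : ℝ → ℝ) (w : Fin m → Input d) (θ : Feat m d) (z : Input d) :
    inner ℝ θ (truncFeature χ σ w z) = truncF χ (deriv σ) (blocks θ) w z := by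
  rw [truncFeature, real_inner_smul_right, inner_featureMap, truncF]

variable {σ s₁ s₂ χ χ' : ℝ → ℝ} {M ω Γ L : ℝ} {w : Fin m → Input d}

lemma continuous_featureMap (hs : IsActivation (deriv σ) s₁ s₂ M) :
    Continuous (featureMap σ w) := by
  have := hs.continuous
  unfold featureMap
  fun_prop

lemma continuous_truncFeature (hs : IsActivation (deriv σ) s₁ s₂ M) (hχ : IsCutoff χ χ' L) :
    Continuous (truncFeature χ σ w) := by
  have hχc : Continuous χ := continuous_iff_continuousAt.2 fun t => (hχ.hasDerivAt t).continuousAt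
  have := continuous_featureMap (w := w) hs
  unfold truncFeature
  fun_prop

lemma truncFeature_eq (hχ : IsCutoff χ χ' L) (hd : 0 < d) {z : Input d} (hz : ‖z‖ ^ 2 ≤ 2 * d) :
    truncFeature χ σ w z = featureMap σ w z := by
  have hd0 : (0 : ℝ) < d := by exact_mod_cast hd
  rw [truncFeature, hχ.eq_one _ (by positivity) (by rwa [div_le_iff₀ hd0]), one_smul]

lemma polyGrowth_featureMap_apply (hs : IsActivation (deriv σ) s₁ s₂ M) (q : Fin m × Fin d) :
    PolyGrowth fun z : Input d => featureMap σ w z q := by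
  refine PolyGrowth.mul (f := fun z : Input d => z q.2) ?_ (polyGrowth_bdd_comp hs.abs_le _)
  exact PolyGrowth.clm (EuclideanSpace.proj q.2 : Input d →L[ℝ] ℝ)

lemma dotProduct_featureCov (hs : IsActivation (deriv σ) s₁ s₂ M) (θ : Feat m d) :
    dotProduct (θ : Fin m × Fin d → ℝ) (Matrix.mulVec (featureCov σ w) θ) =
      ∫ z, ntkF (deriv σ) (blocks θ) w z ^ 2 ∂(stdGaussian (Input d)) := by
  have hc : ∀ q, Continuous fun z : Input d => featureMap σ w z q := fun q => by
    exact (EuclideanSpace.proj q : Feat m d →L[ℝ] ℝ).continuous.comp (continuous_featureMap hs)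
  have hi : ∀ q q', Integrable (fun z : Input d => featureMap σ w z q * featureMap σ w z q')
      (stdGaussian (Input d)) := fun q q' =>
    ((polyGrowth_featureMap_apply hs q).mul (polyGrowth_featureMap_apply hs q')).integrable
      ((hc q).mul (hc q')).aestronglyMeasurable
  have h1 : ∀ z, ntkF (deriv σ) (blocks θ) w z ^ 2 =
      ∑ q, ∑ q', θ q * (featureMap σ w z q * featureMap σ w z q' * θ q') := fun z => by
    have h2 : ntkF (deriv σ) (blocks θ) w z = ∑ q, θ q * featureMap σ w z q := by
      rw [← inner_featureMap, inner_feat, Fintype.sum_prod_type]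
    rw [h2, pow_two, Finset.sum_mul_sum]
    exact Finset.sum_congr rfl fun q _ => Finset.sum_congr rfl fun q' _ => by ring
  simp_rw [h1]
  rw [integral_finsetSum _ fun q _ => integrable_finsetSum _ fun q' _ =>
    ((hi q q').mul_const _).const_mul _]
  refine Finset.sum_congr rfl fun q _ => ?_
  rw [integral_finsetSum _ fun q' _ => ((hi q q').mul_const _).const_mul _, Matrix.mulVec,
    dotProduct, Finset.mul_sum]
  refine Finset.sum_congr rfl fun q' _ => ?_
  rw [integral_const_mul, integral_mul_const]
  rfl

lemma posSemidef_featureCov (hs : IsActivation (deriv σ) s₁ s₂ M) :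
    (featureCov σ w).PosSemidef := by
  refine Matrix.PosSemidef.of_dotProduct_mulVec_nonneg ?_ fun x => ?_
  · ext q q'
    simp only [Matrix.conjTranspose_apply, featureCov, Matrix.of_apply, star_trivial]
    congr 1
    ext z
    ring
  · have := dotProduct_featureCov (w := w) hs (WithLp.toLp 2 x)
    simp only [star_trivial]
    rw [this]
    exact integral_nonneg fun _ => sq_nonneg _

lemma charFun_gaussianFeature (hs : IsActivation (deriv σ) s₁ s₂ M) (θ : Feat m d) :
    charFun (multivariateGaussian 0 (featureCov σ w)) θ =
      Complex.exp (-(∫ z, ntkF (deriv σ) (blocks θ) w z ^ 2 ∂(stdGaussian (Input d)) : ℝ) / 2) := by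
  rw [charFun_multivariateGaussian (posSemidef_featureCov hs), inner_zero_right,
    dotProduct_featureCov hs]
  congr 1
  push_cast
  ring

lemma variance_gaussianFeature (hs : IsActivation (deriv σ) s₁ s₂ M) (θ : Feat m d) :
    Var[innerSL ℝ θ; multivariateGaussian 0 (featureCov σ w)] =
      ∫ z, ntkF (deriv σ) (blocks θ) w z ^ 2 ∂(stdGaussian (Input d)) := by
  rw [← dotProduct_featureCov hs, ← covarianceBilin_multivariateGaussian (μ := 0)
    (posSemidef_featureCov hs), covarianceBilin_self IsGaussian.memLp_two_id]
  rfl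

lemma subgaussianOn_of_lintegral_le {V : Type*} [NormedAddCommGroup V] [InnerProductSpace ℝ V]
    [MeasurableSpace V] [BorelSpace V] {μ : Measure V} {q : Seminorm ℝ V} {R c K₀ : ℝ}
    (hK₀ : 0 ≤ K₀) (h : ∀ θ, q θ ≤ R →
      ∫⁻ u, ENNReal.ofReal (Real.exp (c * inner ℝ θ u ^ 2)) ∂μ ≤ ENNReal.ofReal K₀) :
    SubgaussianOn μ q R c K₀ := by
  intro θ hθ
  have hc : Continuous fun u : V => Real.exp (c * inner ℝ θ u ^ 2) := by fun_prop
  have hi : Integrable (fun u => Real.exp (c * inner ℝ θ u ^ 2)) μ := by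
    rw [← lintegral_ofReal_ne_top_iff_integrable hc.measurable.aestronglyMeasurable
      (ae_of_all _ fun x => (Real.exp_pos _).le)]
    exact ((h θ hθ).trans_lt ENNReal.ofReal_lt_top).ne
  refine ⟨hi, ?_⟩
  rw [integral_eq_lintegral_of_nonneg_ae (ae_of_all _ fun x => (Real.exp_pos _).le)
    hi.aestronglyMeasurable]
  exact ENNReal.toReal_le_of_le_ofReal hK₀ (h θ hθ)

variable {R : ℝ}

lemma subgaussianOn_truncFeature (hs : IsActivation (deriv σ) s₁ s₂ M) (hχ : IsCutoff χ χ' L)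
    (hd : 0 < d) (hΓ : (m : ℝ) ≤ Γ * d) (hw : BddFamily ω w) (hw1 : ∀ j, ‖w j‖ = 1)
    (h0 : ∫ t, t * deriv σ t ∂(gaussianReal 0 1) = 0) :
    SubgaussianOn ((stdGaussian (Input d)).map (truncFeature χ σ w)) (opSeminorm m d) R
      (subgaussianConst M R ω Γ L) 4 := by
  refine subgaussianOn_of_lintegral_le (by norm_num) fun θ hθ => ?_
  rw [lintegral_map (by fun_prop) (continuous_truncFeature hs hχ).measurable]
  simp_rw [inner_truncFeature]
  exact (lintegral_exp_truncF_le hs hχ hd hΓ (bddFamily_blocks hd θ hθ) hw hw1 h0).trans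
    (by norm_num)

/-- A Gaussian marginal is governed by its variance, which equals that of `ntkF`; the latter is one
of the terms of `subgaussianConst`, so both row laws share the constant. -/
lemma subgaussianOn_gaussianFeature (hs : IsActivation (deriv σ) s₁ s₂ M)
    (hd : 0 < d) (hΓ : (m : ℝ) ≤ Γ * d) (hw : BddFamily ω w) (hw1 : ∀ j, ‖w j‖ = 1)
    (h0 : ∫ t, t * deriv σ t ∂(gaussianReal 0 1) = 0) :
    SubgaussianOn (multivariateGaussian 0 (featureCov σ w)) (opSeminorm m d) R
      (subgaussianConst M R ω Γ L) 4 := by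
  refine subgaussianOn_of_lintegral_le (by norm_num) fun θ hθ => ?_
  have hΓ0 : 0 ≤ Γ := by
    by_contra! h
    have := mul_neg_of_neg_of_pos h (show (0 : ℝ) < d by exact_mod_cast hd)
    linarith [Nat.cast_nonneg (α := ℝ) m]
  have hv0 : 0 ≤ 4 * (R * M) ^ 2 * (Γ + 2 * ω ^ 2) := by positivity
  have hv := integral_ntkF_sq_le hs hd hΓ (bddFamily_blocks hd θ hθ) hw hw1 h0
  have hc0 : 0 ≤ subgaussianConst M R ω Γ L := by
    rw [subgaussianConst]
    positivity
  have h := lintegral_exp_mul_sq_le (μ := multivariateGaussian 0 (featureCov σ w)) (innerSL ℝ θ)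
    (t := subgaussianConst M R ω Γ L) (by
      have h := (innerSL ℝ θ).integral_comp_id_comm
        (μ := multivariateGaussian 0 (featureCov σ w)) IsGaussian.integrable_id
      rw [h]
      simp) (by
      rw [variance_gaussianFeature hs]
      refine (mul_le_mul_of_nonneg_left hv hc0).trans ?_
      rw [subgaussianConst, div_mul_eq_mul_div, one_mul, div_le_iff₀ (by positivity)]
      nlinarith [sq_nonneg (R * M * (Real.sqrt Γ + 2 * ω + 6 * L * Real.sqrt Γ))])
  simp only [innerSL_apply_apply ℝ] at h
  exact h.trans (by norm_num)

/-- The truncated features and the Gaussian features have close characteristic functions. -/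
theorem norm_charFun_truncFeature_sub_le (hs : IsActivation (deriv σ) s₁ s₂ M)
    (hχ : IsCutoff χ χ' L) (hd : 0 < d) (hΓ : (m : ℝ) ≤ Γ * d) (hw : BddFamily ω w)
    (hw1 : ∀ j, ‖w j‖ = 1) (h0 : ∫ t, t * deriv σ t ∂(gaussianReal 0 1) = 0) (θ : Feat m d) :
    ‖charFun ((stdGaussian (Input d)).map (truncFeature χ σ w)) θ -
      charFun (multivariateGaussian 0 (featureCov σ w)) θ‖ ≤
      2 * Real.exp (-(d / 8)) + 2 * (Real.sqrt (5 * (8 * (M * ω) ^ 4 * (16 + 3 * Γ * ω ^ 4) +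
        8 * M ^ 4 * (Γ ^ 2 + 3 * ω ^ 4))) * opSeminorm m d θ ^ 2 / Real.sqrt (Real.sqrt d)) := by
  have h1 := norm_integral_cexp_ntkF_sub_le hs hd hΓ (bddFamily_blocks hd θ le_rfl) hw hw1 h0
  rw [← charFun_gaussianFeature hs] at h1
  refine (norm_sub_le_norm_sub_add_norm_sub _
    (∫ z, Complex.exp (ntkF (deriv σ) (blocks θ) w z * Complex.I) ∂(stdGaussian (Input d))) _).trans
    (add_le_add ?_ h1)
  have hFc : Continuous (ntkF (deriv σ) (blocks θ) w) := continuous_ntkF hs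
  have htc : Continuous fun z => truncF χ (deriv σ) (blocks θ) w z := by
    have := continuous_truncFeature (w := w) hs hχ
    simp_rw [← inner_truncFeature]
    fun_prop
  have hn : ∀ x : ℝ, ‖Complex.exp (x * Complex.I)‖ = 1 := Complex.norm_exp_ofReal_mul_I
  have hi1 : Integrable (fun z => Complex.exp (truncF χ (deriv σ) (blocks θ) w z * Complex.I))
      (stdGaussian (Input d)) := Integrable.of_bound
    (by fun_prop : Continuous _).aestronglyMeasurable 1 (ae_of_all _ fun z => (hn _).le)
  have hi2 : Integrable (fun z => Complex.exp (ntkF (deriv σ) (blocks θ) w z * Complex.I))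
      (stdGaussian (Input d)) := Integrable.of_bound
    (by fun_prop : Continuous _).aestronglyMeasurable 1 (ae_of_all _ fun z => (hn _).le)
  have h2 : charFun ((stdGaussian (Input d)).map (truncFeature χ σ w)) θ =
      ∫ z, Complex.exp (truncF χ (deriv σ) (blocks θ) w z * Complex.I)
        ∂(stdGaussian (Input d)) := by
    rw [charFun_apply, integral_map (continuous_truncFeature hs hχ).measurable.aemeasurable
      (by fun_prop : Continuous _).aestronglyMeasurable]
    simp_rw [real_inner_comm, inner_truncFeature]
  rw [h2, ← integral_sub hi1 hi2]
  -- Off this set the cutoff equals 1 and the two integrands agree; on it they differ by at most 2.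
  set S : Set (Input d) := {z | 2 * (d : ℝ) ≤ ‖z‖ ^ 2} with hS
  have hSm : MeasurableSet S := measurableSet_le measurable_const (by fun_prop)
  calc _ ≤ ∫ z, S.indicator (fun _ => (2 : ℝ)) z ∂(stdGaussian (Input d)) := by
        refine norm_integral_le_of_norm_le ((integrable_const _).indicator hSm)
          (ae_of_all _ fun z => ?_)
        by_cases hz : z ∈ S
        · rw [Set.indicator_of_mem hz]
          refine (norm_sub_le _ _).trans ?_
          rw [hn, hn]
          norm_num
        · rw [Set.indicator_of_notMem hz, ← inner_truncFeature, ← inner_featureMap,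
            truncFeature_eq hχ hd (not_le.1 hz).le, sub_self, norm_zero]
    _ ≤ _ := by
        rw [integral_indicator_const _ hSm, smul_eq_mul, mul_comm]
        gcongr
        exact measure_norm_sq_gt_stdGaussian_le d

end Feature

/-! ### Uniform random vectors on the sphere -/

section Sphere

variable {d : ℕ}

open scoped Pointwise in
lemma toSphere_map_val_apply {A : Set (Input d)} (hA : MeasurableSet A) :
    (volume : Measure (Input d)).toSphere.map Subtype.val A =
      d * volume (Set.Ioo (0 : ℝ) 1 • (A ∩ Metric.sphere 0 1)) := by
  rw [Measure.map_apply measurable_subtype_coe hA,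
    Measure.toSphere_apply' _ (measurable_subtype_coe hA), finrank_euclideanSpace_fin,
    Subtype.image_preimage_coe, Set.inter_comm]

open scoped Pointwise in
/-- The uniform distribution on the sphere is invariant under linear isometries. -/
lemma sphereUniform_map_isometry (f : Input d ≃ₗᵢ[ℝ] Input d) :
    (sphereUniform d).map f = sphereUniform d := by
  have h1 : ((volume : Measure (Input d)).toSphere.map Subtype.val).map f =
      (volume : Measure (Input d)).toSphere.map Subtype.val := by
    ext A hA
    rw [Measure.map_apply f.continuous.measurable hA,
      toSphere_map_val_apply (f.continuous.measurable hA), toSphere_map_val_apply hA]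
    have h2 : Set.Ioo (0 : ℝ) 1 • (f ⁻¹' A ∩ Metric.sphere 0 1) =
        f.toMeasurableEquiv ⁻¹' (Set.Ioo (0 : ℝ) 1 • (A ∩ Metric.sphere 0 1)) := by
      ext x
      simp only [Set.mem_smul, Set.mem_preimage]
      constructor
      · rintro ⟨r, hr, y, ⟨hyA, hy⟩, rfl⟩
        refine ⟨r, hr, f y, ⟨hyA, ?_⟩, ?_⟩
        · simpa using hy
        · exact (f.map_smul r y).symm
      · rintro ⟨r, hr, y, ⟨hyA, hy⟩, hxy⟩
        refine ⟨r, hr, f.symm y, ⟨by simpa using hyA, by simpa using hy⟩, ?_⟩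
        have : f (r • f.symm y) = f x := by
          rw [f.map_smul, f.apply_symm_apply]
          exact hxy
        exact f.injective this
    rw [h2, MeasurePreserving.measure_preimage_equiv]
    exact f.measurePreserving
  rw [sphereUniform, Measure.map_smul, Measure.map_smul, h1]

lemma isProbabilityMeasure_sphereUniform (hd : 0 < d) :
    IsProbabilityMeasure (sphereUniform d) := by
  have : Nonempty (Fin d) := ⟨⟨0, hd⟩⟩
  refine ⟨?_⟩
  rw [sphereUniform, Measure.map_apply measurable_subtype_coe MeasurableSet.univ,
    Set.preimage_univ, Measure.smul_apply, smul_eq_mul]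
  refine ENNReal.inv_mul_cancel ?_ (measure_ne_top _ _)
  rw [Measure.toSphere_apply_univ, finrank_euclideanSpace_fin]
  exact mul_ne_zero (by exact_mod_cast hd.ne') (Metric.measure_ball_pos _ _ one_pos).ne'

lemma norm_eq_one_ae_sphereUniform : ∀ᵐ w ∂(sphereUniform d), ‖w‖ = 1 := by
  rw [sphereUniform, ae_map_iff measurable_subtype_coe.aemeasurable
    (measurableSet_eq_fun (by fun_prop) (by fun_prop))]
  exact ae_of_all _ fun w => by simp

/-- A reflection maps `u` to `v` and preserves the uniform law. -/
lemma lintegral_inner_sphereUniform_congr {u v : Input d} (h : ‖u‖ = ‖v‖) {f : ℝ → ℝ≥0∞}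
    (hf : Measurable f) :
    ∫⁻ w, f (inner ℝ u w) ∂(sphereUniform d) = ∫⁻ w, f (inner ℝ v w) ∂(sphereUniform d) := by
  set g := (Submodule.span ℝ {u - v})ᗮ.reflection with hg
  have hgu : g u = v := Submodule.reflection_sub h
  conv_rhs => rw [← sphereUniform_map_isometry g]
  rw [lintegral_map (by fun_prop) g.continuous.measurable]
  refine lintegral_congr fun w => ?_
  rw [← hgu, g.inner_map_map]

lemma integral_norm_sq_stdGaussian : ∫ z, ‖z‖ ^ 2 ∂(stdGaussian (Input d)) = d := by
  set b := EuclideanSpace.basisFun (Fin d) ℝ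
  have hb : ∀ z : Input d, ‖z‖ ^ 2 = ∑ a, inner ℝ (b a) z ^ 2 := fun z => by
    rw [input_norm_sq]
    simp [b, EuclideanSpace.inner_single_left]
  simp_rw [hb]
  rw [integral_finsetSum _ fun a _ => ((polyGrowth_inner (b a)).pow 2).integrable
    (by fun_prop : Continuous fun z : Input d => inner ℝ (b a) z ^ 2).aestronglyMeasurable]
  simp_rw [integral_inner_sq_stdGaussian, b.norm_eq_one]
  simp

/-- The coordinates of `√d w`, for `w` uniform on the sphere, are subgaussian. -/
lemma lintegral_exp_inner_sq_sphereUniform_le (hd : 0 < d) {θ : Input d} (hθ : ‖θ‖ ≤ 1) :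
    ∫⁻ w, ENNReal.ofReal (Real.exp (1 / 4 * (d * inner ℝ θ w ^ 2))) ∂(sphereUniform d) ≤ 2 := by
  have := isProbabilityMeasure_sphereUniform hd
  set γ := stdGaussian (Input d)
  set u : Input d := EuclideanSpace.basisFun (Fin d) ℝ ⟨0, hd⟩ with hu
  have hu1 : ‖u‖ = 1 := (EuclideanSpace.basisFun (Fin d) ℝ).norm_eq_one _
  have hmeas : ∀ a : ℝ, Measurable fun x : ℝ => ENNReal.ofReal (Real.exp (a * x ^ 2)) := by
    intro a
    fun_prop
  have h1 : ∫⁻ w, ENNReal.ofReal (Real.exp (1 / 4 * (d * inner ℝ θ w ^ 2))) ∂(sphereUniform d) ≤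
      ∫⁻ w, ENNReal.ofReal (Real.exp (1 / 4 * (d * inner ℝ u w ^ 2))) ∂(sphereUniform d) := by
    simp_rw [← mul_assoc]
    rw [lintegral_inner_sphereUniform_congr (v := ‖θ‖ • u) (by
      rw [norm_smul, hu1, norm_norm, mul_one]) (hmeas _)]
    refine lintegral_mono fun w => ENNReal.ofReal_le_ofReal (Real.exp_le_exp.2 ?_)
    rw [real_inner_smul_left, mul_pow]
    refine mul_le_mul_of_nonneg_left (mul_le_of_le_one_left (sq_nonneg _) ?_) (by positivity)
    exact pow_le_one₀ (norm_nonneg _) hθ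
  refine h1.trans ?_
  -- Comparison with a Gaussian: d is the mean of ‖z‖², so Jensen's inequality puts the random ‖z‖²
  -- in its place.
  have hJ : ∀ᵐ w ∂(sphereUniform d), ENNReal.ofReal (Real.exp (1 / 4 * (d * inner ℝ u w ^ 2))) ≤
      ∫⁻ z, ENNReal.ofReal (Real.exp (1 / 4 * (‖z‖ ^ 2 * inner ℝ u w ^ 2))) ∂γ := by
    filter_upwards [norm_eq_one_ae_sphereUniform] with w hw
    set a : ℝ := inner ℝ u w ^ 2 with ha
    have ha1 : a ≤ 1 := by
      have := abs_real_inner_le_norm u w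
      rw [hu1, hw, one_mul] at this
      rw [ha, ← sq_abs]
      exact pow_le_one₀ (abs_nonneg _) this
    have hz2 : Integrable (fun z : Input d => 1 / 4 * (‖z‖ ^ 2 * a)) γ :=
      (((polyGrowth_norm.pow 2).integrable
        (by fun_prop : Continuous fun z : Input d => ‖z‖ ^ 2).aestronglyMeasurable).mul_const
          a).const_mul _
    have hei : Integrable (fun z : Input d => Real.exp (1 / 4 * (‖z‖ ^ 2 * a))) γ := by
      refine (integrable_exp_norm_sq_stdGaussian d).1.mono'
        (by fun_prop : Continuous fun z : Input d =>
          Real.exp (1 / 4 * (‖z‖ ^ 2 * a))).aestronglyMeasurable (ae_of_all _ fun z => ?_)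
      rw [Real.norm_of_nonneg (Real.exp_pos _).le]
      refine Real.exp_le_exp.2 ?_
      nlinarith [mul_le_of_le_one_right (sq_nonneg ‖z‖) ha1]
    rw [← ofReal_integral_eq_lintegral_ofReal hei (ae_of_all _ fun z => (Real.exp_pos _).le)]
    refine ENNReal.ofReal_le_ofReal ?_
    have := convexOn_exp.map_integral_le Real.continuous_exp.continuousOn isClosed_univ
      (ae_of_all γ fun z => Set.mem_univ _) hz2 hei
    rwa [integral_const_mul, integral_mul_const, integral_norm_sq_stdGaussian] at this
  refine (lintegral_mono_ae hJ).trans ?_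
  have hjm : Measurable fun p : Input d × Input d =>
      ENNReal.ofReal (Real.exp (1 / 4 * (‖p.2‖ ^ 2 * inner ℝ u p.1 ^ 2))) :=
    (by fun_prop : Continuous fun p : Input d × Input d =>
      Real.exp (1 / 4 * (‖p.2‖ ^ 2 * inner ℝ u p.1 ^ 2))).measurable.ennreal_ofReal
  have hjm2 : Measurable fun p : Input d × Input d =>
      ENNReal.ofReal (Real.exp (1 / 4 * inner ℝ p.1 p.2 ^ 2)) :=
    (by fun_prop : Continuous fun p : Input d × Input d =>
      Real.exp (1 / 4 * inner ℝ p.1 p.2 ^ 2)).measurable.ennreal_ofReal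
  rw [lintegral_lintegral_swap hjm.aemeasurable]
  -- For fixed z, ‖z‖⟨u, w⟩ and ⟨z, w⟩ have the same law under the uniform w. After exchanging the
  -- integrals, ⟨z, w⟩ is standard normal for each unit vector w.
  calc _ = ∫⁻ z, ∫⁻ w, ENNReal.ofReal (Real.exp (1 / 4 * inner ℝ z w ^ 2))
        ∂(sphereUniform d) ∂γ := by
        refine lintegral_congr fun z => ?_
        rw [lintegral_inner_sphereUniform_congr (u := z) (v := ‖z‖ • u) (by
          rw [norm_smul, hu1, norm_norm, mul_one]) (hmeas _)]
        refine lintegral_congr fun w => ?_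
        rw [real_inner_smul_left, mul_pow]
    _ = ∫⁻ w, ∫⁻ z, ENNReal.ofReal (Real.exp (1 / 4 * inner ℝ z w ^ 2)) ∂γ ∂(sphereUniform d) :=
        lintegral_lintegral_swap hjm2.aemeasurable
    _ ≤ ∫⁻ _w, 2 ∂(sphereUniform d) := by
        refine lintegral_mono_ae ?_
        filter_upwards [norm_eq_one_ae_sphereUniform] with w hw
        simp_rw [real_inner_comm w]
        exact lintegral_exp_mul_inner_sq_stdGaussian_le w (by rw [hw]; norm_num)
    _ = 2 := by simp

lemma bddFamily_of_sum_inner_sq_le {V : Type*} [NormedAddCommGroup V] [InnerProductSpace ℝ V]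
    {m : ℕ} {T : Fin m → V} {τ : ℝ} (hτ : 0 ≤ τ)
    (h : ∀ u, ∑ j, inner ℝ (T j) u ^ 2 ≤ τ ^ 2 * ‖u‖ ^ 2) : BddFamily τ T := by
  refine ⟨hτ, fun c => ?_⟩
  set v := ∑ j, c j • T j with hv
  have h0 : 0 ≤ ∑ j, c j ^ 2 := Finset.sum_nonneg fun _ _ => sq_nonneg _
  have h1 : ‖v‖ ^ 2 = ∑ j, c j * inner ℝ (T j) v := by
    rw [← real_inner_self_eq_norm_sq]
    conv_lhs => rw [hv, sum_inner]
    simp [real_inner_smul_left, ← hv]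
  have h2 := Finset.sum_mul_sq_le_sq_mul_sq Finset.univ c fun j => (inner ℝ (T j) v : ℝ)
  rw [← h1] at h2
  have h3 : (‖v‖ ^ 2) ^ 2 ≤ (∑ j, c j ^ 2) * (τ ^ 2 * ‖v‖ ^ 2) :=
    h2.trans (mul_le_mul_of_nonneg_left (h v) h0)
  rcases (sq_nonneg ‖v‖).eq_or_lt with h4 | h4
  · rw [← h4]
    positivity
  · nlinarith

lemma hasNets_norm (d : ℕ) : HasNets (normSeminorm ℝ (Input d)) d := by
  intro A ρ α hρ hα hA
  obtain ⟨N, h1, h2, h3⟩ := exists_finset_net hρ hα hA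
  rw [finrank_euclideanSpace_fin] at h3
  exact ⟨N, h1, h2, h3⟩

/-- Independent uniform random vectors on the sphere of `ℝ^d` form a bounded family with
overwhelming probability. -/
theorem measure_not_bddFamily_le {m : ℕ} (hd : 0 < d) {Γ Γ' : ℝ} (hΓ : (m : ℝ) ≤ Γ * d)
    (hΓ' : (d : ℝ) ≤ Γ' * m) (hΓ0 : 0 ≤ Γ) (hΓ0' : 0 ≤ Γ') :
    (Measure.pi fun _ : Fin m => sphereUniform d).real
      {w | ¬ BddFamily (Real.sqrt (Γ * (4 * ((Γ' * Real.log 5 + Real.log 2 + 1) / (1 / 4))))) w} ≤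
        Real.exp (-m) := by
  have := isProbabilityMeasure_sphereUniform hd
  have hd0 : (0 : ℝ) < d := by exact_mod_cast hd
  -- The rescaled weights are m independent subgaussian rows in dimension d ≤ Γ' m, so
  -- `measure_not_rowsBounded_le` bounds their quadratic forms by M m; undoing the scaling and using
  -- m ≤ Γ d gives the operator norm bound √(ΓM).
  set μ := (sphereUniform d).map fun w => Real.sqrt d • w with hμ
  have : IsProbabilityMeasure μ := Measure.isProbabilityMeasure_map (by fun_prop)
  have hsub : SubgaussianOn μ (normSeminorm ℝ (Input d)) 1 (1 / 4) 2 := by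
    refine subgaussianOn_of_lintegral_le (by norm_num) fun θ hθ => ?_
    rw [hμ, lintegral_map (by fun_prop) (by fun_prop)]
    simp_rw [real_inner_smul_right, mul_pow, Real.sq_sqrt hd0.le]
    exact (lintegral_exp_inner_sq_sphereUniform_le hd hθ).trans (by norm_num)
  have hmain := measure_not_rowsBounded_le (n := m) (fun θ => le_rfl) one_pos (by norm_num)
    (by norm_num) hsub (hasNets_norm d) hΓ'
  set M := 4 * ((Γ' * Real.log 5 + Real.log 2 + 1) / (1 / 4)) with hM
  have hM0 : 0 ≤ M := by
    have := Real.log_nonneg (show (1 : ℝ) ≤ 5 by norm_num)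
    have := Real.log_nonneg (show (1 : ℝ) ≤ 2 by norm_num)
    positivity
  have hpi : (Measure.pi fun _ : Fin m => μ) = (Measure.pi fun _ : Fin m => sphereUniform d).map
      fun w j => Real.sqrt d • w j :=
    (Measure.pi_map_pi (μ := fun _ : Fin m => sphereUniform d)
      (f := fun _ w => Real.sqrt d • w) (fun _ => by fun_prop)).symm
  rw [hpi] at hmain
  refine le_trans ?_ hmain
  refine le_trans ?_ (ENNReal.toReal_mono (measure_ne_top _ _)
    (Measure.le_map_apply (by fun_prop : Measurable fun (w : Fin m → Input d) j =>
      Real.sqrt d • w j).aemeasurable _))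
  refine measureReal_mono (fun w hw hrow => hw ?_) (measure_ne_top _ _)
  have hrow' : RowsBounded (normSeminorm ℝ (Input d)) 1 M fun j => Real.sqrt d • w j := hrow
  refine bddFamily_of_sum_inner_sq_le (Real.sqrt_nonneg _) fun u => ?_
  rw [Real.sq_sqrt (by positivity)]
  rcases eq_or_ne u 0 with rfl | hu
  · simp
  have hu0 : 0 < ‖u‖ := norm_pos_iff.2 hu
  have h1 := hrow' (‖u‖⁻¹ • u) (by
    rw [coe_normSeminorm, norm_smul, norm_inv, norm_norm, inv_mul_cancel₀ hu0.ne'])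
  have h2 : ∀ j, (inner ℝ (‖u‖⁻¹ • u) (Real.sqrt d • w j) : ℝ) ^ 2 =
      d / ‖u‖ ^ 2 * inner ℝ (w j) u ^ 2 := fun j => by
    rw [real_inner_smul_left, real_inner_smul_right, real_inner_comm, mul_pow, mul_pow,
      Real.sq_sqrt hd0.le, inv_pow]
    ring
  simp_rw [h2] at h1
  rw [← Finset.mul_sum, div_mul_eq_mul_div, div_le_iff₀ (by positivity)] at h1
  have h3 : M * m * ‖u‖ ^ 2 ≤ M * (Γ * d) * ‖u‖ ^ 2 := by gcongr
  nlinarith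

end Sphere

/-! ### Reduction of the optimal training error to centered losses of the marginals -/

lemma isActivation_deriv {σ : ℝ → ℝ} {M : ℝ}
    (hdiff : ∀ j < 4, Differentiable ℝ (iteratedDeriv j σ))
    (hbdd : ∀ j, 1 ≤ j → j ≤ 4 → ∀ t, |iteratedDeriv j σ t| ≤ M) :
    IsActivation (deriv σ) (iteratedDeriv 2 σ) (iteratedDeriv 3 σ) M where
  hasDerivAt t := by
    have := (hdiff 1 (by norm_num) t).hasDerivAt
    rwa [← iteratedDeriv_succ, iteratedDeriv_one] at this
  hasDerivAt₁ t := by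
    have := (hdiff 2 (by norm_num) t).hasDerivAt
    rwa [← iteratedDeriv_succ] at this
  continuous₂ := (hdiff 3 (by norm_num)).continuous
  abs_le t := by
    have := hbdd 1 le_rfl (by norm_num) t
    rwa [iteratedDeriv_one] at this
  abs_le₁ := hbdd 2 (by norm_num) (by norm_num)
  abs_le₂ := hbdd 3 (by norm_num) (by norm_num)

lemma piLp_norm_le_sum {ι : Type*} [Fintype ι] {E : Type*} [NormedAddCommGroup E]
    (x : PiLp 2 fun _ : ι => E) : ‖x‖ ≤ ∑ i, ‖x i‖ := by
  rw [PiLp.norm_eq_of_L2]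
  refine (Real.sqrt_le_left (Finset.sum_nonneg fun _ _ => norm_nonneg _)).2 ?_
  exact Finset.sum_sq_le_sq_sum_of_nonneg fun _ _ => norm_nonneg _

lemma IsLip.abs_sub_le {k : ℕ} {K : ℝ≥0} {f : EuclideanSpace ℝ (Fin k) → ℝ → ℝ} (hf : IsLip K f)
    (u u' : EuclideanSpace ℝ (Fin k)) (y y' : ℝ) :
    |f u y - f u' y'| ≤ K * (‖u - u'‖ + |y - y'|) := by
  have h := hf.dist_le_mul (WithLp.toLp 2 (u, y)) (WithLp.toLp 2 (u', y'))
  rw [Real.dist_eq, dist_eq_norm, ← WithLp.toLp_sub, Prod.mk_sub_mk,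
    WithLp.prod_norm_eq_of_L2] at h
  refine h.trans (mul_le_mul_of_nonneg_left ?_ K.2)
  refine (Real.sqrt_le_left (by positivity)).2 ?_
  have := mul_nonneg (norm_nonneg (u - u')) (abs_nonneg (y - y'))
  change ‖u - u'‖ ^ 2 + |y - y'| ^ 2 ≤ (‖u - u'‖ + |y - y'|) ^ 2
  nlinarith

lemma IsLip.continuous {k : ℕ} {K : ℝ≥0} {f : EuclideanSpace ℝ (Fin k) → ℝ → ℝ} (hf : IsLip K f) :
    Continuous fun p : EuclideanSpace ℝ (Fin k) × ℝ => f p.1 p.2 :=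
  LipschitzWith.continuous (f := fun v : WithLp 2 (EuclideanSpace ℝ (Fin k) × ℝ) =>
    f v.fst v.snd) hf |>.comp (WithLp.prod_continuous_toLp 2 _ _)

section CenteredLoss

variable {m d k ks n : ℕ}

/-- The loss as a function of the marginals, normalized to vanish at zero. -/
def centeredLoss (ℓ : EuclideanSpace ℝ (Fin k) → ℝ → ℝ) (η : EuclideanSpace ℝ (Fin ks) → ℝ → ℝ)
    (e : ℝ) (x : Fin k ⊕ Fin ks → ℝ) : ℝ :=
  ℓ (WithLp.toLp 2 fun j => x (Sum.inl j)) (η (WithLp.toLp 2 fun j => x (Sum.inr j)) e) -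
    ℓ 0 (η 0 e)

lemma norm_toLp_comp_le {ι : Type*} [Fintype ι] (f : Fin k → ι) (x : ι → ℝ) :
    ‖(WithLp.toLp 2 fun j => x (f j) : EuclideanSpace ℝ (Fin k))‖ ≤ k * ‖x‖ := by
  refine (piLp_norm_le_sum _).trans ?_
  calc _ ≤ ∑ _j : Fin k, ‖x‖ := Finset.sum_le_sum fun j _ => norm_le_pi_norm x (f j)
    _ = k * ‖x‖ := by simp

lemma abs_centeredLoss_sub_le {K : ℝ≥0} {ℓ : EuclideanSpace ℝ (Fin k) → ℝ → ℝ}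
    {η : EuclideanSpace ℝ (Fin ks) → ℝ → ℝ} (hℓ : IsLip K ℓ) (hη : IsLip K η) (e : ℝ)
    (x y : Fin k ⊕ Fin ks → ℝ) :
    |centeredLoss ℓ η e x - centeredLoss ℓ η e y| ≤ K * (k + K * ks) * ‖x - y‖ := by
  rw [centeredLoss, centeredLoss, sub_sub_sub_cancel_right]
  have h1 := hη.abs_sub_le (WithLp.toLp 2 fun j => x (Sum.inr j))
    (WithLp.toLp 2 fun j => y (Sum.inr j)) e e
  have h2 := norm_toLp_comp_le Sum.inl (x - y)
  have h3 := norm_toLp_comp_le Sum.inr (x - y)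
  rw [sub_self, abs_zero, add_zero] at h1
  refine (hℓ.abs_sub_le _ _ _ _).trans ?_
  rw [mul_assoc]
  refine mul_le_mul_of_nonneg_left ?_ K.2
  rw [add_mul]
  refine add_le_add h2 (h1.trans ?_)
  rw [mul_assoc]
  exact mul_le_mul_of_nonneg_left h3 K.2

lemma centeredLoss_zero (ℓ : EuclideanSpace ℝ (Fin k) → ℝ → ℝ)
    (η : EuclideanSpace ℝ (Fin ks) → ℝ → ℝ) (e : ℝ) : centeredLoss ℓ η e 0 = 0 :=
  sub_self _

/-- The regularizer plus the mean loss at zero. -/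
def shiftedReg (ℓ : EuclideanSpace ℝ (Fin k) → ℝ → ℝ) (η : EuclideanSpace ℝ (Fin ks) → ℝ → ℝ)
    (e : Fin n → ℝ) (r : Param m d k → ℝ) (Θ : Fin k → Feat m d) : ℝ :=
  r (WithLp.toLp 2 Θ) + (1 / (n : ℝ)) * ∑ i, ℓ 0 (η 0 (e i))

/-- The loss at zero does not depend on Θ and moves into the regularizer as an additive constant.
The remaining losses vanish at zero and have Lipschitz constants that do not depend on the noise, so
the universality theorem applies for every fixed noise vector. -/
lemma minRisk_eq_optRisk (ℓ : EuclideanSpace ℝ (Fin k) → ℝ → ℝ)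
    (η : EuclideanSpace ℝ (Fin ks) → ℝ → ℝ) (e : Fin n → ℝ) (r : Param m d k → ℝ)
    (C : Set (Feat m d)) (Θs : Param m d ks) (X : Fin n → Feat m d) :
    minRisk ℓ r C X (response η Θs X e) =
      optRisk C (fun i => centeredLoss ℓ η (e i)) (shiftedReg ℓ η e r) (fun j => Θs j) X := by
  have h : ∀ Θ : Param m d k, empRisk ℓ r X (response η Θs X e) Θ =
      risk (fun i => centeredLoss ℓ η (e i)) (shiftedReg ℓ η e r) (fun j => Θs j) X
        (fun j => Θ j) := by
    intro Θ
    have : ∑ i, centeredLoss ℓ η (e i) (marginals (fun j => Θ j) (fun j => Θs j) (X i)) =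
        ∑ i, ℓ (proj Θ (X i)) (response η Θs X e i) - ∑ i, ℓ 0 (η 0 (e i)) :=
      Finset.sum_sub_distrib _ _
    rw [empRisk, risk, shiftedReg, this]
    ring
  rw [minRisk, optRisk]
  congr 1
  ext t
  constructor
  · rintro ⟨Θ, hΘ, rfl⟩
    exact ⟨fun j => Θ j, hΘ, (h Θ).symm⟩
  · rintro ⟨Θ, hΘ, rfl⟩
    exact ⟨WithLp.toLp 2 Θ, hΘ, h _⟩

lemma abs_shiftedReg_sub_le {Lr R : ℝ} {ℓ : EuclideanSpace ℝ (Fin k) → ℝ → ℝ}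
    {η : EuclideanSpace ℝ (Fin ks) → ℝ → ℝ} {e : Fin n → ℝ} {r : Param m d k → ℝ}
    (hLr : 0 ≤ Lr)
    (hr : ∀ Θ₀ Θ₁ : Param m d k, ‖Θ₀‖ ≤ k * R → ‖Θ₁‖ ≤ k * R → |r Θ₀ - r Θ₁| ≤ Lr * ‖Θ₀ - Θ₁‖)
    {Θ Θ' : Fin k → Feat m d} (hΘ : ∀ j, ‖Θ j‖ ≤ R) (hΘ' : ∀ j, ‖Θ' j‖ ≤ R) :
    |shiftedReg ℓ η e r Θ - shiftedReg ℓ η e r Θ'| ≤ Lr * ∑ j, ‖Θ j - Θ' j‖ := by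
  have h1 : ∀ Ξ : Fin k → Feat m d, (∀ j, ‖Ξ j‖ ≤ R) →
      ‖(WithLp.toLp 2 Ξ : Param m d k)‖ ≤ k * R := fun Ξ h => by
    refine (piLp_norm_le_sum _).trans ((Finset.sum_le_sum fun j _ => h j).trans_eq ?_)
    simp
  rw [shiftedReg, shiftedReg, add_sub_add_right_eq_sub]
  refine (hr _ _ (h1 Θ hΘ) (h1 Θ' hΘ')).trans (mul_le_mul_of_nonneg_left ?_ hLr)
  exact piLp_norm_le_sum _

lemma continuous_of_locally_lipschitz {E : Type*} [NormedAddCommGroup E] {r : E → ℝ}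
    {Kr : ℝ≥0 → ℝ} (hKr : ∀ B, 0 < Kr B) (hr : ∀ B : ℝ≥0, 0 < B → ∀ x y : E, ‖x‖ ≤ B → ‖y‖ ≤ B →
      |r x - r y| ≤ Kr B * ‖x - y‖) : Continuous r := by
  refine continuous_iff_continuousAt.2 fun x => ?_
  set B : ℝ≥0 := ‖x‖₊ + 1
  have hB : (B : ℝ) = ‖x‖ + 1 := by simp [B]
  have hL : LipschitzOnWith ⟨Kr B, (hKr B).le⟩ r (Metric.ball 0 B) := by
    refine LipschitzOnWith.of_dist_le_mul fun y hy z hz => ?_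
    rw [mem_ball_zero_iff] at hy hz
    rw [Real.dist_eq, dist_eq_norm]
    exact hr B (by positivity) y z hy.le hz.le
  refine hL.continuousOn.continuousAt (Metric.isOpen_ball.mem_nhds ?_)
  rw [mem_ball_zero_iff, hB]
  linarith

/-- An infimum over a compact set of a jointly continuous function is continuous in the parameter;
this supplies all the measurability needed. -/
lemma continuous_minRisk {K : ℝ≥0} {ℓ : EuclideanSpace ℝ (Fin k) → ℝ → ℝ}
    {η : EuclideanSpace ℝ (Fin ks) → ℝ → ℝ} (hℓ : IsLip K ℓ) (hη : IsLip K η)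
    {r : Param m d k → ℝ} (hr : Continuous r) {C : Set (Feat m d)} (hC : IsCompact C)
    (Θs : Param m d ks) :
    Continuous fun p : (Fin n → Feat m d) × (Fin n → ℝ) =>
      minRisk ℓ r C p.1 (response η Θs p.1 p.2) := by
  have hK : IsCompact {Θ : Param m d k | ∀ j, Θ j ∈ C} := by
    have h1 : IsCompact (Set.univ.pi fun _ : Fin k => C) := isCompact_univ_pi fun _ => hC
    have h2 := h1.image (PiLp.continuous_toLp 2 fun _ : Fin k => Feat m d)
    convert h2 using 1
    ext Θ
    constructor
    · intro h
      exact ⟨fun j => Θ j, fun j _ => h j, rfl⟩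
    · rintro ⟨Ξ, hΞ, rfl⟩ j
      exact hΞ j trivial
  refine hK.continuous_sInf (f := fun p : (Fin n → Feat m d) × (Fin n → ℝ) =>
    empRisk ℓ r p.1 (response η Θs p.1 p.2)) ?_
  have hproj : ∀ (l : ℕ) (i : Fin n), Continuous fun q : Param m d l × (Fin n → Feat m d) =>
      proj q.1 (q.2 i) := by
    intro l i
    unfold proj
    fun_prop
  have hresp : ∀ i : Fin n, Continuous fun q : ((Fin n → Feat m d) × (Fin n → ℝ)) =>
      response η Θs q.1 q.2 i := fun i =>
    hη.continuous.comp (((hproj ks i).comp (continuous_const.prodMk continuous_fst)).prodMk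
      ((continuous_apply i).comp continuous_snd))
  have hloss : ∀ i : Fin n, Continuous fun q : ((Fin n → Feat m d) × (Fin n → ℝ)) × Param m d k =>
      ℓ (proj q.2 (q.1.1 i)) (response η Θs q.1.1 q.1.2 i) := fun i =>
    hℓ.continuous.comp (((hproj k i).comp (continuous_snd.prodMk
      (continuous_fst.comp continuous_fst))).prodMk ((hresp i).comp continuous_fst))
  exact (continuous_const.mul (continuous_finsetSum _ fun i _ => hloss i)).add
    (hr.comp continuous_snd)

end CenteredLoss

/-! ### Proportional dimensions -/

section Dimensions

variable {γ γt : ℝ} {m d : ℕ → ℕ}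

lemma eventually_width_le (hγt : 0 < γt) (hd : ∀ n, 0 < d n)
    (hmd : Tendsto (fun n => (m n : ℝ) / d n) atTop (𝓝 γt)) :
    ∀ᶠ n in atTop, (m n : ℝ) ≤ (γt + 1) * d n ∧ (d n : ℝ) ≤ 2 / γt * m n := by
  filter_upwards [hmd.eventually_lt_const (lt_add_one γt),
    hmd.eventually_const_lt (half_lt_self hγt)] with n h1 h2
  have hd0 : (0 : ℝ) < d n := by exact_mod_cast hd n
  rw [div_lt_iff₀ hd0] at h1
  rw [lt_div_iff₀ hd0] at h2
  refine ⟨h1.le, ?_⟩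
  rw [div_mul_eq_mul_div, le_div_iff₀ hγt]
  linarith

lemma eventually_dim_le
    (hp : Tendsto (fun n => ((m n * d n : ℕ) : ℝ) / n) atTop (𝓝 γ)) :
    ∀ᶠ n in atTop, ((m n * d n : ℕ) : ℝ) ≤ (γ + 1) * n := by
  filter_upwards [hp.eventually_lt_const (lt_add_one γ), eventually_gt_atTop 0] with n h1 hn
  have hn0 : (0 : ℝ) < n := by exact_mod_cast hn
  rw [div_lt_iff₀ hn0] at h1
  exact h1.le

lemma eventually_sample_size_le (hγ : 0 < γ) (hγt : 0 < γt) (hd : ∀ n, 0 < d n)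
    (hmd : Tendsto (fun n => (m n : ℝ) / d n) atTop (𝓝 γt))
    (hp : Tendsto (fun n => ((m n * d n : ℕ) : ℝ) / n) atTop (𝓝 γ)) :
    ∀ᶠ n : ℕ in atTop, (n : ℝ) ≤ 2 / γ * (γt + 1) * (d n : ℝ) ^ 2 := by
  filter_upwards [eventually_width_le hγt hd hmd, hp.eventually_const_lt (half_lt_self hγ),
    eventually_gt_atTop 0] with n h1 h2 hn
  have hn0 : (0 : ℝ) < n := by exact_mod_cast hn
  have hd0 : (0 : ℝ) < d n := by exact_mod_cast hd n
  rw [lt_div_iff₀ hn0] at h2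
  push_cast at h2
  have h3 : (m n : ℝ) * d n ≤ (γt + 1) * d n * d n := mul_le_mul_of_nonneg_right h1.1 hd0.le
  have h4 : 2 / γ * (γt + 1) * (d n : ℝ) ^ 2 = 2 * ((γt + 1) * d n * d n) / γ := by
    field_simp
  rw [h4, le_div_iff₀ hγ]
  linarith

lemma tendsto_inputDim (hγ : 0 < γ) (hγt : 0 < γt) (hd : ∀ n, 0 < d n)
    (hmd : Tendsto (fun n => (m n : ℝ) / d n) atTop (𝓝 γt))
    (hp : Tendsto (fun n => ((m n * d n : ℕ) : ℝ) / n) atTop (𝓝 γ)) :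
    Tendsto (fun n => (d n : ℝ)) atTop atTop := by
  have hc : 0 < 2 / γ * (γt + 1) := by positivity
  refine tendsto_atTop_mono' (f₁ := fun n : ℕ => Real.sqrt ((n : ℝ) / (2 / γ * (γt + 1)))) _ ?_ ?_
  · filter_upwards [eventually_sample_size_le hγ hγt hd hmd hp] with n hn
    refine Real.sqrt_le_iff.2 ⟨Nat.cast_nonneg _, ?_⟩
    rw [div_le_iff₀ hc, mul_comm]
    exact hn
  · exact Real.tendsto_sqrt_atTop.comp (tendsto_natCast_atTop_atTop.atTop_div_const hc)

lemma tendsto_width (hγ : 0 < γ) (hγt : 0 < γt) (hd : ∀ n, 0 < d n)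
    (hmd : Tendsto (fun n => (m n : ℝ) / d n) atTop (𝓝 γt))
    (hp : Tendsto (fun n => ((m n * d n : ℕ) : ℝ) / n) atTop (𝓝 γ)) :
    Tendsto (fun n => (m n : ℝ)) atTop atTop := by
  refine tendsto_atTop_mono' (f₁ := fun n : ℕ => (d n : ℝ) / (2 / γt)) _ ?_
    ((tendsto_inputDim hγ hγt hd hmd hp).atTop_div_const (by positivity))
  filter_upwards [eventually_width_le hγt hd hmd] with n hn
  rw [div_le_iff₀ (by positivity), mul_comm]
  exact hn.2

/-- The sample size is at most of order d², so the union bound over all inputs for the event ‖z‖² ≥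
2d still vanishes. -/
lemma tendsto_sample_size_mul_exp (hγ : 0 < γ) (hγt : 0 < γt) (hd : ∀ n, 0 < d n)
    (hmd : Tendsto (fun n => (m n : ℝ) / d n) atTop (𝓝 γt))
    (hp : Tendsto (fun n => ((m n * d n : ℕ) : ℝ) / n) atTop (𝓝 γ)) :
    Tendsto (fun n : ℕ => (n : ℝ) * Real.exp (-((d n : ℝ) / 8))) atTop (𝓝 0) := by
  have h1 : Tendsto (fun n => (d n : ℝ) / 8) atTop atTop :=
    (tendsto_inputDim hγ hγt hd hmd hp).atTop_div_const (by norm_num)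
  have h2 := ((Real.tendsto_pow_mul_exp_neg_atTop_nhds_zero 2).comp h1).const_mul
    (2 / γ * (γt + 1) * 64)
  rw [mul_zero] at h2
  refine tendsto_of_tendsto_of_tendsto_of_le_of_le' tendsto_const_nhds h2
    (Eventually.of_forall fun n => by positivity) ?_
  filter_upwards [eventually_sample_size_le hγ hγt hd hmd hp] with n hn
  calc _ ≤ 2 / γ * (γt + 1) * (d n : ℝ) ^ 2 * Real.exp (-((d n : ℝ) / 8)) :=
        mul_le_mul_of_nonneg_right hn (Real.exp_pos _).le
    _ = _ := by
        simp only [Function.comp_apply]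
        ring

end Dimensions

/-! ### Universality for fixed weights and noise -/

/-- Replacing the features by the truncated features changes bounded expectations by at most the
probability that some input is long. -/
lemma abs_integral_featureMap_sub_truncFeature_le {m d n : ℕ} {σ s₁ s₂ χ χ' : ℝ → ℝ} {M L B : ℝ}
    {w : Fin m → Input d} (hs : IsActivation (deriv σ) s₁ s₂ M) (hχ : IsCutoff χ χ' L) (hd : 0 < d)
    {F : (Fin n → Feat m d) → ℝ} (hF : Continuous F) (hB : ∀ u, |F u| ≤ B) :
    |∫ u, F (fun i => featureMap σ w (u i)) ∂(Measure.pi fun _ => stdGaussian (Input d)) -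
      ∫ u, F u ∂(Measure.pi fun _ => (stdGaussian (Input d)).map (truncFeature χ σ w))| ≤
      2 * B * (n * Real.exp (-(d / 8))) := by
  have hB0 : 0 ≤ B := (abs_nonneg _).trans (hB 0)
  have htc := continuous_truncFeature (w := w) hs hχ
  have hfc := continuous_featureMap (w := w) hs
  have : IsProbabilityMeasure ((stdGaussian (Input d)).map (truncFeature χ σ w)) :=
    Measure.isProbabilityMeasure_map htc.aemeasurable
  have htc' : Continuous fun (u : Fin n → Input d) i => truncFeature χ σ w (u i) := by fun_prop
  have hfc' : Continuous fun (u : Fin n → Input d) i => featureMap σ w (u i) := by fun_prop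
  rw [← Measure.pi_map_pi fun _ => htc.aemeasurable,
    integral_map htc'.aemeasurable hF.aestronglyMeasurable, ← integral_sub
      (f := fun u : Fin n → Input d => F fun i => featureMap σ w (u i))
      (g := fun u : Fin n → Input d => F fun i => truncFeature χ σ w (u i))
      (Integrable.of_bound (hF.comp hfc').aestronglyMeasurable B (ae_of_all _ fun u => hB _))
      (Integrable.of_bound (hF.comp htc').aestronglyMeasurable B (ae_of_all _ fun u => hB _))]
  set S : Set (Fin n → Input d) := ⋃ i, (fun u => u i) ⁻¹' {z | 2 * (d : ℝ) ≤ ‖z‖ ^ 2} with hS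
  have hSm : MeasurableSet {z : Input d | 2 * (d : ℝ) ≤ ‖z‖ ^ 2} :=
    measurableSet_le measurable_const (by fun_prop)
  have h1 : (Measure.pi fun _ : Fin n => stdGaussian (Input d)).real S ≤
      n * Real.exp (-(d / 8)) := by
    refine (measureReal_iUnion_fintype_le _).trans ?_
    calc _ ≤ ∑ _i : Fin n, Real.exp (-(d / 8)) := by
          refine Finset.sum_le_sum fun i _ => ?_
          have := (measurePreserving_eval (fun _ : Fin n => stdGaussian (Input d)) i).measureReal_preimage
            hSm.nullMeasurableSet
          exact this.trans_le (measure_norm_sq_gt_stdGaussian_le d)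
      _ = _ := by simp
  refine (abs_integral_le_of_abs_le_off S le_rfl (b := 2 * B) ?_ ?_).trans ?_
  · intro u hu
    have h2 : (fun i => truncFeature χ σ w (u i)) = fun i => featureMap σ w (u i) := by
      funext i
      refine truncFeature_eq hχ hd ?_
      simp only [hS, Set.mem_iUnion, Set.mem_preimage, Set.mem_ofPred_eq, not_exists, not_le] at hu
      exact (hu i).le
    rw [h2, sub_self, abs_zero]
  · intro u
    have := abs_sub (F fun i => featureMap σ w (u i)) (F fun i => truncFeature χ σ w (u i))
    linarith [hB fun i => featureMap σ w (u i), hB fun i => truncFeature χ σ w (u i)]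
  · rw [zero_add]
    exact mul_le_mul_of_nonneg_left h1 (by positivity)

/-- The threshold on n precedes the weights, the noise and all the data of the optimization problem;
this uniformity is what allows averaging over weights and noise afterwards. The chain is features,
truncated features, Gaussian features. -/
theorem eventually_abs_integral_minRisk_sub_le {γ γt R ω ε : ℝ} {K : ℝ≥0} {k ks : ℕ}
    {Kr : ℝ≥0 → ℝ} (hγ : 0 < γ) (hγt : 0 < γt) (hR : 0 < R) (hKr : ∀ B, 0 < Kr B)
    {σ s₁ s₂ : ℝ → ℝ} {M : ℝ} (hs : IsActivation (deriv σ) s₁ s₂ M)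
    (h0 : ∫ t, t * deriv σ t ∂(gaussianReal 0 1) = 0) {m d : ℕ → ℕ} (hd : ∀ n, 0 < d n)
    (hmd : Tendsto (fun n => (m n : ℝ) / d n) atTop (𝓝 γt))
    (hp : Tendsto (fun n => ((m n * d n : ℕ) : ℝ) / n) atTop (𝓝 γ))
    {ψ : ℝ → ℝ} {B : ℝ} (hB : ∀ x, |ψ x| ≤ B) {L : ℝ≥0} (hψ : LipschitzWith L ψ) (hε : 0 < ε) :
    ∀ᶠ n in atTop, ∀ w : Fin (m n) → Input (d n), BddFamily ω w → (∀ j, ‖w j‖ = 1) →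
      ∀ (ℓ : EuclideanSpace ℝ (Fin k) → ℝ → ℝ) (η : EuclideanSpace ℝ (Fin ks) → ℝ → ℝ),
      IsLip K ℓ → IsLip K η →
      ∀ C : Set (Feat (m n) (d n)), IsCompact C → C.Nonempty → C ⊆ paramSet (m n) (d n) R →
      ∀ Θs : Param (m n) (d n) ks, (∀ j, Θs j ∈ paramSet (m n) (d n) R) →
      ∀ r : Param (m n) (d n) k → ℝ,
      (∀ B' : ℝ≥0, 0 < B' → ∀ Θ₀ Θ₁, ‖Θ₀‖ ≤ B' → ‖Θ₁‖ ≤ B' → |r Θ₀ - r Θ₁| ≤ Kr B' * ‖Θ₀ - Θ₁‖) →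
      ∀ e : Fin n → ℝ,
      |∫ u, ψ (minRisk ℓ r C (fun i => featureMap σ w (u i))
          (response η Θs (fun i => featureMap σ w (u i)) e))
          ∂(Measure.pi fun _ => stdGaussian (Input (d n))) -
        ∫ u, ψ (minRisk ℓ r C u (response η Θs u e))
          ∂(Measure.pi fun _ => multivariateGaussian 0 (featureCov σ w))| ≤ ε := by
  obtain ⟨χ, χ', Lc, hχ⟩ := exists_isCutoff
  have hB0 : 0 ≤ B := (abs_nonneg _).trans (hB 0)
  -- Columns of norm at most R have Frobenius norm at most kR; the added 1 keeps the radius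
  -- positive.
  set B₀ : ℝ≥0 := NNReal.mk (k * R + 1) (by positivity)
  have hB₀ : (B₀ : ℝ) = k * R + 1 := rfl
  have hB₀' : 0 < B₀ := by
    rw [← NNReal.coe_pos, hB₀]
    positivity
  have hc : 0 < subgaussianConst M R ω (γt + 1) Lc := by
    unfold subgaussianConst
    positivity
  obtain ⟨δ, hδ, n₀, H⟩ := exists_charFun_close_imp_optRisk_close k ks R (γ + 1)
    (subgaussianConst M R ω (γt + 1) Lc) 4 (K * (k + K * ks)) (Kr B₀) (ε / 2) hR (by positivity)
    hc (by norm_num) (by positivity) (hKr _).le (by positivity) ψ hB hψ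
  have hdt := tendsto_inputDim hγ hγt hd hmd hp
  have hl1 : Tendsto (fun n => 2 * Real.exp (-((d n : ℝ) / 8))) atTop (𝓝 0) := by
    have := ((Real.tendsto_exp_neg_atTop_nhds_zero).comp
      (hdt.atTop_div_const (by norm_num : (0 : ℝ) < 8))).const_mul 2
    rwa [mul_zero] at this
  have hl2 : Tendsto (fun n => 2 * (Real.sqrt (5 * (8 * (M * ω) ^ 4 * (16 + 3 * (γt + 1) * ω ^ 4) +
      8 * M ^ 4 * ((γt + 1) ^ 2 + 3 * ω ^ 4))) / Real.sqrt (Real.sqrt (d n)))) atTop (𝓝 0) := by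
    have := (tendsto_const_nhds (x := Real.sqrt (5 * (8 * (M * ω) ^ 4 *
      (16 + 3 * (γt + 1) * ω ^ 4) + 8 * M ^ 4 * ((γt + 1) ^ 2 + 3 * ω ^ 4))))).div_atTop
      (Real.tendsto_sqrt_atTop.comp (Real.tendsto_sqrt_atTop.comp hdt)) |>.const_mul 2
    rwa [mul_zero] at this
  have hl3 := (tendsto_sample_size_mul_exp hγ hγt hd hmd hp).const_mul (2 * B)
  rw [mul_zero] at hl3
  filter_upwards [eventually_ge_atTop n₀, eventually_width_le hγt hd hmd, eventually_dim_le hp,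
    hl1.eventually_lt_const hδ, hl2.eventually_lt_const hδ,
    hl3.eventually_lt_const (half_pos hε)] with n hn hΓ hpn h1 h2 h3
  intro w hw hw1 ℓ η hℓ hη C hCc hCn hC Θs hΘs r hr e
  have hcont := (continuous_minRisk (n := n) hℓ hη (continuous_of_locally_lipschitz hKr hr) hCc
    Θs).comp (continuous_id.prodMk (continuous_const (y := e)))
  have htc := continuous_truncFeature (w := w) hs hχ
  have : IsProbabilityMeasure ((stdGaussian (Input (d n))).map (truncFeature χ σ w)) :=
    Measure.isProbabilityMeasure_map htc.aemeasurable
  have h4 := abs_integral_featureMap_sub_truncFeature_le (w := w) hs hχ (hd n)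
    (F := fun u => ψ (minRisk ℓ r C u (response η Θs u e))) (hψ.continuous.comp hcont)
    (fun u => hB _)
  have hC' : ∀ x ∈ C, opSeminorm (m n) (d n) x ≤ R := fun x hx =>
    (mem_paramSet_iff (hd n) x).1 (hC hx)
  have hrisk : (fun u => minRisk ℓ r C u (response η Θs u e)) =
      optRisk C (fun i => centeredLoss ℓ η (e i)) (shiftedReg ℓ η e r) fun j => Θs j :=
    funext fun u => minRisk_eq_optRisk ℓ η e r C Θs u
  have h5 := H (Feat (m n) (d n)) (opSeminorm (m n) (d n))
    ((stdGaussian (Input (d n))).map (truncFeature χ σ w))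
    (multivariateGaussian 0 (featureCov σ w)) norm_le_opSeminorm
    (subgaussianOn_truncFeature hs hχ (hd n) hΓ.1 hw hw1 h0)
    (subgaussianOn_gaussianFeature hs (hd n) hΓ.1 hw hw1 h0) (fun θ => by
      refine (norm_charFun_truncFeature_sub_le hs hχ (hd n) hΓ.1 hw hw1 h0 θ).trans ?_
      rw [mul_add δ, mul_one δ, mul_div_right_comm, ← mul_assoc]
      exact add_le_add h1.le (mul_le_mul_of_nonneg_right h2.le (sq_nonneg _)))
    n hn (m n * d n) (hasNets_opSeminorm (m n) (d n) (hd n)) hpn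
    (fun i => centeredLoss ℓ η (e i)) (fun i => abs_centeredLoss_sub_le hℓ hη (e i))
    (fun i => centeredLoss_zero ℓ η (e i)) (fun j => Θs j)
    (fun j => (mem_paramSet_iff (hd n) _).1 (hΘs j)) C hCn hC' (shiftedReg ℓ η e r)
    (fun Θ Θ' hΘ hΘ' => abs_shiftedReg_sub_le (hKr _).le
      (fun Θ₀ Θ₁ hΘ₀ hΘ₁ => hr B₀ hB₀' Θ₀ Θ₁ (hΘ₀.trans (by linarith)) (hΘ₁.trans (by linarith)))
      (fun j => (norm_le_opSeminorm _).trans (hC' _ (hΘ j)))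
      (fun j => (norm_le_opSeminorm _).trans (hC' _ (hΘ' j))))
    (hrisk ▸ hcont.measurable)
  rw [← hrisk] at h5
  refine (abs_sub_le _ _ _).trans ((add_le_add (h4.trans h3.le) h5).trans_eq (by ring))

/-! ### Averaging over the weights and the noise -/

section Model

variable {m d n : ℕ} {σ s₁ s₂ : ℝ → ℝ} {M : ℝ}

lemma continuous_featureMap_uncurry (hs : IsActivation (deriv σ) s₁ s₂ M) :
    Continuous fun q : (Fin m → Input d) × Input d => featureMap σ q.1 q.2 := by
  have := hs.continuous
  unfold featureMap
  fun_prop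

variable {Ω : Type*} [MeasurableSpace Ω] {P : Measure Ω} [IsProbabilityMeasure P] {ν : Measure ℝ}
  [IsProbabilityMeasure ν] {W : Ω → Fin m → Input d} {z : Ω → Fin n → Input d}
  {e : Ω → Fin n → ℝ} {g : Ω → Fin n → Feat m d} {F : (Fin n → Feat m d) × (Fin n → ℝ) → ℝ} {B : ℝ}

lemma IsModel.aemeasurable_features (h : IsModel P σ ν W z e g)
    (hs : IsActivation (deriv σ) s₁ s₂ M) :
    AEMeasurable (fun x => ((fun i => featureMap σ (W x) (z x i)), e x)) P := by
  have hc : Continuous fun q : (Fin m → Input d) × (Fin n → Input d) × (Fin n → ℝ) =>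
      ((fun i => featureMap σ q.1 (q.2.1 i)), q.2.2) := by
    have := continuous_featureMap_uncurry (m := m) (d := d) hs
    refine Continuous.prodMk (continuous_pi fun i => ?_) (by fun_prop)
    exact this.comp (f := fun q : (Fin m → Input d) × (Fin n → Input d) × (Fin n → ℝ) =>
      (q.1, q.2.1 i)) (by fun_prop)
  exact hc.measurable.comp_aemeasurable
    (h.law_W.aemeasurable.prodMk (h.law_z.aemeasurable.prodMk h.law_e.aemeasurable))

lemma IsModel.integral_features (h : IsModel P σ ν W z e g) (hd : 0 < d)
    (hs : IsActivation (deriv σ) s₁ s₂ M) (hF : Continuous F) (hB : ∀ q, |F q| ≤ B) :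
    ∫ x, F ((fun i => featureMap σ (W x) (z x i)), e x) ∂P =
      ∫ y, ∫ w, ∫ u, F ((fun i => featureMap σ w (u i)), y)
        ∂(Measure.pi fun _ => stdGaussian (Input d)) ∂(Measure.pi fun _ => sphereUniform d)
        ∂(Measure.pi fun _ => ν) := by
  have := isProbabilityMeasure_sphereUniform hd
  have hc : Continuous fun q : (Fin m → Input d) × (Fin n → Input d) × (Fin n → ℝ) =>
      F ((fun i => featureMap σ q.1 (q.2.1 i)), q.2.2) := by
    have := continuous_featureMap_uncurry (m := m) (d := d) hs
    refine hF.comp (Continuous.prodMk (continuous_pi fun i => ?_) (by fun_prop))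
    exact this.comp (f := fun q : (Fin m → Input d) × (Fin n → Input d) × (Fin n → ℝ) =>
      (q.1, q.2.1 i)) (by fun_prop)
  have hze := h.law_z.aemeasurable.prodMk h.law_e.aemeasurable
  have hlaw : P.map (fun x => (W x, (z x, e x))) =
      (Measure.pi fun _ => sphereUniform d).prod
        ((Measure.pi fun _ => stdGaussian (Input d)).prod (Measure.pi fun _ => ν)) := by
    rw [(indepFun_iff_map_prod_eq_prod_map_map h.law_W.aemeasurable hze).1 h.indep_W_ze,
      (indepFun_iff_map_prod_eq_prod_map_map h.law_z.aemeasurable h.law_e.aemeasurable).1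
        h.indep_z_e, h.law_W.map_eq, h.law_z.map_eq, h.law_e.map_eq]
  have h1 : ∫ x, F ((fun i => featureMap σ (W x) (z x i)), e x) ∂P =
      ∫ q, F ((fun i => featureMap σ q.1 (q.2.1 i)), q.2.2)
        ∂(P.map (fun x => (W x, (z x, e x)))) :=
    (integral_map (h.law_W.aemeasurable.prodMk hze) hc.aestronglyMeasurable).symm
  rw [h1, hlaw, integral_prod_symm _
    (Integrable.of_bound hc.aestronglyMeasurable B (ae_of_all _ fun q => hB _)),
    integral_prod_symm]
  · refine integral_congr_ae (ae_of_all _ fun y => ?_)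
    have hcy : Continuous fun q : (Fin n → Input d) × (Fin m → Input d) =>
        F ((fun i => featureMap σ q.2 (q.1 i)), y) :=
      hc.comp (f := fun q : (Fin n → Input d) × (Fin m → Input d) => (q.2, (q.1, y))) (by fun_prop)
    exact integral_integral_swap (f := fun (u : Fin n → Input d) (w : Fin m → Input d) =>
      F ((fun i => featureMap σ w (u i)), y))
      (Integrable.of_bound hcy.aestronglyMeasurable B (ae_of_all _ fun q => hB _))
  · have hm : StronglyMeasurable fun q : ((Fin n → Input d) × (Fin n → ℝ)) × (Fin m → Input d) =>
        F ((fun i => featureMap σ q.2 (q.1.1 i)), q.1.2) :=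
      (hc.comp continuous_swap).stronglyMeasurable
    exact Integrable.of_bound hm.integral_prod_right'.aestronglyMeasurable B
      (ae_of_all _ fun q => abs_integral_le_of_abs_le fun w => hB _)

/-- Only the law of (W, g, e) enters: independence splits off the noise, and the conditional
distribution of g disintegrates the rest over W. -/
lemma IsModel.integral_gaussianFeatures (h : IsModel P σ ν W z e g) (hF : Continuous F)
    (hB : ∀ q, |F q| ≤ B) :
    ∫ x, F (g x, e x) ∂P =
      ∫ y, ∫ w, ∫ u, F (u, y) ∂(condDistrib g W P w) ∂(Measure.pi fun _ => sphereUniform d)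
        ∂(Measure.pi fun _ => ν) := by
  have : IsProbabilityMeasure (P.map W) := Measure.isProbabilityMeasure_map h.law_W.aemeasurable
  have hWg := h.law_W.aemeasurable.prodMk h.aemeasurable_g
  have : IsProbabilityMeasure (P.map fun x => (W x, g x)) := Measure.isProbabilityMeasure_map hWg
  have hc : Continuous fun q : ((Fin m → Input d) × (Fin n → Feat m d)) × (Fin n → ℝ) =>
      F (q.1.2, q.2) := by fun_prop
  have h1 : ∫ x, F (g x, e x) ∂P =
      ∫ q, F (q.1.2, q.2) ∂(P.map (fun x => ((W x, g x), e x))) :=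
    (integral_map (hWg.prodMk h.law_e.aemeasurable) hc.aestronglyMeasurable).symm
  rw [h1, (indepFun_iff_map_prod_eq_prod_map_map hWg h.law_e.aemeasurable).1 h.indep_Wg_e,
    h.law_e.map_eq, integral_prod_symm _
    (Integrable.of_bound hc.aestronglyMeasurable B (ae_of_all _ fun q => hB _))]
  refine integral_congr_ae (ae_of_all _ fun y => ?_)
  have hcy : Continuous fun q : (Fin m → Input d) × (Fin n → Feat m d) => F (q.2, y) := by fun_prop
  simp only
  rw [← compProd_map_condDistrib h.aemeasurable_g, Measure.integral_compProd
    (Integrable.of_bound hcy.aestronglyMeasurable B (ae_of_all _ fun q => hB _)), h.law_W.map_eq]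

/-- If the conditional expectations given good weights and the noise are close, then so are the
expectations. -/
theorem IsModel.abs_integral_sub_le (h : IsModel P σ ν W z e g) (hd : 0 < d)
    (hs : IsActivation (deriv σ) s₁ s₂ M) (hF : Continuous F) (hB : ∀ q, |F q| ≤ B) {ω ε b : ℝ}
    (hε : 0 ≤ ε)
    (hbad : (Measure.pi fun _ : Fin m => sphereUniform d).real {w | ¬ BddFamily ω w} ≤ b)
    (hgood : ∀ w : Fin m → Input d, BddFamily ω w → (∀ j, ‖w j‖ = 1) → ∀ y : Fin n → ℝ,
      |∫ u, F ((fun i => featureMap σ w (u i)), y) ∂(Measure.pi fun _ => stdGaussian (Input d)) -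
        ∫ u, F (u, y) ∂(Measure.pi fun _ => multivariateGaussian 0 (featureCov σ w))| ≤ ε) :
    |∫ x, F ((fun i => featureMap σ (W x) (z x i)), e x) ∂P - ∫ x, F (g x, e x) ∂P| ≤
      ε + 2 * B * b := by
  have := isProbabilityMeasure_sphereUniform hd
  have hB0 : 0 ≤ B := (abs_nonneg _).trans (hB 0)
  set π := Measure.pi fun _ : Fin m => sphereUniform d with hπ
  have hXm : StronglyMeasurable fun q : (Fin n → ℝ) × (Fin m → Input d) =>
      ∫ u, F ((fun i => featureMap σ q.2 (u i)), q.1)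
        ∂(Measure.pi fun _ => stdGaussian (Input d)) := by
    have hc : Continuous fun q : ((Fin n → ℝ) × (Fin m → Input d)) × (Fin n → Input d) =>
        F ((fun i => featureMap σ q.1.2 (q.2 i)), q.1.1) := by
      have := continuous_featureMap_uncurry (m := m) (d := d) hs
      refine hF.comp (Continuous.prodMk (continuous_pi fun i => ?_) (by fun_prop))
      exact this.comp (f := fun q : ((Fin n → ℝ) × (Fin m → Input d)) × (Fin n → Input d) =>
        (q.1.2, q.2 i)) (by fun_prop)
    exact hc.stronglyMeasurable.integral_prod_right'
  have hGm : StronglyMeasurable fun q : (Fin n → ℝ) × (Fin m → Input d) =>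
      ∫ u, F (u, q.1) ∂(condDistrib g W P q.2) := by
    have hc : Continuous fun q : ((Fin n → ℝ) × (Fin m → Input d)) × (Fin n → Feat m d) =>
        F (q.2, q.1.1) := by fun_prop
    exact hc.stronglyMeasurable.integral_kernel_prod_right'
      (κ := (condDistrib g W P).comap Prod.snd measurable_snd)
  have hXi : ∀ y, Integrable (fun w : Fin m → Input d =>
      ∫ u, F ((fun i => featureMap σ w (u i)), y)
        ∂(Measure.pi fun _ => stdGaussian (Input d))) π := fun y =>
    Integrable.of_bound (hXm.comp_measurable measurable_prodMk_left).aestronglyMeasurable B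
      (ae_of_all _ fun w => abs_integral_le_of_abs_le fun u => hB _)
  have hGi : ∀ y, Integrable (fun w : Fin m → Input d =>
      ∫ u, F (u, y) ∂(condDistrib g W P w)) π := fun y =>
    Integrable.of_bound (hGm.comp_measurable measurable_prodMk_left).aestronglyMeasurable B
      (ae_of_all _ fun w => abs_integral_le_of_abs_le fun u => hB _)
  have hae : ∀ᵐ w ∂π, (∀ j, ‖w j‖ = 1) ∧
      condDistrib g W P w = Measure.pi fun _ => multivariateGaussian 0 (featureCov σ w) := by
    refine Filter.Eventually.and (ae_all_iff.2 fun j => ?_) ?_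
    · exact (measurePreserving_eval (fun _ : Fin m => sphereUniform d)
        j).quasiMeasurePreserving.ae norm_eq_one_ae_sphereUniform
    · rw [hπ, ← h.law_W.map_eq]
      exact h.cond_law_g
  rw [h.integral_features hd hs hF hB, h.integral_gaussianFeatures hF hB, ← integral_sub
    (Integrable.of_bound hXm.integral_prod_right'.aestronglyMeasurable B (ae_of_all _ fun y =>
      abs_integral_le_of_abs_le fun w => abs_integral_le_of_abs_le fun u => hB _))
    (Integrable.of_bound hGm.integral_prod_right'.aestronglyMeasurable B (ae_of_all _ fun y =>
      abs_integral_le_of_abs_le fun w => abs_integral_le_of_abs_le fun u => hB _))]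
  refine abs_integral_le_of_abs_le fun y => ?_
  rw [← integral_sub (hXi y) (hGi y)]
  have hnull := measureReal_eq_zero_iff (measure_ne_top _ _) |>.2 (ae_iff.1 hae)
  -- The exceptional set joins the ill-conditioned weights, of probability at most b, to the null
  -- set where a weight is not a unit vector or the conditional law of g is not the prescribed one.
  refine (abs_integral_le_of_abs_le_off ({w | ¬ BddFamily ω w} ∪ {w | ¬ ((∀ j, ‖w j‖ = 1) ∧
    condDistrib g W P w = Measure.pi fun _ => multivariateGaussian 0 (featureCov σ w))})
    hε (b := 2 * B) ?_ ?_).trans ?_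
  · intro w hw
    simp only [Set.mem_union, Set.mem_ofPred_eq, not_or, not_not] at hw
    rw [hw.2.2]
    exact hgood w hw.1 hw.2.1 y
  · intro w
    refine (abs_sub _ _).trans ?_
    rw [two_mul]
    exact add_le_add (abs_integral_le_of_abs_le fun u => hB _)
      (abs_integral_le_of_abs_le fun u => hB _)
  · have := measureReal_union_le (μ := π) {w | ¬ BddFamily ω w} {w | ¬ ((∀ j, ‖w j‖ = 1) ∧
      condDistrib g W P w = Measure.pi fun _ => multivariateGaussian 0 (featureCov σ w))}
    rw [hnull, add_zero] at this
    exact add_le_add_right (mul_le_mul_of_nonneg_left (this.trans hbad) (by positivity)) _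

end Model

/-! ### Consequences of closeness for bounded Lipschitz test functions -/

section Comparison

variable {Ω : ℕ → Type*} [∀ n, MeasurableSpace (Ω n)] {P : ∀ n, Measure (Ω n)}
  [∀ n, IsProbabilityMeasure (P n)] {X Y : ∀ n, Ω n → ℝ}

/-- Asymptotic equality of the expectations of bounded Lipschitz functions. -/
def AsympEqInLaw (P : ∀ n, Measure (Ω n)) (X Y : ∀ n, Ω n → ℝ) : Prop :=
  ∀ ψ : ℝ → ℝ, (∃ B : ℝ, ∀ t, |ψ t| ≤ B) → (∃ L : ℝ≥0, LipschitzWith L ψ) →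
    Tendsto (fun n => |∫ ω, ψ (X n ω) ∂(P n) - ∫ ω, ψ (Y n ω) ∂(P n)|) atTop (𝓝 0)

lemma AsympEqInLaw.symm (h : AsympEqInLaw P X Y) : AsympEqInLaw P Y X := fun ψ hB hL => by
  simpa only [abs_sub_comm] using h ψ hB hL

/-- Clamping `f` to [0, 1] gives a Lipschitz function between the indicators of f ≥ 1 and f ≥ 0. The
tail comparisons and the convergence in probability are all instances for a suitable `f`. -/
lemma AsympEqInLaw.eventually_measureReal_le (h : AsympEqInLaw P X Y)
    (hX : ∀ n, AEMeasurable (X n) (P n)) {f : ℝ → ℝ}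
    {L : ℝ≥0} (hf : LipschitzWith L f) {ε : ℝ} (hε : 0 < ε) :
    ∀ᶠ n in atTop, (P n).real {ω | 1 ≤ f (X n ω)} - (P n).real {ω | 0 ≤ f (Y n ω)} ≤ ε := by
  set ψ : ℝ → ℝ := fun t => max 0 (min 1 (f t)) with hψ
  have hψL : LipschitzWith L ψ := (hf.const_min 1).const_max 0
  have h0 : ∀ t, 0 ≤ ψ t := fun t => le_max_left _ _
  have h1 : ∀ t, ψ t ≤ 1 := fun t => max_le zero_le_one (min_le_left _ _)
  have hB : ∀ t, |ψ t| ≤ 1 := fun t => by rw [abs_of_nonneg (h0 t)]; exact h1 t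
  have hint : ∀ n, Integrable (fun ω => ψ (X n ω)) (P n) := fun n =>
    Integrable.of_bound (hψL.continuous.measurable.comp_aemeasurable (hX n)).aestronglyMeasurable 1
      (ae_of_all _ fun ω => hB _)
  filter_upwards [(h ψ ⟨1, hB⟩ ⟨L, hψL⟩).eventually_lt_const hε] with n hn
  have hl : (P n).real {ω | 1 ≤ f (X n ω)} ≤ ∫ ω, ψ (X n ω) ∂(P n) := by
    have := mul_meas_ge_le_integral_of_nonneg (ae_of_all _ fun ω => h0 (X n ω)) (hint n) 1
    rw [one_mul] at this
    refine (measureReal_mono (fun ω hω => ?_) (measure_ne_top _ _)).trans this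
    have hω' : 1 ≤ f (X n ω) := hω
    exact le_max_of_le_right (le_min le_rfl hω')
  have hu : ∫ ω, ψ (Y n ω) ∂(P n) ≤ (P n).real {ω | 0 ≤ f (Y n ω)} := by
    have := abs_integral_le_of_abs_le_off (μ := P n) (f := fun ω => ψ (Y n ω))
      {ω | 0 ≤ f (Y n ω)} le_rfl (fun ω hω => by
        have hω' : f (Y n ω) < 0 := not_le.1 hω
        rw [abs_of_nonneg (h0 _)]
        exact max_le le_rfl ((min_le_right _ _).trans hω'.le)) fun ω => hB _
    linarith [le_abs_self (∫ ω, ψ (Y n ω) ∂(P n))]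
  linarith [le_abs_self (∫ ω, ψ (X n ω) ∂(P n) - ∫ ω, ψ (Y n ω) ∂(P n))]

lemma limsup_measureReal_sub_le_zero {A A' : ∀ n, Set (Ω n)}
    (h : ∀ ε > 0, ∀ᶠ n in atTop, (P n).real (A n) - (P n).real (A' n) ≤ ε) :
    limsup (fun n => (P n).real (A n) - (P n).real (A' n)) atTop ≤ 0 := by
  have hb : IsBoundedUnder (· ≥ ·) atTop fun n => (P n).real (A n) - (P n).real (A' n) :=
    isBoundedUnder_of ⟨-1, fun n => by
      have h1 : (P n).real (A' n) ≤ 1 := measureReal_le_one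
      have h2 : 0 ≤ (P n).real (A n) := measureReal_nonneg
      simp only [ge_iff_le]
      linarith⟩
  refine le_of_forall_pos_le_add fun ε hε => ?_
  rw [zero_add]
  exact limsup_le_of_le hb.isCoboundedUnder_le (h ε hε)

lemma AsympEqInLaw.limsup_le (h : AsympEqInLaw P X Y)
    (hX : ∀ n, AEMeasurable (X n) (P n)) (ρ : ℝ) {δ : ℝ}
    (hδ : 0 < δ) :
    limsup (fun n => (P n).real {ω | ρ + δ ≤ X n ω} - (P n).real {ω | ρ ≤ Y n ω}) atTop ≤ 0 ∧
      limsup (fun n => (P n).real {ω | X n ω ≤ ρ - δ} - (P n).real {ω | Y n ω ≤ ρ}) atTop ≤ 0 := by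
  constructor
  · refine limsup_measureReal_sub_le_zero fun ε hε => ?_
    have hf : LipschitzWith (NNReal.mk δ⁻¹ (by positivity)) fun t => (t - ρ) / δ :=
      LipschitzWith.of_dist_le_mul fun x y => by
        rw [Real.dist_eq, Real.dist_eq, ← sub_div, sub_sub_sub_cancel_right, abs_div,
          abs_of_pos hδ, div_eq_inv_mul, NNReal.coe_mk]
    filter_upwards [h.eventually_measureReal_le hX hf hε] with n hn
    have h1 : ∀ t, 1 ≤ (t - ρ) / δ ↔ ρ + δ ≤ t := fun t => by
      rw [one_le_div hδ, le_sub_iff_add_le, add_comm]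
    have h2 : ∀ t, 0 ≤ (t - ρ) / δ ↔ ρ ≤ t := fun t => by
      rw [le_div_iff₀ hδ, zero_mul, sub_nonneg]
    simpa only [h1, h2] using hn
  · refine limsup_measureReal_sub_le_zero fun ε hε => ?_
    have hf : LipschitzWith (NNReal.mk δ⁻¹ (by positivity)) fun t => (ρ - t) / δ :=
      LipschitzWith.of_dist_le_mul fun x y => by
        rw [Real.dist_eq, Real.dist_eq, ← sub_div, sub_sub_sub_cancel_left, abs_div,
          abs_of_pos hδ, div_eq_inv_mul, NNReal.coe_mk, abs_sub_comm]
    filter_upwards [h.eventually_measureReal_le hX hf hε] with n hn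
    have h1 : ∀ t, 1 ≤ (ρ - t) / δ ↔ t ≤ ρ - δ := fun t => by
      rw [one_le_div hδ, le_sub_comm]
    have h2 : ∀ t, 0 ≤ (ρ - t) / δ ↔ t ≤ ρ := fun t => by
      rw [le_div_iff₀ hδ, zero_mul, sub_nonneg]
    simpa only [h1, h2] using hn

lemma AsympEqInLaw.tendstoInProb (h : AsympEqInLaw P X Y)
    (hX : ∀ n, AEMeasurable (X n) (P n)) {ρ : ℝ}
    (hρ : TendstoInProb P Y ρ) : TendstoInProb P X ρ := by
  intro δ hδ
  -- This function reaches 1 where |t - ρ| = δ and 0 where |t - ρ| = δ/2, so deviations δ of X are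
  -- compared with deviations δ/2 of Y.
  have hf : LipschitzWith (NNReal.mk (2 / δ) (by positivity)) fun t => 2 * |t - ρ| / δ - 1 :=
    LipschitzWith.of_dist_le_mul fun x y => by
      rw [Real.dist_eq, Real.dist_eq, sub_sub_sub_cancel_right, ← sub_div, ← mul_sub,
        mul_div_right_comm, abs_mul, abs_of_pos (by positivity : 0 < 2 / δ), NNReal.coe_mk]
      refine mul_le_mul_of_nonneg_left ((abs_abs_sub_abs_le _ _).trans_eq ?_) (by positivity)
      rw [sub_sub_sub_cancel_right]
  have h1 : ∀ t, 1 ≤ 2 * |t - ρ| / δ - 1 ↔ δ ≤ |t - ρ| := fun t => by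
    rw [le_sub_iff_add_le, le_div_iff₀ hδ]
    constructor <;> intro _ <;> linarith
  have h2 : ∀ t, 0 ≤ 2 * |t - ρ| / δ - 1 ↔ δ / 2 ≤ |t - ρ| := fun t => by
    rw [sub_nonneg, one_le_div hδ]
    constructor <;> intro _ <;> linarith
  refine tendsto_order.2 ⟨fun a ha => Eventually.of_forall fun n =>
    ha.trans_le measureReal_nonneg, fun a ha => ?_⟩
  filter_upwards [h.eventually_measureReal_le hX hf (half_pos ha),
    (hρ (δ / 2) (half_pos hδ)).eventually_lt_const (half_pos ha)] with n hn hn'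
  simp only [h1, h2] at hn
  linarith

end Comparison

end NTK

end

/-- Universality of the training error for the two-layer neural tangent model. Every object may
depend on the sample size `n`; only `γ, γt, R, K, k, ks, Kr` and `σ` are fixed. -/
theorem corollary3p1
    -- fixed constants
    (γ γt R : ℝ) (K : ℝ≥0) (k ks : ℕ) (Kr : ℝ≥0 → ℝ)
    (hγ : 0 < γ) (hγt : 0 < γt) (hR : 0 < R) (hK : 0 < K) (hk : 0 < k) (hks : 0 < ks)
    (hKr : ∀ B, 0 < Kr B)
    -- activation function
    (σ : ℝ → ℝ)
    (hσ_diff : ∀ j < 4, Differentiable ℝ (iteratedDeriv j σ))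
    (hσ_bdd : ∃ M : ℝ, ∀ j, 1 ≤ j → j ≤ 4 → ∀ t, |iteratedDeriv j σ t| ≤ M)
    (hσ_mean : ∫ t, deriv σ t ∂(gaussianReal 0 1) = 0)
    (hσ_cov : ∫ t, t * deriv σ t ∂(gaussianReal 0 1) = 0)
    -- dimensions, with `p = m d`
    (m d : ℕ → ℕ) (hm : ∀ n, 0 < m n) (hd : ∀ n, 0 < d n)
    (hmd : Tendsto (fun n => (m n : ℝ) / d n) atTop (𝓝 γt))
    (hp : Tendsto (fun n => ((m n * d n : ℕ) : ℝ) / n) atTop (𝓝 γ))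
    -- random variables
    {Ω : ℕ → Type*} [∀ n, MeasurableSpace (Ω n)] (P : ∀ n, Measure (Ω n))
    [∀ n, IsProbabilityMeasure (P n)]
    (ν : ℕ → Measure ℝ) [∀ n, IsProbabilityMeasure (ν n)]
    (W : ∀ n, Ω n → Fin (m n) → NTK.Input (d n))
    (z : ∀ n, Ω n → Fin n → NTK.Input (d n))
    (e : ∀ n, Ω n → Fin n → ℝ)
    (g : ∀ n, Ω n → Fin n → NTK.Feat (m n) (d n))
    (hmodel : ∀ n, NTK.IsModel (P n) σ (ν n) (W n) (z n) (e n) (g n))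
    (hnoise : ∀ n i, NTK.psi2Norm (fun ω => e n ω i) (P n) ≤ K)
    -- loss and labeling function
    (ℓ : ℕ → EuclideanSpace ℝ (Fin k) → ℝ → ℝ) (η : ℕ → EuclideanSpace ℝ (Fin ks) → ℝ → ℝ)
    (hℓ_nonneg : ∀ n u y, 0 ≤ ℓ n u y) (hℓ : ∀ n, NTK.IsLip K (ℓ n))
    (hη : ∀ n, NTK.IsLip K (η n))
    -- constraint set
    (C : ∀ n, Set (NTK.Feat (m n) (d n)))
    (hC_compact : ∀ n, IsCompact (C n)) (hC_nonempty : ∀ n, (C n).Nonempty)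
    (hC : ∀ n, C n ⊆ NTK.paramSet (m n) (d n) R)
    -- distribution parameters
    (Θs : ∀ n, NTK.Param (m n) (d n) ks)
    (hΘs : ∀ n j, Θs n j ∈ NTK.paramSet (m n) (d n) R)
    -- regularizer
    (r : ∀ n, NTK.Param (m n) (d n) k → ℝ)
    (hr : ∀ n (B : ℝ≥0), 0 < B → ∀ Θ₀ Θ₁ : NTK.Param (m n) (d n) k, ‖Θ₀‖ ≤ B → ‖Θ₁‖ ≤ B →
      |r n Θ₀ - r n Θ₁| ≤ Kr B * ‖Θ₀ - Θ₁‖)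
    -- optimal training errors for the neural tangent features and for the Gaussian features
    (RX RG : ∀ n, Ω n → ℝ)
    (hRX : ∀ n ω, RX n ω = NTK.minRisk (ℓ n) (r n) (C n)
      (fun i => NTK.featureMap σ (W n ω) (z n ω i))
      (NTK.response (η n) (Θs n) (fun i => NTK.featureMap σ (W n ω) (z n ω i)) (e n ω)))
    (hRG : ∀ n ω, RG n ω = NTK.minRisk (ℓ n) (r n) (C n) (g n ω)
      (NTK.response (η n) (Θs n) (g n ω) (e n ω))) :
    (∀ ψ : ℝ → ℝ, (∃ B : ℝ, ∀ t, |ψ t| ≤ B) → (∃ L : ℝ≥0, LipschitzWith L ψ) →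
      Tendsto (fun n => |∫ ω, ψ (RX n ω) ∂(P n) - ∫ ω, ψ (RG n ω) ∂(P n)|) atTop (𝓝 0)) ∧
    (∀ ρ δ : ℝ, 0 < δ →
      limsup (fun n => (P n).real {ω | ρ + δ ≤ RX n ω} - (P n).real {ω | ρ ≤ RG n ω})
        atTop ≤ 0 ∧
      limsup (fun n => (P n).real {ω | RX n ω ≤ ρ - δ} - (P n).real {ω | RG n ω ≤ ρ})
        atTop ≤ 0) ∧
    (∀ ρ : ℝ, NTK.TendstoInProb P RX ρ ↔ NTK.TendstoInProb P RG ρ) := by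
  obtain ⟨M, hM⟩ := hσ_bdd
  have hs := NTK.isActivation_deriv hσ_diff hM
  have hF : ∀ n, Continuous fun q : (Fin n → NTK.Feat (m n) (d n)) × (Fin n → ℝ) =>
      NTK.minRisk (ℓ n) (r n) (C n) q.1 (NTK.response (η n) (Θs n) q.1 q.2) := fun n =>
    NTK.continuous_minRisk (hℓ n) (hη n) (NTK.continuous_of_locally_lipschitz hKr (hr n))
      (hC_compact n) (Θs n)
  have hXm : ∀ n, AEMeasurable (RX n) (P n) := fun n => by
    have := (hF n).measurable.comp_aemeasurable ((hmodel n).aemeasurable_features hs)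
    exact this.congr (ae_of_all _ fun ω => (hRX n ω).symm)
  have hGm : ∀ n, AEMeasurable (RG n) (P n) := fun n => by
    have := (hF n).measurable.comp_aemeasurable
      ((hmodel n).aemeasurable_g.prodMk (hmodel n).law_e.aemeasurable)
    exact this.congr (ae_of_all _ fun ω => (hRG n ω).symm)
  have hlaw : NTK.AsympEqInLaw P RX RG := by
    rintro ψ ⟨B, hB⟩ ⟨L, hψ⟩
    have hB0 : 0 ≤ B := (abs_nonneg _).trans (hB 0)
    have hexp : Tendsto (fun n => 2 * B * Real.exp (-(m n : ℝ))) atTop (𝓝 0) := by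
      have := (Real.tendsto_exp_neg_atTop_nhds_zero.comp
        (NTK.tendsto_width hγ hγt hd hmd hp)).const_mul (2 * B)
      rwa [mul_zero] at this
    refine tendsto_order.2 ⟨fun a ha => Eventually.of_forall fun n => ha.trans_le (abs_nonneg _),
      fun a ha => ?_⟩
    -- The value of ω is the operator norm bound of `measure_not_bddFamily_le` for the aspect ratios
    -- Γ = γt + 1 and Γ' = 2/γt, which hold eventually.
    filter_upwards [NTK.eventually_abs_integral_minRisk_sub_le (K := K) (k := k) (ks := ks)
      (ω := Real.sqrt ((γt + 1) * (4 * ((2 / γt * Real.log 5 + Real.log 2 + 1) / (1 / 4)))))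
      hγ hγt hR hKr hs hσ_cov hd hmd hp hB hψ (half_pos ha), NTK.eventually_width_le hγt hd hmd,
      hexp.eventually_lt_const (half_pos ha)] with n h1 h2 h3
    have h4 := (hmodel n).abs_integral_sub_le (hd n) hs (hψ.continuous.comp (hF n))
      (fun q => hB _) (half_pos ha).le
      (NTK.measure_not_bddFamily_le (hd n) h2.1 h2.2 (by positivity) (by positivity))
      (fun w hw hw1 y => h1 w hw hw1 (ℓ n) (η n) (hℓ n) (hη n) (C n) (hC_compact n)
        (hC_nonempty n) (hC n) (Θs n) (hΘs n) (r n) (hr n) y)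
    simp only [Function.comp_apply, ← hRX, ← hRG] at h4
    linarith
  exact ⟨hlaw, fun ρ δ hδ => hlaw.limsup_le hXm ρ hδ, fun ρ =>
    ⟨fun h => hlaw.symm.tendstoInProb hGm h, fun h => hlaw.tendstoInProb hXm h⟩⟩
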